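/- Let $N\in\mathbb N$, $1<p<N$ and $\beta>p$. There exists $\theta_0=\theta_0(p,\beta,N)\in(0,1]$ with the following property. Let $q>N$ and $\lambda>0$, let $\Omega\subset\mathbb R^N$ be open, and let $\mathcal A:\Omega\times\mathbb R\times\mathbb R^N\to\mathbb R^N$ and $\mathcal B:\Omega\times\mathbb R\times\mathbb R^N\to\mathbb R$ be Carathéodory functions (measurable in $x$ for all $(\zeta,\xi)$, continuous in $(\zeta,\xi)$ for a.e. $x$) such that, for a.e. $x\in\Omega$ and all $(\zeta,\xi)\in\mathbb R\times\mathbb R^N$, $$\text{(s1)}\quad \mathcal A(x,\zeta,\xi)\cdot\xi\ \ge\ \lambda|\xi|^p-a_1(x)|\zeta|^p-a_2(x),$$ $$\text{(s2)}\quad |\mathcal B(x,\zeta,\xi)|\ \le\ b_1(x)|\xi|^{p-1}+b_2(x)|\zeta|^{p-1}+b_3(x),$$ $$\text{(s3)}\quad |\mathcal A(x,\zeta,\xi)|\ \le\ c_1(x)|\xi|^{p-1}+c_2(x)|\zeta|^{p-1}+c_3(x),$$ where $a_1,a_2,b_1,b_2,b_3\ge 0$ and $$b_1,c_1\in L^\infty(\Omega),\quad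 a_1,b_2\in L^{\frac qp}(\Omega),\quad c_2\in L^{\frac q{p-1}}(\Omega),$$ $$a_2,c_3\in L^{\frac\beta p}(\Omega)\cap L^\infty(\Omega),\quad b_3\in L^{\frac\beta{p-1}}(\Omega)\cap L^\infty(\Omega).$$ Let $u\in W^{1,p}_{loc}(\Omega)\cap L^\beta_{loc}(\Omega)$ be a weak solution of $-\mathrm{div}\,\mathcal A(x,u,\nabla u)=\mathcal B(x,u,\nabla u)$ in $\Omega$, i.e. $$\int_\Omega \mathcal A(x,u,\nabla u)\cdot\nabla\phi\,dx=\int_\Omega\mathcal B(x,u,\nabla u)\,\phi\,dx\qquad\text{for all }\phi\in C^1_c(\Omega)$$ (both integrands being integrable), and let $r>0$ and $B_r=B(x_0,r)$, $B_{2r}=B(x_0,2r)$ be concentric open balls with $B_{2r}\subset\Omega$. Then $$|u|_{\infty,B_r}\ \le\ C\max\Big\{\Big(\frac1{|B_{2r}|}\int_{B_{2r}}|u|^\beta\Big)^{\frac1\beta},\ \Big(\frac1{|B_{2r}|}\int_{B_{2r}}|u|^\beta\Big)^{\frac{\theta_0}\beta}\Big\}$$ (the right-hand side being $+\infty$ if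 $u\notin L^\beta(B_{2r})$), where $0<C<\infty$ depends only on $p,q,\beta,N,\lambda$ and, in a nondecreasing way, on the eight quantities $$r|b_1|_\infty,\quad |c_1|_\infty,\quad r^{p\delta_1}|a_1|_{\frac qp},\quad r^{p\delta_1}|b_2|_{\frac qp},\quad r^{(p-1)\delta_1}|c_2|_{\frac q{p-1}},\quad \|a_2\|_r,\quad \|b_3\|_r,\quad \|c_3\|_r.$$ Here $\delta_1=1-\frac Nq$, $\delta_2=1-\frac N\beta$, $$\|a_2\|_r=r^{p\delta_2}|a_2|_{\frac\beta p}+r^p|a_2|_\infty,\qquad \|b_3\|_r=r^{(p-1)\delta_2+1}|b_3|_{\frac\beta{p-1}}+r^p|b_3|_\infty,$$ $$\|c_3\|_r=r^{(p-1)\delta_2}|c_3|_{\frac\beta{p-1}}+r^{p-1}|c_3|_\infty,$$ and $|\cdot|_s$ denotes the $L^s$ norm over $B_{2r}$. -/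

import Mathlib

open MeasureTheory Metric Set
open scoped ENNReal ContDiff

noncomputable section

/-- The space `ℝ^N` with its Euclidean norm and Lebesgue measure. -/
abbrev Space (N : ℕ) : Type := EuclideanSpace ℝ (Fin N)

/-- Local `L^s` membership: `f ∈ L^s(K)` for every compact `K ⊆ Ω`. -/
def MemLpLoc {N : ℕ} {F : Type*} [NormedAddCommGroup F] (s : ℝ≥0∞) (Ω : Set (Space N))
    (f : Space N → F) : Prop :=
  ∀ K : Set (Space N), K ⊆ Ω → IsCompact K → MemLp f s (volume.restrict K)

/-- `Du` is the weak (distributional) gradient of `u` on the open set `Ω`. -/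
def IsWeakGradient {N : ℕ} (Ω : Set (Space N)) (u : Space N → ℝ) (Du : Space N → Space N) :
    Prop :=
  LocallyIntegrableOn u Ω volume ∧ LocallyIntegrableOn Du Ω volume ∧
    ∀ φ : Space N → ℝ, ContDiff ℝ ∞ φ → HasCompactSupport φ → tsupport φ ⊆ Ω →
      ∫ x in Ω, u x • gradient φ x = - ∫ x in Ω, φ x • Du x

/-- `u ∈ W^{1,p}_loc(Ω)`, with weak gradient `Du` (which is unique up to a null set). -/
def MemW1pLoc {N : ℕ} (p : ℝ) (Ω : Set (Space N)) (u : Space N → ℝ)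
    (Du : Space N → Space N) : Prop :=
  IsWeakGradient Ω u Du ∧ MemLpLoc (ENNReal.ofReal p) Ω u ∧ MemLpLoc (ENNReal.ofReal p) Ω Du

/-- Carathéodory functions on `Ω × ℝ × ℝ^N`: Lebesgue measurable in `x ∈ Ω` for all `(ζ, ξ)`,
and continuous in `(ζ, ξ)` for almost every `x ∈ Ω`. -/
def IsCaratheodory {N : ℕ} {F : Type*} [NormedAddCommGroup F] (Ω : Set (Space N))
    (f : Space N → ℝ → Space N → F) : Prop :=
  (∀ (ζ : ℝ) (ξ : Space N), AEStronglyMeasurable (fun x => f x ζ ξ) (volume.restrict Ω)) ∧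
    ∀ᵐ x ∂(volume.restrict Ω), Continuous fun z : ℝ × Space N => f x z.1 z.2

/-- Structure condition (s1). -/
def StructureS1 {N : ℕ} (p lam : ℝ) (Ω : Set (Space N)) (A : Space N → ℝ → Space N → Space N)
    (a₁ a₂ : Space N → ℝ) : Prop :=
  ∀ᵐ x ∂(volume.restrict Ω), ∀ (ζ : ℝ) (ξ : Space N),
    lam * ‖ξ‖ ^ p - a₁ x * |ζ| ^ p - a₂ x ≤ inner ℝ (A x ζ ξ) ξ

/-- Structure condition (s2). -/
def StructureS2 {N : ℕ} (p : ℝ) (Ω : Set (Space N)) (B : Space N → ℝ → Space N → ℝ)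
    (b₁ b₂ b₃ : Space N → ℝ) : Prop :=
  ∀ᵐ x ∂(volume.restrict Ω), ∀ (ζ : ℝ) (ξ : Space N),
    |B x ζ ξ| ≤ b₁ x * ‖ξ‖ ^ (p - 1) + b₂ x * |ζ| ^ (p - 1) + b₃ x

/-- Structure condition (s3). -/
def StructureS3 {N : ℕ} (p : ℝ) (Ω : Set (Space N)) (A : Space N → ℝ → Space N → Space N)
    (c₁ c₂ c₃ : Space N → ℝ) : Prop :=
  ∀ᵐ x ∂(volume.restrict Ω), ∀ (ζ : ℝ) (ξ : Space N),
    ‖A x ζ ξ‖ ≤ c₁ x * ‖ξ‖ ^ (p - 1) + c₂ x * |ζ| ^ (p - 1) + c₃ x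

/-- `u`, with weak gradient `Du`, is a weak solution of `-div A(x, u, ∇u) = B(x, u, ∇u)` in `Ω`,
tested against `C^1_c(Ω)`. -/
def IsWeakSolution {N : ℕ} (Ω : Set (Space N)) (A : Space N → ℝ → Space N → Space N)
    (B : Space N → ℝ → Space N → ℝ) (u : Space N → ℝ) (Du : Space N → Space N) : Prop :=
  ∀ φ : Space N → ℝ, ContDiff ℝ 1 φ → HasCompactSupport φ → tsupport φ ⊆ Ω →
    IntegrableOn (fun x => (inner ℝ (A x (u x) (Du x)) (gradient φ x) : ℝ)) Ω volume ∧
    IntegrableOn (fun x => B x (u x) (Du x) * φ x) Ω volume ∧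
    ∫ x in Ω, (inner ℝ (A x (u x) (Du x)) (gradient φ x) : ℝ) =
      ∫ x in Ω, B x (u x) (Du x) * φ x

/-- The `L^s(V)` norm as a real number; only used for functions that belong to `L^s(V)`. -/
def normOn {N : ℕ} (s : ℝ≥0∞) (V : Set (Space N)) (f : Space N → ℝ) : ℝ :=
  (eLpNorm f s (volume.restrict V)).toReal

/-- The scaled norm `‖a₂‖_r`, taken over `V`. -/
def scaledNormA2 {N : ℕ} (p β r : ℝ) (V : Set (Space N)) (a₂ : Space N → ℝ) : ℝ :=
  r ^ (p * (1 - N / β)) * normOn (ENNReal.ofReal (β / p)) V a₂ + r ^ p * normOn ∞ V a₂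

/-- The scaled norm `‖b₃‖_r`, taken over `V`. -/
def scaledNormB3 {N : ℕ} (p β r : ℝ) (V : Set (Space N)) (b₃ : Space N → ℝ) : ℝ :=
  r ^ ((p - 1) * (1 - N / β) + 1) * normOn (ENNReal.ofReal (β / (p - 1))) V b₃ +
    r ^ p * normOn ∞ V b₃

/-- The scaled norm `‖c₃‖_r`, taken over `V`. -/
def scaledNormC3 {N : ℕ} (p β r : ℝ) (V : Set (Space N)) (c₃ : Space N → ℝ) : ℝ :=
  r ^ ((p - 1) * (1 - N / β)) * normOn (ENNReal.ofReal (β / (p - 1))) V c₃ +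
    r ^ (p - 1) * normOn ∞ V c₃

/-- The list of data norms over `V` on which the constant of the estimate depends. -/
def dataNorms {N : ℕ} (p q β r : ℝ) (V : Set (Space N))
    (a₁ a₂ b₁ b₂ b₃ c₁ c₂ c₃ : Space N → ℝ) : Fin 8 → ℝ :=
  ![r * normOn ∞ V b₁,
    normOn ∞ V c₁,
    r ^ (p * (1 - N / q)) * normOn (ENNReal.ofReal (q / p)) V a₁,
    r ^ (p * (1 - N / q)) * normOn (ENNReal.ofReal (q / p)) V b₂,
    r ^ ((p - 1) * (1 - N / q)) * normOn (ENNReal.ofReal (q / (p - 1))) V c₂,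
    scaledNormA2 p β r V a₂,
    scaledNormB3 p β r V b₃,
    scaledNormC3 p β r V c₃]

end

/-!
Local boundedness is proved by De Giorgi's iteration, with truncations `(u - k)⁺` as test functions.

On the ball of radius `2 r` the data enter only through `LocalSolution`: the coefficients of `u` are
absorbed into one weight `h ∈ L^q` with `q > N`, and `b₁, c₁, a₂, b₃, c₃` are bounded by `Λ` times
the power of `r` that scaling dictates (`exists_localSolution`).

The equation is given for `C¹` test functions. Mollification of `χ u` shows that `η (u - k)⁺` is a
limit in `W^{1,p}` of `C¹` functions with support in the ball (`IsSobolevLimit`,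
`MemW1pLoc.isSobolevLimit_posPart`), and the growth conditions allow passage to the limit in the
weak formulation (`LocalSolution.weak_of_isSobolevLimit`). Testing with `η^p (u - k)⁺` gives a
Caccioppoli inequality on `{u > k}` (`LocalSolution.lintegral_energy_le`). Since `q > N`, Hölder's
inequality interpolates the weighted term `h η (u - k)⁺` between `L^p` and the Sobolev exponent,
so a small multiple of the Sobolev norm absorbs it (`lintegral_mul_rpow_le_add`,
`LocalSolution.exists_sobolev_truncation_le`).

With Chebyshev's inequality this bounds the energy `Y' = ∫ ((u - k')⁺)^p` on a smaller ball by
`Y^{1 + p/N}` and `Y^{1 + p/N - p/q}` for the energy `Y` at a lower level `k < k'` on a larger ball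
(`LocalSolution.exists_level_step`). Along radii decreasing to `r` and levels increasing to `k` the
energies decay geometrically, hence `u ≤ k`, provided `z = c M^p / k^p` is small in the sense that
`(1 + k^{-p}) z^{p/N} + z^{p/N - p/q}` is small, where `M` is the `L^β` mean of `|u|`. The summand
`k^{-p}` comes from the part of the equation that is inhomogeneous in `u`; the choice
`k = K max (M, M^θ)` with `θ = p / (p + N)` balances it (`exists_level_factor`), and this `θ` is the
exponent `θ₀` of the estimate. The same bound for `-u`, which solves an equation of the same type,
finishes the proof.
-/

/-! ### Translations and mollification in `L^p` -/

/-- Translations act continuously on `L^p`. -/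
theorem exists_eLpNorm_translate_sub_le {N : ℕ} {E : Type*} [NormedAddCommGroup E]
    {p : ℝ≥0∞} (hp : 1 ≤ p) (hp' : p ≠ ⊤) {f : Space N → E} (hf : MemLp f p volume)
    {ε : ℝ≥0∞} (hε : ε ≠ 0) :
    ∃ δ > 0, ∀ y : Space N, ‖y‖ < δ →
      eLpNorm (fun x => f (x - y) - f x) p volume ≤ ε := by
  have : Fact (1 ≤ p) := ⟨hp⟩
  let g : Space N → C(Space N, Space N) := fun y => ⟨fun x => x - y, by fun_prop⟩
  have hgm : ∀ y, MeasurePreserving (g y) volume volume := fun y =>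
    measurePreserving_sub_right volume y
  have hgc : Continuous g := by
    have : Continuous (fun z : Space N × Space N => z.2 - z.1) := by fun_prop
    exact (ContinuousMap.curry ⟨_, this⟩).continuous
  have key := Continuous.compMeasurePreservingLp (f := fun _ : Space N => hf.toLp f) (p := p)
    continuous_const hgc hgm hp'
  have h0 : (Lp.compMeasurePreserving (g 0) (hgm 0)) (hf.toLp f) = hf.toLp f := by
    apply Lp.ext
    refine (Lp.coeFn_compMeasurePreserving _ (hgm 0)).trans ?_
    refine Filter.Eventually.of_forall fun x => ?_
    simp [g]
  have h1 := EMetric.tendsto_nhds.1 (key.tendsto 0) ε (pos_iff_ne_zero.2 hε)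
  obtain ⟨δ, hδ, h2⟩ := Metric.eventually_nhds_iff.1 h1
  refine ⟨δ, hδ, fun y hy => ?_⟩
  have h3 := h2 (y := y) (by simpa using hy)
  simp only [h0] at h3
  rw [Lp.edist_def] at h3
  refine le_trans (le_of_eq ?_) h3.le
  refine eLpNorm_congr_ae ?_
  have e1 : (Lp.compMeasurePreserving (g y) (hgm y) (hf.toLp f) : Space N → E) =ᵐ[volume]
      fun x => f (x - y) := by
    refine (Lp.coeFn_compMeasurePreserving _ (hgm y)).trans ?_
    exact (hgm y).quasiMeasurePreserving.ae_eq_comp hf.coeFn_toLp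
  filter_upwards [e1, hf.coeFn_toLp] with x a b
  rw [Pi.sub_apply, a, b]

/-- Jensen's inequality for the weight `w` of total mass at most one. -/
theorem lintegral_mul_rpow_le_of_mass_le_one {α : Type*} [MeasurableSpace α] {μ : Measure α}
    {p : ℝ} (hp : 1 ≤ p) {w F : α → ℝ≥0∞} (hw : AEMeasurable w μ) (hF : AEMeasurable F μ)
    (hw1 : ∫⁻ x, w x ∂μ ≤ 1) :
    (∫⁻ x, w x * F x ∂μ) ^ p ≤ ∫⁻ x, w x * F x ^ p ∂μ := by
  have hp0 : 0 < p := by linarith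
  have h1 : ∀ x, w x * F x = w x ^ (1 - 1 / p) * (w x * F x ^ p) ^ (1 / p) := by
    intro x
    rw [ENNReal.mul_rpow_of_nonneg _ _ (by positivity), ← ENNReal.rpow_mul,
      mul_one_div_cancel hp0.ne', ENNReal.rpow_one, ← mul_assoc, ← ENNReal.rpow_add_of_nonneg _ _ _ (by positivity)]
    · simp
    · rw [sub_nonneg, div_le_one hp0]; exact hp
  have hq : 0 ≤ 1 - 1 / p := by rw [sub_nonneg, div_le_one hp0]; exact hp
  have h2 := ENNReal.lintegral_mul_norm_pow_le (μ := μ) hw (hw.mul (hF.pow_const p))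
    (p := 1 - 1 / p) (q := 1 / p) hq (by positivity) (by ring)
  calc (∫⁻ x, w x * F x ∂μ) ^ p
      = (∫⁻ x, w x ^ (1 - 1 / p) * (w x * F x ^ p) ^ (1 / p) ∂μ) ^ p := by
        congr 1; exact lintegral_congr h1
    _ ≤ (1 * (∫⁻ x, w x * F x ^ p ∂μ) ^ (1 / p)) ^ p := by
        gcongr
        refine h2.trans ?_
        gcongr
        · exact ENNReal.rpow_le_one hw1 hq
        · exact le_rfl
    _ = _ := by
        rw [one_mul, ← ENNReal.rpow_mul, one_div_mul_cancel hp0.ne', ENNReal.rpow_one]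

open scoped Convolution in
/-- Mollification converges in `L^p`. -/
theorem exists_eLpNorm_convolution_sub_le {N : ℕ} {E : Type*} [NormedAddCommGroup E]
    [NormedSpace ℝ E] [CompleteSpace E] {p : ℝ} (hp : 1 ≤ p) {f : Space N → E}
    (hf : MemLp f (ENNReal.ofReal p) volume) {ε : ℝ≥0∞} (hε : ε ≠ 0) :
    ∃ δ > 0, ∀ ρ : ContDiffBump (0 : Space N), ρ.rOut < δ →
      eLpNorm (fun x => (ρ.normed volume ⋆[ContinuousLinearMap.lsmul ℝ ℝ, volume] f) x - f x)
        (ENNReal.ofReal p) volume ≤ ε := by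
  have hp0 : 0 < p := by linarith
  have hp1 : 1 ≤ ENNReal.ofReal p := by simpa using hp
  have hpt : ENNReal.ofReal p ≠ ⊤ := ENNReal.ofReal_ne_top
  have hpz : ENNReal.ofReal p ≠ 0 := by simpa using hp0
  obtain ⟨δ, hδ, H⟩ := exists_eLpNorm_translate_sub_le hp1 hpt hf hε
  refine ⟨δ, hδ, fun ρ hρ => ?_⟩
  set w : Space N → ℝ≥0∞ := fun t => ENNReal.ofReal (ρ.normed volume t) with hw
  have hwm : Measurable w := (ρ.continuous_normed (μ := volume)).measurable.ennreal_ofReal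
  have hw1 : ∫⁻ t, w t ∂volume = 1 := by
    rw [hw, ← ofReal_integral_eq_lintegral_ofReal ρ.integrable_normed
      (Filter.Eventually.of_forall ρ.nonneg_normed), ρ.integral_normed]
    simp
  have hfl : LocallyIntegrable f volume := hf.locallyIntegrable hp1
  have hconv : ∀ x, ConvolutionExistsAt (ρ.normed volume) f x (ContinuousLinearMap.lsmul ℝ ℝ)
      volume := fun x => ρ.hasCompactSupport_normed.convolutionExists_left _
        ρ.continuous_normed hfl x
  have hpt1 : ∀ x, ‖(ρ.normed volume ⋆[ContinuousLinearMap.lsmul ℝ ℝ, volume] f) x - f x‖ₑ ≤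
      ∫⁻ t, w t * ‖f (x - t) - f x‖ₑ ∂volume := by
    intro x
    have e1 : f x = ∫ t, ρ.normed volume t • f x ∂volume := by
      rw [integral_smul_const, ρ.integral_normed, one_smul]
    have e2 : (ρ.normed volume ⋆[ContinuousLinearMap.lsmul ℝ ℝ, volume] f) x - f x =
        ∫ t, ρ.normed volume t • (f (x - t) - f x) ∂volume := by
      conv_lhs => rw [e1]
      rw [convolution_def, ← integral_sub]
      · simp [smul_sub]
      · exact hconv x
      · exact ρ.integrable_normed.smul_const _
    rw [e2]
    refine (enorm_integral_le_lintegral_enorm _).trans (le_of_eq ?_)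
    refine lintegral_congr fun t => ?_
    rw [enorm_smul, hw, Real.enorm_of_nonneg (ρ.nonneg_normed t)]
  have hmeas : AEMeasurable (fun z : Space N × Space N => ‖f (z.1 - z.2) - f z.1‖ₑ)
      (volume.prod volume) := by
    have a1 : AEStronglyMeasurable (fun z : Space N × Space N => f (z.1 - z.2))
        (volume.prod volume) :=
      hf.1.comp_quasiMeasurePreserving (quasiMeasurePreserving_sub volume volume)
    have a2 : AEStronglyMeasurable (fun z : Space N × Space N => f z.1)
        (volume.prod volume) := hf.1.comp_fst
    exact (a1.sub a2).enorm
  rw [eLpNorm_eq_lintegral_rpow_enorm_toReal hpz hpt, ENNReal.toReal_ofReal hp0.le]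
  rw [one_div, ENNReal.rpow_inv_le_iff hp0]
  calc ∫⁻ x, ‖(ρ.normed volume ⋆[ContinuousLinearMap.lsmul ℝ ℝ, volume] f) x - f x‖ₑ ^ p
      ≤ ∫⁻ x, ∫⁻ t, w t * ‖f (x - t) - f x‖ₑ ^ p ∂volume ∂volume := by
        refine lintegral_mono fun x => ?_
        have hx : AEMeasurable (fun t => ‖f (x - t) - f x‖ₑ) volume :=
          ((hf.1.comp_quasiMeasurePreserving (quasiMeasurePreserving_sub_left volume x)).sub
            aestronglyMeasurable_const).enorm
        refine (ENNReal.rpow_le_rpow (hpt1 x) hp0.le).trans ?_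
        exact lintegral_mul_rpow_le_of_mass_le_one hp hwm.aemeasurable hx hw1.le
    _ = ∫⁻ t, ∫⁻ x, w t * ‖f (x - t) - f x‖ₑ ^ p ∂volume ∂volume := by
        refine lintegral_lintegral_swap ?_
        exact (hwm.comp measurable_snd).aemeasurable.mul (hmeas.pow_const p)
    _ ≤ ∫⁻ t, w t * ε ^ p ∂volume := by
        refine lintegral_mono fun t => ?_
        rw [lintegral_const_mul' _ _ ENNReal.ofReal_ne_top]
        by_cases ht : ‖t‖ < δ
        · gcongr
          have := H t ht
          rwa [eLpNorm_eq_lintegral_rpow_enorm_toReal hpz hpt, ENNReal.toReal_ofReal hp0.le,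
            one_div, ENNReal.rpow_inv_le_iff hp0] at this
        · have h0 : ρ.normed volume t = 0 := by
            rw [← Function.notMem_support, ρ.support_normed_eq]
            simp only [mem_ball, dist_zero_right]
            linarith
          simp [hw, h0]
    _ = ε ^ p := by rw [lintegral_mul_const _ hwm, hw1, one_mul]

/-! ### Gradients and Sobolev limits -/

section GradientCalculus

variable {N : ℕ}

theorem ContDiff.hasGradientAt {f : Space N → ℝ} {n : WithTop ℕ∞} (hf : ContDiff ℝ n f)
    (hn : n ≠ 0) (x : Space N) : HasGradientAt f (gradient f x) x :=
  ((hf.differentiable hn) x).hasGradientAt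

theorem continuous_gradient {f : Space N → ℝ} (hf : ContDiff ℝ 1 f) : Continuous (gradient f) := by
  have h := hf.continuous_fderiv (by norm_num)
  exact (InnerProductSpace.toDual ℝ (Space N)).symm.continuous.comp h

theorem gradient_eq_zero_of_notMem_tsupport {f : Space N → ℝ} {x : Space N}
    (hx : x ∉ tsupport f) : gradient f x = 0 := by
  have h : fderiv ℝ f x = 0 := by
    by_contra h0
    exact hx (support_fderiv_subset ℝ (Function.mem_support.2 h0))
  rw [gradient, h, map_zero]

theorem HasGradientAt.mul {f g : Space N → ℝ} {f' g' x : Space N}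
    (hf : HasGradientAt f f' x) (hg : HasGradientAt g g' x) :
    HasGradientAt (fun y => f y * g y) (f x • g' + g x • f') x := by
  rw [hasGradientAt_iff_hasFDerivAt] at *
  refine (HasFDerivAt.mul hf hg).congr_fderiv ?_
  simp

theorem HasDerivAt.comp_hasGradientAt {G : ℝ → ℝ} {G' : ℝ} {f : Space N → ℝ} {f' x : Space N}
    (hG : HasDerivAt G G' (f x)) (hf : HasGradientAt f f' x) :
    HasGradientAt (fun y => G (f y)) (G' • f') x := by
  rw [hasGradientAt_iff_hasFDerivAt] at *
  refine (hG.comp_hasFDerivAt x hf).congr_fderiv ?_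
  simp

theorem norm_gradient (f : Space N → ℝ) (x : Space N) : ‖gradient f x‖ = ‖fderiv ℝ f x‖ := by
  simp [gradient]

end GradientCalculus

section LpConvergence

variable {α E : Type*} [MeasurableSpace α] {μ : Measure α} [NormedAddCommGroup E]

/-- Dominated convergence in `L^p`. -/
theorem tendsto_eLpNorm_sub_of_dominated {p : ℝ≥0∞} (hp0 : p ≠ 0) (hp : p ≠ ⊤)
    {f : ℕ → α → E} {g : α → E} {b : α → ℝ} (hb : MemLp b p μ)
    (hf : ∀ n, AEStronglyMeasurable (f n) μ) (hfb : ∀ n, ∀ᵐ x ∂μ, ‖f n x - g x‖ ≤ b x)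
    (hlim : ∀ᵐ x ∂μ, Filter.Tendsto (fun n => f n x) Filter.atTop (nhds (g x))) :
    Filter.Tendsto (fun n => eLpNorm (fun x => f n x - g x) p μ) Filter.atTop (nhds 0) := by
  have hg : AEStronglyMeasurable g μ := aestronglyMeasurable_of_tendsto_ae _ hf hlim
  have hpr : 0 < p.toReal := ENNReal.toReal_pos hp0 hp
  have key : Filter.Tendsto (fun n => ∫⁻ x, ‖f n x - g x‖ₑ ^ p.toReal ∂μ) Filter.atTop
      (nhds (∫⁻ _, 0 ∂μ)) := by
    refine tendsto_lintegral_of_dominated_convergence' (fun x => ‖b x‖ₑ ^ p.toReal)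
      (fun n => ((hf n).sub hg).enorm.pow_const _) (fun n => ?_) ?_ ?_
    · filter_upwards [hfb n] with x hx
      gcongr
      rw [← ofReal_norm, ← ofReal_norm]
      exact ENNReal.ofReal_le_ofReal (hx.trans (Real.le_norm_self _))
    · exact (lintegral_rpow_enorm_lt_top_of_eLpNorm_lt_top hp0 hp hb.2).ne
    · filter_upwards [hlim] with x hx
      have h1 : Filter.Tendsto (fun n => ‖f n x - g x‖ₑ) Filter.atTop (nhds 0) := by
        have := (hx.sub_const (g x)).enorm
        simpa using this
      have h2 := (ENNReal.continuous_rpow_const (y := p.toReal)).tendsto 0 |>.comp h1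
      rw [ENNReal.zero_rpow_of_pos hpr] at h2
      exact h2
  simp only [lintegral_zero] at key
  simp only [eLpNorm_eq_lintegral_rpow_enorm_toReal hp0 hp]
  have h2 := (ENNReal.continuous_rpow_const (y := 1 / p.toReal)).tendsto 0 |>.comp key
  rw [ENNReal.zero_rpow_of_pos (by positivity)] at h2
  exact h2

end LpConvergence

/-- `v`, with gradient `Dv`, is the limit in `W^{1,p}(ℝ^N)` of `C^1` functions with compact support
contained in the fixed set `K`. It plays the part of `v ∈ W^{1,p}_0` without a Banach space
structure; `Dv` is part of the data. -/
structure IsSobolevLimit {N : ℕ} (p : ℝ≥0∞) (K : Set (Space N)) (v : Space N → ℝ)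
    (Dv : Space N → Space N) : Prop where
  memLp : MemLp v p volume
  memLp_grad : MemLp Dv p volume
  exists_approx : ∀ ε : ℝ≥0∞, ε ≠ 0 → ∃ φ : Space N → ℝ, ContDiff ℝ 1 φ ∧ HasCompactSupport φ ∧
    tsupport φ ⊆ K ∧ eLpNorm (fun x => φ x - v x) p volume ≤ ε ∧
    eLpNorm (fun x => gradient φ x - Dv x) p volume ≤ ε

namespace IsSobolevLimit

variable {N : ℕ} {p : ℝ≥0∞} {K : Set (Space N)} {v : Space N → ℝ} {Dv : Space N → Space N}

theorem mono {K' : Set (Space N)} (h : IsSobolevLimit p K v Dv) (hK : K ⊆ K') :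
    IsSobolevLimit p K' v Dv where
  memLp := h.memLp
  memLp_grad := h.memLp_grad
  exists_approx ε hε := by
    obtain ⟨φ, h1, h2, h3, h4⟩ := h.exists_approx ε hε
    exact ⟨φ, h1, h2, h3.trans hK, h4⟩

/-- Limits of limits of smooth functions are limits of smooth functions. -/
theorem of_tendsto (hp : 1 ≤ p) {w : ℕ → Space N → ℝ} {Dw : ℕ → Space N → Space N}
    (hw : ∀ n, IsSobolevLimit p K (w n) (Dw n)) (hv : MemLp v p volume) (hDv : MemLp Dv p volume)
    (h1 : Filter.Tendsto (fun n => eLpNorm (fun x => w n x - v x) p volume) Filter.atTop (nhds 0))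
    (h2 : Filter.Tendsto (fun n => eLpNorm (fun x => Dw n x - Dv x) p volume) Filter.atTop
      (nhds 0)) : IsSobolevLimit p K v Dv where
  memLp := hv
  memLp_grad := hDv
  exists_approx ε hε := by
    have hε2 : ε / 2 ≠ 0 := by simpa using hε
    have e1 := (ENNReal.tendsto_nhds_zero.1 h1) (ε / 2) (pos_iff_ne_zero.2 hε2)
    have e2 := (ENNReal.tendsto_nhds_zero.1 h2) (ε / 2) (pos_iff_ne_zero.2 hε2)
    obtain ⟨n, hn1, hn2⟩ := (e1.and e2).exists
    obtain ⟨φ, c1, c2, c3, c4, c5⟩ := (hw n).exists_approx (ε / 2) hε2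
    have m1 : AEStronglyMeasurable φ volume := c1.continuous.aestronglyMeasurable
    have m2 : AEStronglyMeasurable (gradient φ) volume :=
      (continuous_gradient c1).aestronglyMeasurable
    refine ⟨φ, c1, c2, c3, ?_, ?_⟩
    · calc eLpNorm (fun x => φ x - v x) p volume
          = eLpNorm ((fun x => φ x - w n x) + fun x => w n x - v x) p volume := by
            congr 1; ext x; simp
        _ ≤ ε / 2 + ε / 2 := (eLpNorm_add_le (m1.sub (hw n).memLp.1)
            ((hw n).memLp.1.sub hv.1) hp).trans (add_le_add c4 hn1)
        _ = ε := ENNReal.add_halves ε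
    · calc eLpNorm (fun x => gradient φ x - Dv x) p volume
          = eLpNorm ((fun x => gradient φ x - Dw n x) + fun x => Dw n x - Dv x) p volume := by
            congr 1; ext x; simp
        _ ≤ ε / 2 + ε / 2 := (eLpNorm_add_le (m2.sub (hw n).memLp_grad.1)
            ((hw n).memLp_grad.1.sub hDv.1) hp).trans (add_le_add c5 hn2)
        _ = ε := ENNReal.add_halves ε

/-- An approximating sequence, converging in `W^{1,p}` and almost everywhere. -/
theorem exists_seq (hp0 : p ≠ 0) (h : IsSobolevLimit p K v Dv) :
    ∃ φ : ℕ → Space N → ℝ, (∀ n, ContDiff ℝ 1 (φ n)) ∧ (∀ n, HasCompactSupport (φ n)) ∧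
      (∀ n, tsupport (φ n) ⊆ K) ∧
      Filter.Tendsto (fun n => eLpNorm (fun x => φ n x - v x) p volume) Filter.atTop (nhds 0) ∧
      Filter.Tendsto (fun n => eLpNorm (fun x => gradient (φ n) x - Dv x) p volume)
        Filter.atTop (nhds 0) ∧
      (∀ᵐ x, Filter.Tendsto (fun n => φ n x) Filter.atTop (nhds (v x))) ∧
      (∀ᵐ x, Filter.Tendsto (fun n => gradient (φ n) x) Filter.atTop (nhds (Dv x))) := by
  have h0 : ∀ n : ℕ, ((n : ℝ≥0∞) + 1)⁻¹ ≠ 0 := fun n => by simp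
  have hlim : Filter.Tendsto (fun n : ℕ => ((n : ℝ≥0∞) + 1)⁻¹) Filter.atTop (nhds 0) := by
    have := (Filter.tendsto_add_atTop_iff_nat 1).2 ENNReal.tendsto_inv_nat_nhds_zero
    simpa using this
  choose φ c1 c2 c3 c4 c5 using fun n : ℕ => h.exists_approx _ (h0 n)
  have m1 : ∀ n, AEStronglyMeasurable (φ n) volume := fun n =>
    (c1 n).continuous.aestronglyMeasurable
  have m2 : ∀ n, AEStronglyMeasurable (gradient (φ n)) volume := fun n =>
    (continuous_gradient (c1 n)).aestronglyMeasurable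
  have t1 : Filter.Tendsto (fun n => eLpNorm (fun x => φ n x - v x) p volume) Filter.atTop
      (nhds 0) := tendsto_of_tendsto_of_tendsto_of_le_of_le tendsto_const_nhds hlim
        (fun _ => zero_le) c4
  have t2 : Filter.Tendsto (fun n => eLpNorm (fun x => gradient (φ n) x - Dv x) p volume)
      Filter.atTop (nhds 0) := tendsto_of_tendsto_of_tendsto_of_le_of_le tendsto_const_nhds hlim
        (fun _ => zero_le) c5
  obtain ⟨ns, hns, a1⟩ := (tendstoInMeasure_of_tendsto_eLpNorm hp0 m1 h.memLp.1
    t1).exists_seq_tendsto_ae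
  obtain ⟨ms, hms, a2⟩ := (tendstoInMeasure_of_tendsto_eLpNorm hp0 (fun n => m2 (ns n))
    h.memLp_grad.1 (t2.comp hns.tendsto_atTop)).exists_seq_tendsto_ae
  have hlt := hns.tendsto_atTop.comp hms.tendsto_atTop
  refine ⟨fun n => φ (ns (ms n)), fun n => c1 _, fun n => c2 _, fun n => c3 _, t1.comp hlt,
    t2.comp hlt, ?_, a2⟩
  filter_upwards [a1] with x hx
  exact hx.comp hms.tendsto_atTop

end IsSobolevLimit

/-! ### Mollification of weakly differentiable functions -/

section

variable {N : ℕ}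

/-- A function dominated by an `L^p(K)` function on `K`, and zero off `K`, is in `L^p`. -/
theorem memLp_of_le_mul_restrict {E F : Type*} [NormedAddCommGroup E] [NormedAddCommGroup F]
    {p : ℝ≥0∞} {K : Set (Space N)} (hK : MeasurableSet K) {f : Space N → E} {g : Space N → F}
    {c : ℝ} (hf : MemLp f p (volume.restrict K)) (hg : AEStronglyMeasurable g (volume.restrict K))
    (hle : ∀ x, ‖g x‖ ≤ c * ‖f x‖) (h0 : ∀ x, x ∉ K → g x = 0) : MemLp g p volume := by
  have h1 : g = K.indicator g := by
    ext1 x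
    by_cases hx : x ∈ K
    · simp [hx]
    · simp [hx, h0 x hx]
  rw [h1, memLp_indicator_iff_restrict hK]
  exact hf.of_le_mul hg (Filter.Eventually.of_forall hle)

theorem HasCompactSupport.exists_norm_le {E : Type*} [NormedAddCommGroup E] {f : Space N → E}
    (hf : HasCompactSupport f) (hc : Continuous f) : ∃ C : ℝ, 0 ≤ C ∧ ∀ x, ‖f x‖ ≤ C := by
  obtain ⟨C, hC⟩ := hf.exists_bound_of_continuous hc
  exact ⟨C, (norm_nonneg _).trans (hC 0), hC⟩

theorem tsupport_gradient_subset (f : Space N → ℝ) : tsupport (gradient f) ⊆ tsupport f := by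
  refine closure_minimal (fun x hx => ?_) (isClosed_tsupport f)
  by_contra h
  exact hx (gradient_eq_zero_of_notMem_tsupport h)

theorem HasCompactSupport.gradient {f : Space N → ℝ} (hf : HasCompactSupport f) :
    HasCompactSupport (gradient f) :=
  hf.of_isClosed_subset (isClosed_tsupport _) (tsupport_gradient_subset f)

/-- Multiplication by a continuous compactly supported function maps `L^p` of the support to
`L^p(ℝ^N)`. -/
theorem MemLp.continuous_smul {p : ℝ≥0∞} {E : Type*} [NormedAddCommGroup E] [NormedSpace ℝ E]
    {K : Set (Space N)} (hK : MeasurableSet K) {χ : Space N → ℝ}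
    {f : Space N → E} (hχ : Continuous χ) (hχc : HasCompactSupport χ) (hχK : tsupport χ ⊆ K)
    (hf : MemLp f p (volume.restrict K)) : MemLp (fun x => χ x • f x) p volume := by
  obtain ⟨C, _, hC⟩ := hχc.exists_norm_le hχ
  refine memLp_of_le_mul_restrict hK hf (hχ.aestronglyMeasurable.smul hf.1)
    (fun x => ?_) (c := C) (fun x hx => ?_)
  · rw [norm_smul]; gcongr; exact hC x
  · rw [image_eq_zero_of_notMem_tsupport (fun h => hx (hχK h)), zero_smul]

theorem MemLp.smul_continuous {p : ℝ≥0∞} {E : Type*} [NormedAddCommGroup E] [NormedSpace ℝ E]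
    {K : Set (Space N)} (hK : MeasurableSet K) {χ : Space N → E}
    {f : Space N → ℝ} (hχ : Continuous χ) (hχc : HasCompactSupport χ) (hχK : tsupport χ ⊆ K)
    (hf : MemLp f p (volume.restrict K)) : MemLp (fun x => f x • χ x) p volume := by
  obtain ⟨C, _, hC⟩ := hχc.exists_norm_le hχ
  refine memLp_of_le_mul_restrict hK hf (hf.1.smul hχ.aestronglyMeasurable)
    (fun x => ?_) (c := C) (fun x hx => ?_)
  · rw [norm_smul, mul_comm]; gcongr; exact hC x
  · rw [image_eq_zero_of_notMem_tsupport (fun h => hx (hχK h)), smul_zero]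

open scoped Convolution in
/-- The mollification of `χ u` has gradient the mollification of `χ Du + u ∇χ`. -/
theorem IsWeakGradient.gradient_convolution {Ω : Set (Space N)} {u : Space N → ℝ}
    {Du : Space N → Space N} (h : IsWeakGradient Ω u Du) {χ : Space N → ℝ}
    (hχ : ContDiff ℝ ∞ χ) (hχc : HasCompactSupport χ) (hχΩ : tsupport χ ⊆ Ω)
    (hv : LocallyIntegrable (fun x => χ x * u x) volume)
    (h1 : Integrable (fun x => χ x • Du x) volume)
    (h2 : Integrable (fun x => u x • gradient χ x) volume)
    {ρ : Space N → ℝ} (hρ : ContDiff ℝ ∞ ρ) (hρc : HasCompactSupport ρ) (x : Space N) :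
    gradient (ρ ⋆[ContinuousLinearMap.lsmul ℝ ℝ, volume] fun y => χ y * u y) x =
      (ρ ⋆[ContinuousLinearMap.lsmul ℝ ℝ, volume]
        fun y => χ y • Du y + u y • gradient χ y) x := by
  have hρ1 : ContDiff ℝ 1 ρ := hρ.of_le (by exact_mod_cast le_top)
  have e1 := (hρc.hasFDerivAt_convolution_left (ContinuousLinearMap.lsmul ℝ ℝ) hρ1 hv x).fderiv
  have e2 : gradient (ρ ⋆[ContinuousLinearMap.lsmul ℝ ℝ, volume] fun y => χ y * u y) x =
      ∫ t, (χ (x - t) * u (x - t)) • gradient ρ t := by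
    rw [gradient, e1, convolution_def]
    let J : StrongDual ℝ (Space N) →L[ℝ] Space N :=
      { toFun := (InnerProductSpace.toDual ℝ (Space N)).symm
        map_add' := map_add _
        map_smul' := fun c f => by simp
        cont := (InnerProductSpace.toDual ℝ (Space N)).symm.continuous }
    have hint := (hρc.fderiv ℝ).convolutionExists_left
      ((ContinuousLinearMap.lsmul ℝ ℝ).precompL (Space N)) (hρ1.continuous_fderiv (by norm_num))
      hv x
    have hJ := J.integral_comp_comm hint
    refine Eq.trans hJ.symm ?_
    refine integral_congr_ae (Filter.Eventually.of_forall fun t => ?_)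
    have : (((ContinuousLinearMap.lsmul ℝ ℝ).precompL (Space N)) (fderiv ℝ ρ t))
        (χ (x - t) * u (x - t)) = (χ (x - t) * u (x - t)) • fderiv ℝ ρ t := by
      ext y
      simp [ContinuousLinearMap.precompL_apply]
      ring
    simp only [this, J, map_smul]
    rfl
  have hψ : ContDiff ℝ ∞ (fun s => ρ (x - s) * χ s) :=
    (hρ.comp (contDiff_const.sub contDiff_id)).mul hχ
  have hψs : tsupport (fun s => ρ (x - s) * χ s) ⊆ tsupport χ := tsupport_mul_subset_right
  have e3 := h.2.2 _ hψ (hχc.of_isClosed_subset (isClosed_tsupport _) hψs) (hψs.trans hχΩ)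
  have e4 : ∀ s, gradient (fun s => ρ (x - s) * χ s) s =
      ρ (x - s) • gradient χ s - χ s • gradient ρ (x - s) := by
    intro s
    have g1 : HasGradientAt (fun s => ρ (x - s)) (-gradient ρ (x - s)) s := by
      have := hρ.hasGradientAt (by simp) (x - s)
      rw [hasGradientAt_iff_hasFDerivAt] at *
      have h3 : HasFDerivAt (fun s : Space N => x - s) (-ContinuousLinearMap.id ℝ (Space N)) s :=
        (hasFDerivAt_id s).const_sub x
      refine (this.comp s h3).congr_fderiv ?_
      ext y
      simp
    rw [(g1.mul (hχ.hasGradientAt (by simp) s)).gradient, smul_neg]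
    exact (sub_eq_add_neg _ _).symm
  have hχ0 : ∀ s, s ∉ Ω → χ s = 0 := fun s hs =>
    image_eq_zero_of_notMem_tsupport (fun h => hs (hχΩ h))
  have hg0 : ∀ s, s ∉ Ω → gradient χ s = 0 := fun s hs =>
    gradient_eq_zero_of_notMem_tsupport (fun h => hs (hχΩ h))
  rw [setIntegral_eq_integral_of_forall_compl_eq_zero
      (fun s hs => by rw [e4, hχ0 s hs, hg0 s hs]; simp),
    setIntegral_eq_integral_of_forall_compl_eq_zero (fun s hs => by rw [hχ0 s hs]; simp)] at e3
  have hρx : Continuous fun s => ρ (x - s) :=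
    hρ.continuous.comp (continuous_const.sub continuous_id)
  have hgρx : Continuous fun s => gradient ρ (x - s) :=
    (continuous_gradient hρ1).comp (continuous_const.sub continuous_id)
  obtain ⟨C, hC0, hC⟩ := hρc.exists_norm_le hρ.continuous
  have i1 : Integrable (fun s => ρ (x - s) • χ s • Du s) volume := by
    refine (h1.norm.const_mul C).mono' (hρx.aestronglyMeasurable.smul h1.1)
      (Filter.Eventually.of_forall fun s => ?_)
    rw [norm_smul]; gcongr; exact hC _
  have i2 : Integrable (fun s => ρ (x - s) • u s • gradient χ s) volume := by
    refine (h2.norm.const_mul C).mono' (hρx.aestronglyMeasurable.smul h2.1)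
      (Filter.Eventually.of_forall fun s => ?_)
    rw [norm_smul]; gcongr; exact hC _
  have i3 : Integrable (fun s => (χ s * u s) • gradient ρ (x - s)) volume := by
    have := hρc.gradient.convolutionExists_left (ContinuousLinearMap.lsmul ℝ ℝ).flip
      (continuous_gradient hρ1) hv x
    have := (this.integrable.comp_sub_left x)
    simpa using this
  have e5 : ∫ s, u s • gradient (fun s => ρ (x - s) * χ s) s =
      (∫ s, ρ (x - s) • u s • gradient χ s) - ∫ s, (χ s * u s) • gradient ρ (x - s) := by
    rw [← integral_sub i2 i3]
    refine integral_congr_ae (Filter.Eventually.of_forall fun s => ?_)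
    simp only [e4]
    module
  have e6 : ∫ s, (ρ (x - s) * χ s) • Du s = ∫ s, ρ (x - s) • χ s • Du s := by
    simp only [mul_smul]
  rw [e5, e6] at e3
  have e7 : ∫ t, (χ (x - t) * u (x - t)) • gradient ρ t =
      ∫ s, (χ s * u s) • gradient ρ (x - s) := by
    rw [← integral_sub_left_eq_self _ volume x]
    simp
  have e8 : (ρ ⋆[ContinuousLinearMap.lsmul ℝ ℝ, volume]
        fun y => χ y • Du y + u y • gradient χ y) x =
      (∫ s, ρ (x - s) • χ s • Du s) + ∫ s, ρ (x - s) • u s • gradient χ s := by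
    rw [← integral_add i1 i2, convolution_def, ← integral_sub_left_eq_self _ volume x]
    simp
  rw [e2, e7, e8]
  rw [sub_eq_iff_eq_add] at e3
  rw [e3]
  abel

end

/-! ### Cutoffs and the chain rule -/

section

variable {N : ℕ}

/-- A smooth cutoff times a `W^{1,p}_loc` function is a limit of smooth functions. -/
theorem MemW1pLoc.isSobolevLimit_cutoff {p : ℝ} (hp : 1 ≤ p) {Ω : Set (Space N)}
    {u : Space N → ℝ} {Du : Space N → Space N} (h : MemW1pLoc p Ω u Du) {χ : Space N → ℝ}
    (hχ : ContDiff ℝ ∞ χ) (hχc : HasCompactSupport χ) (hχΩ : tsupport χ ⊆ Ω) :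
    IsSobolevLimit (ENNReal.ofReal p) univ (fun x => χ x * u x)
      (fun x => χ x • Du x + u x • gradient χ x) := by
  have hp1 : 1 ≤ ENNReal.ofReal p := by simpa using hp
  have hK : MeasurableSet (tsupport χ) := (isClosed_tsupport χ).measurableSet
  have hχ1 : ContDiff ℝ 1 χ := hχ.of_le (by exact_mod_cast le_top)
  have mu := h.2.1 _ hχΩ hχc
  have mDu := h.2.2 _ hχΩ hχc
  have m1 : MemLp (fun x => χ x * u x) (ENNReal.ofReal p) volume :=
    MemLp.continuous_smul hK hχ.continuous hχc subset_rfl mu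
  have m2 : MemLp (fun x => χ x • Du x) (ENNReal.ofReal p) volume :=
    MemLp.continuous_smul hK hχ.continuous hχc subset_rfl mDu
  have m3 : MemLp (fun x => u x • gradient χ x) (ENNReal.ofReal p) volume :=
    MemLp.smul_continuous hK (continuous_gradient hχ1) hχc.gradient (tsupport_gradient_subset χ) mu
  have : IsFiniteMeasure (volume.restrict (tsupport χ)) :=
    isFiniteMeasure_restrict.2 hχc.isCompact.measure_lt_top.ne
  have i2 : Integrable (fun x => χ x • Du x) volume :=
    memLp_one_iff_integrable.1 (MemLp.continuous_smul hK hχ.continuous hχc subset_rfl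
      (mDu.mono_exponent hp1))
  have i3 : Integrable (fun x => u x • gradient χ x) volume :=
    memLp_one_iff_integrable.1 (MemLp.smul_continuous hK (continuous_gradient hχ1) hχc.gradient
      (tsupport_gradient_subset χ) (mu.mono_exponent hp1))
  refine ⟨m1, m2.add m3, fun ε hε => ?_⟩
  obtain ⟨δ₁, hδ₁, H₁⟩ := exists_eLpNorm_convolution_sub_le hp m1 hε
  obtain ⟨δ₂, hδ₂, H₂⟩ := exists_eLpNorm_convolution_sub_le hp (m2.add m3) hε
  have hδ : 0 < min δ₁ δ₂ := lt_min hδ₁ hδ₂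
  let ρ : ContDiffBump (0 : Space N) := ⟨min δ₁ δ₂ / 4, min δ₁ δ₂ / 2, by positivity, by linarith⟩
  have hρlt : ρ.rOut < min δ₁ δ₂ := by simp only [ρ]; linarith
  have hlv := m1.locallyIntegrable hp1
  have hρc : HasCompactSupport (ρ.normed volume) := ρ.hasCompactSupport_normed
  have hρs : ContDiff ℝ ∞ (ρ.normed volume) := ρ.contDiff_normed
  have hvc : HasCompactSupport (fun x => χ x * u x) :=
    hχc.of_isClosed_subset (isClosed_tsupport _) tsupport_mul_subset_left
  refine ⟨convolution (ρ.normed volume) (fun y => χ y * u y) (ContinuousLinearMap.lsmul ℝ ℝ)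
    volume, ?_, ?_, subset_univ _, H₁ ρ (hρlt.trans_le (min_le_left _ _)), ?_⟩
  · exact hρc.contDiff_convolution_left (n := 1) _ (hρs.of_le (by exact_mod_cast le_top)) hlv
  · exact HasCompactSupport.convolution _ hρc hvc
  · simp only [fun x => h.1.gradient_convolution hχ hχc hχΩ hlv i2 i3 hρs hρc x]
    exact H₂ ρ (hρlt.trans_le (min_le_right _ _))

/-- Chain and product rule: composing with a `C^1` function of bounded derivative and multiplying
by a `C^1` cutoff preserves limits of smooth functions. -/
theorem IsSobolevLimit.cutoff_mul_comp {p : ℝ≥0∞} (hp1 : 1 ≤ p) (hp : p ≠ ⊤) {K : Set (Space N)}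
    {v : Space N → ℝ} {Dv : Space N → Space N} (h : IsSobolevLimit p K v Dv)
    {G g : ℝ → ℝ} (hG : ∀ t, HasDerivAt G (g t) t) (hg : Continuous g) {M : ℝ}
    (hM : ∀ t, |g t| ≤ M) {η : Space N → ℝ} (hη : ContDiff ℝ 1 η) (hηc : HasCompactSupport η) :
    IsSobolevLimit p (tsupport η) (fun x => η x * G (v x))
      (fun x => (η x * g (v x)) • Dv x + G (v x) • gradient η x) := by
  have hp0 : p ≠ 0 := (one_pos.trans_le hp1).ne'
  have hM0 : 0 ≤ M := (abs_nonneg _).trans (hM 0)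
  have hGd : Differentiable ℝ G := fun t => (hG t).differentiableAt
  have hGC : ContDiff ℝ 1 G := by
    rw [contDiff_one_iff_deriv]
    refine ⟨hGd, ?_⟩
    rw [show deriv G = g from funext fun t => (hG t).deriv]
    exact hg
  have hLip : ∀ s t, |G s - G t| ≤ M * |s - t| := fun s t => by
    have := Convex.norm_image_sub_le_of_norm_hasDerivWithin_le (f := G) (f' := g) (C := M)
      (s := univ) (x := t) (y := s) (fun x _ => (hG x).hasDerivWithinAt)
      (fun x _ => by simpa using hM x) convex_univ (mem_univ _) (mem_univ _)
    simpa using this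
  obtain ⟨C, hC0, hC⟩ := hηc.exists_norm_le hη.continuous
  obtain ⟨C', hC'0, hC'⟩ := hηc.gradient.exists_norm_le (continuous_gradient hη)
  have hgc := continuous_gradient hη
  have mG : AEStronglyMeasurable (fun x => G (v x)) volume :=
    hGd.continuous.comp_aestronglyMeasurable h.memLp.1
  have mg : AEStronglyMeasurable (fun x => g (v x)) volume :=
    hg.comp_aestronglyMeasurable h.memLp.1
  have n1 : MemLp (fun x => η x * G (v x)) p volume := by
    have a1 : MemLp (fun x => η x * G 0) p volume :=
      (hη.continuous.mul continuous_const).memLp_of_hasCompactSupport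
        (hηc.of_isClosed_subset (isClosed_tsupport _) tsupport_mul_subset_left)
    have a2 : MemLp (fun x => η x * (G (v x) - G 0)) p volume := by
      refine h.memLp.of_le_mul (c := C * M) (hη.continuous.aestronglyMeasurable.mul
        (mG.sub aestronglyMeasurable_const)) (Filter.Eventually.of_forall fun x => ?_)
      rw [norm_mul, mul_assoc]
      have := hLip (v x) 0
      rw [sub_zero] at this
      gcongr
      · exact hC x
      · exact this
    refine (a1.add a2).ae_eq (Filter.Eventually.of_forall fun x => ?_)
    simp only [Pi.add_apply]; ring
  have n2 : MemLp (fun x => (η x * g (v x)) • Dv x) p volume := by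
    refine h.memLp_grad.of_le_mul (c := C * M) ((hη.continuous.aestronglyMeasurable.mul mg).smul
      h.memLp_grad.1) (Filter.Eventually.of_forall fun x => ?_)
    rw [norm_smul, norm_mul]
    gcongr
    · exact hC x
    · exact hM _
  have n3 : MemLp (fun x => G (v x) • gradient η x) p volume := by
    have a1 : MemLp (fun x => G 0 • gradient η x) p volume :=
      (hgc.memLp_of_hasCompactSupport hηc.gradient).const_smul (G 0)
    have a2 : MemLp (fun x => (G (v x) - G 0) • gradient η x) p volume := by
      refine h.memLp.of_le_mul (c := M * C') ((mG.sub aestronglyMeasurable_const).smul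
        hgc.aestronglyMeasurable) (Filter.Eventually.of_forall fun x => ?_)
      rw [norm_smul, mul_right_comm]
      have := hLip (v x) 0
      rw [sub_zero] at this
      gcongr
      · exact this
      · exact hC' x
    refine (a1.add a2).ae_eq (Filter.Eventually.of_forall fun x => ?_)
    simp only [Pi.add_apply]; module
  obtain ⟨φ, c1, c2, -, t1, t2, b1, b2⟩ := h.exists_seq hp0
  have m1 : ∀ n, AEStronglyMeasurable (φ n) volume := fun n =>
    (c1 n).continuous.aestronglyMeasurable
  have m2 : ∀ n, AEStronglyMeasurable (gradient (φ n)) volume := fun n =>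
    (continuous_gradient (c1 n)).aestronglyMeasurable
  have hψ : ∀ n, ContDiff ℝ 1 (fun x => η x * G (φ n x)) := fun n => hη.mul (hGC.comp (c1 n))
  have hgrad : ∀ n x, gradient (fun x => η x * G (φ n x)) x =
      (η x * g (φ n x)) • gradient (φ n) x + G (φ n x) • gradient η x := fun n x => by
    rw [((hη.hasGradientAt one_ne_zero x).mul
      ((hG _).comp_hasGradientAt ((c1 n).hasGradientAt one_ne_zero x))).gradient, smul_smul]
  have T1 : Filter.Tendsto (fun n => eLpNorm (fun x => η x * G (φ n x) - η x * G (v x)) p volume)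
      Filter.atTop (nhds 0) := by
    have hle : ∀ n, eLpNorm (fun x => η x * G (φ n x) - η x * G (v x)) p volume ≤
        ENNReal.ofReal (C * M) * eLpNorm (fun x => φ n x - v x) p volume := fun n => by
      refine eLpNorm_le_mul_eLpNorm_of_ae_le_mul (Filter.Eventually.of_forall fun x => ?_) p
      rw [← mul_sub, norm_mul, mul_assoc]
      gcongr
      · exact hC x
      · exact hLip _ _
    have := ENNReal.Tendsto.const_mul t1 (Or.inr (ENNReal.ofReal_ne_top (r := C * M)))
    rw [mul_zero] at this
    exact tendsto_of_tendsto_of_tendsto_of_le_of_le tendsto_const_nhds this (fun _ => zero_le) hle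
  have T2 : Filter.Tendsto (fun n => eLpNorm (fun x => gradient (fun x => η x * G (φ n x)) x -
      ((η x * g (v x)) • Dv x + G (v x) • gradient η x)) p volume)
      Filter.atTop (nhds 0) := by
    have s1 : Filter.Tendsto (fun n => eLpNorm (fun x => (η x * g (φ n x)) • Dv x -
        (η x * g (v x)) • Dv x) p volume) Filter.atTop (nhds 0) := by
      refine tendsto_eLpNorm_sub_of_dominated hp0 hp (b := fun x => (2 * C * M) * ‖Dv x‖)
        (h.memLp_grad.norm.const_mul _) (fun n => ?_) (fun n => ?_) ?_
      · exact (hη.continuous.aestronglyMeasurable.mul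
          (hg.comp_aestronglyMeasurable (m1 n))).smul h.memLp_grad.1
      · refine Filter.Eventually.of_forall fun x => ?_
        rw [← sub_smul, ← mul_sub, norm_smul, norm_mul]
        have := (norm_sub_le (g (φ n x)) (g (v x))).trans (add_le_add (hM _) (hM _))
        calc _ ≤ C * (M + M) * ‖Dv x‖ := by gcongr; exact hC x
          _ = _ := by ring
      · filter_upwards [b1] with x hx
        exact (((hg.tendsto _).comp hx).const_mul _).smul_const _
    have hle : ∀ n, eLpNorm (fun x => gradient (fun x => η x * G (φ n x)) x -
        ((η x * g (v x)) • Dv x + G (v x) • gradient η x)) p volume ≤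
        ENNReal.ofReal (C * M) * eLpNorm (fun x => gradient (φ n) x - Dv x) p volume +
        (eLpNorm (fun x => (η x * g (φ n x)) • Dv x - (η x * g (v x)) • Dv x) p volume +
        ENNReal.ofReal (M * C') * eLpNorm (fun x => φ n x - v x) p volume) := fun n => by
      have e : (fun x => gradient (fun x => η x * G (φ n x)) x -
        ((η x * g (v x)) • Dv x + G (v x) • gradient η x)) =
          (fun x => (η x * g (φ n x)) • (gradient (φ n) x - Dv x)) +
          ((fun x => (η x * g (φ n x)) • Dv x - (η x * g (v x)) • Dv x) +
          (fun x => (G (φ n x) - G (v x)) • gradient η x)) := by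
        ext1 x
        simp only [hgrad, Pi.add_apply]
        module
      have mgn := hg.comp_aestronglyMeasurable (m1 n)
      have mGn := hGd.continuous.comp_aestronglyMeasurable (m1 n)
      have q1 := (hη.continuous.aestronglyMeasurable.mul mgn).smul ((m2 n).sub h.memLp_grad.1)
      have q2 := ((hη.continuous.aestronglyMeasurable.mul mgn).smul h.memLp_grad.1).sub
        ((hη.continuous.aestronglyMeasurable.mul mg).smul h.memLp_grad.1)
      have q3 := (mGn.sub mG).smul (hgc.aestronglyMeasurable (μ := volume))
      rw [e]
      refine (eLpNorm_add_le q1 (q2.add q3) hp1).trans (add_le_add ?_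
        ((eLpNorm_add_le q2 q3 hp1).trans (add_le_add le_rfl ?_)))
      · refine eLpNorm_le_mul_eLpNorm_of_ae_le_mul (Filter.Eventually.of_forall fun x => ?_) p
        simp only [Pi.smul_apply', Pi.mul_apply, Pi.sub_apply]
        rw [norm_smul, norm_mul]
        gcongr
        · exact hC x
        · exact hM _
      · refine eLpNorm_le_mul_eLpNorm_of_ae_le_mul (Filter.Eventually.of_forall fun x => ?_) p
        simp only [Pi.smul_apply', Pi.sub_apply]
        rw [norm_smul, mul_right_comm]
        gcongr
        · exact hLip _ _
        · exact hC' x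
    have r1 := ENNReal.Tendsto.const_mul t2 (Or.inr (ENNReal.ofReal_ne_top (r := C * M)))
    have r2 := ENNReal.Tendsto.const_mul t1 (Or.inr (ENNReal.ofReal_ne_top (r := M * C')))
    have := r1.add (s1.add r2)
    simp only [mul_zero, add_zero] at this
    exact tendsto_of_tendsto_of_tendsto_of_le_of_le tendsto_const_nhds this (fun _ => zero_le) hle
  refine ⟨n1, n2.add n3, fun ε hε => ?_⟩
  obtain ⟨n, hn1, hn2⟩ := (((ENNReal.tendsto_nhds_zero.1 T1) ε (pos_iff_ne_zero.2 hε)).and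
    ((ENNReal.tendsto_nhds_zero.1 T2) ε (pos_iff_ne_zero.2 hε))).exists
  exact ⟨_, hψ n, hηc.of_isClosed_subset (isClosed_tsupport _) tsupport_mul_subset_left,
    tsupport_mul_subset_left, hn1, hn2⟩

end

/-! ### Truncation -/

/-- A continuous ramp, from `0` on `(-∞, k]` to `1` on `[k + 1/m, ∞)`. -/
noncomputable def ramp (k : ℝ) (m : ℕ) (s : ℝ) : ℝ := min (m * max (s - k) 0) 1

theorem continuous_ramp (k : ℝ) (m : ℕ) : Continuous (ramp k m) := by
  unfold ramp; fun_prop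

theorem ramp_nonneg (k : ℝ) (m : ℕ) (s : ℝ) : 0 ≤ ramp k m s := by
  unfold ramp; positivity

theorem ramp_le_one (k : ℝ) (m : ℕ) (s : ℝ) : ramp k m s ≤ 1 := min_le_right _ _

theorem ramp_of_le {k : ℝ} (m : ℕ) {s : ℝ} (h : s ≤ k) : ramp k m s = 0 := by
  simp [ramp, max_eq_right (sub_nonpos.2 h)]

theorem tendsto_ramp (k s : ℝ) :
    Filter.Tendsto (fun m => ramp k m s) Filter.atTop (nhds ((Ioi k).indicator 1 s)) := by
  by_cases h : s ≤ k
  · simp [ramp_of_le _ h, h]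
  · have h' : 0 < s - k := by linarith
    refine tendsto_const_nhds.congr' ?_
    obtain ⟨n, hn⟩ := exists_nat_ge (1 / (s - k))
    filter_upwards [Filter.eventually_ge_atTop n] with m hm
    have h2 : (1 : ℝ) ≤ m * (s - k) := by
      rw [← div_le_iff₀ h']; exact hn.trans (by exact_mod_cast hm)
    simp [ramp, max_eq_left h'.le, h2, not_le.1 h]

/-- The primitive of the ramp, a `C^1` approximation of `t ↦ (t - k)^+`. -/
noncomputable def softPosPart (k : ℝ) (m : ℕ) (t : ℝ) : ℝ := ∫ s in k..t, ramp k m s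

theorem hasDerivAt_softPosPart (k : ℝ) (m : ℕ) (t : ℝ) :
    HasDerivAt (softPosPart k m) (ramp k m t) t :=
  intervalIntegral.integral_hasDerivAt_right ((continuous_ramp k m).intervalIntegrable _ _)
    ((continuous_ramp k m).stronglyMeasurableAtFilter _ _) (continuous_ramp k m).continuousAt

theorem softPosPart_of_le {k : ℝ} (m : ℕ) {t : ℝ} (h : t ≤ k) : softPosPart k m t = 0 := by
  refine intervalIntegral.integral_zero_ae (Filter.Eventually.of_forall fun s hs => ?_)
  rw [uIoc_of_ge h] at hs
  exact ramp_of_le m hs.2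

theorem softPosPart_mem (k : ℝ) (m : ℕ) (t : ℝ) :
    0 ≤ softPosPart k m t ∧ softPosPart k m t ≤ max (t - k) 0 := by
  by_cases h : t ≤ k
  · simp [softPosPart_of_le m h]
  · have h' : k ≤ t := by linarith
    refine ⟨intervalIntegral.integral_nonneg h' fun s _ => ramp_nonneg k m s, ?_⟩
    rw [max_eq_left (by linarith)]
    calc softPosPart k m t ≤ ∫ _ in k..t, (1 : ℝ) :=
          intervalIntegral.integral_mono_on h' ((continuous_ramp k m).intervalIntegrable _ _)
            (by simp) fun s _ => ramp_le_one k m s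
      _ = t - k := by simp

theorem tendsto_softPosPart (k t : ℝ) :
    Filter.Tendsto (fun m => softPosPart k m t) Filter.atTop (nhds (max (t - k) 0)) := by
  by_cases h : t ≤ k
  · simp [softPosPart_of_le _ h, h]
  · have h' : k ≤ t := by linarith
    have e : max (t - k) 0 = ∫ s in k..t, (1 : ℝ) := by
      rw [max_eq_left (by linarith)]; simp
    rw [e]
    refine intervalIntegral.tendsto_integral_filter_of_dominated_convergence (fun _ => (1 : ℝ))
      (Filter.Eventually.of_forall fun m => (continuous_ramp k m).aestronglyMeasurable)
      (Filter.Eventually.of_forall fun m => Filter.Eventually.of_forall fun s _ => ?_) (by simp)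
      (Filter.Eventually.of_forall fun s hs => ?_)
    · rw [Real.norm_of_nonneg (ramp_nonneg k m s)]; exact ramp_le_one k m s
    · rw [uIoc_of_le h'] at hs
      simpa [hs.1] using tendsto_ramp k s

section

variable {N : ℕ}

/-- Truncation: `η (v - k)^+` is a limit of smooth functions. -/
theorem IsSobolevLimit.cutoff_mul_posPart {p : ℝ≥0∞} (hp1 : 1 ≤ p) (hp : p ≠ ⊤)
    {K : Set (Space N)} {v : Space N → ℝ} {Dv : Space N → Space N}
    (h : IsSobolevLimit p K v Dv) (k : ℝ) {η : Space N → ℝ} (hη : ContDiff ℝ 1 η)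
    (hηc : HasCompactSupport η) :
    IsSobolevLimit p (tsupport η) (fun x => η x * max (v x - k) 0)
      (fun x => (η x * (Ioi k).indicator 1 (v x)) • Dv x + max (v x - k) 0 • gradient η x) := by
  have hp0 : p ≠ 0 := (one_pos.trans_le hp1).ne'
  have H := fun m => h.cutoff_mul_comp hp1 hp (hasDerivAt_softPosPart k m) (continuous_ramp k m)
    (M := 1) (fun t => by rw [abs_of_nonneg (ramp_nonneg k m t)]; exact ramp_le_one k m t) hη hηc
  have I := h.cutoff_mul_comp hp1 hp (G := fun t => t - k) (g := fun _ => 1)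
    (fun t => (hasDerivAt_id t).sub_const k) continuous_const (M := 1) (fun t => by simp) hη hηc
  have hgc := continuous_gradient hη
  have mpos : AEStronglyMeasurable (fun x => max (v x - k) 0) volume :=
    (by fun_prop : Continuous fun t : ℝ => max (t - k) 0).comp_aestronglyMeasurable h.memLp.1
  have mind : AEStronglyMeasurable (fun x => (Ioi k).indicator (1 : ℝ → ℝ) (v x)) volume :=
    ((measurable_one.indicator measurableSet_Ioi).comp_aemeasurable
      h.memLp.1.aemeasurable).aestronglyMeasurable
  obtain ⟨C, hC0, hC⟩ := hηc.exists_norm_le hη.continuous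
  obtain ⟨C', hC'0, hC'⟩ := hηc.gradient.exists_norm_le hgc
  have n1 : MemLp (fun x => η x * max (v x - k) 0) p volume := by
    refine I.memLp.of_le_mul (c := 1) (hη.continuous.aestronglyMeasurable.mul mpos)
      (Filter.Eventually.of_forall fun x => ?_)
    rw [one_mul, norm_mul, norm_mul]
    gcongr
    rw [Real.norm_eq_abs, Real.norm_eq_abs]
    rcases le_total (v x - k) 0 with h0 | h0
    · simp [h0]
    · simp [h0]
  have n2 : MemLp (fun x => (η x * (Ioi k).indicator 1 (v x)) • Dv x) p volume := by
    refine h.memLp_grad.of_le_mul (c := C) ((hη.continuous.aestronglyMeasurable.mul mind).smul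
      h.memLp_grad.1) (Filter.Eventually.of_forall fun x => ?_)
    rw [norm_smul, norm_mul]
    gcongr
    calc ‖η x‖ * ‖(Ioi k).indicator (1 : ℝ → ℝ) (v x)‖ ≤ C * 1 := by
          gcongr
          · exact hC x
          · by_cases hx : v x ∈ Ioi k
            · simp [hx]
            · simp [hx]
      _ = C := mul_one C
  have n3 : MemLp (fun x => max (v x - k) 0 • gradient η x) p volume := by
    have i3 : MemLp (fun x => (v x - k) • gradient η x) p volume := by
      have a1 : MemLp (fun x => k • gradient η x) p volume :=
        (hgc.memLp_of_hasCompactSupport hηc.gradient).const_smul k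
      have a2 : MemLp (fun x => v x • gradient η x) p volume := by
        refine h.memLp.of_le_mul (c := C') (h.memLp.1.smul hgc.aestronglyMeasurable)
          (Filter.Eventually.of_forall fun x => ?_)
        rw [norm_smul, mul_comm]
        gcongr
        exact hC' x
      refine (a2.sub a1).ae_eq (Filter.Eventually.of_forall fun x => ?_)
      simp only [Pi.sub_apply]; module
    refine i3.of_le_mul (c := 1) (mpos.smul hgc.aestronglyMeasurable)
      (Filter.Eventually.of_forall fun x => ?_)
    rw [one_mul, norm_smul, norm_smul]
    gcongr
    rw [Real.norm_eq_abs, Real.norm_eq_abs]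
    rcases le_total (v x - k) 0 with h0 | h0
    · simp [h0]
    · simp [h0]
  refine IsSobolevLimit.of_tendsto hp1 H n1 (n2.add n3) ?_ ?_
  · refine tendsto_eLpNorm_sub_of_dominated hp0 hp n1.norm (fun m => (H m).memLp.1)
      (fun m => Filter.Eventually.of_forall fun x => ?_) (Filter.Eventually.of_forall fun x =>
        (tendsto_softPosPart k (v x)).const_mul _)
    rw [← mul_sub, norm_mul, norm_mul]
    gcongr
    have := softPosPart_mem k m (v x)
    rw [Real.norm_eq_abs, Real.norm_of_nonneg (le_max_right _ _), abs_le]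
    constructor <;> linarith [this.1, this.2]
  · refine tendsto_eLpNorm_sub_of_dominated hp0 hp (b := fun x => C * ‖Dv x‖ +
      ‖max (v x - k) 0 • gradient η x‖) ((h.memLp_grad.norm.const_mul C).add n3.norm)
      (fun m => (H m).memLp_grad.1)
      (fun m => Filter.Eventually.of_forall fun x => ?_) (Filter.Eventually.of_forall fun x =>
        (((tendsto_ramp k (v x)).const_mul _).smul_const _).add
          ((tendsto_softPosPart k (v x)).smul_const _))
    have e : (η x * ramp k m (v x)) • Dv x + softPosPart k m (v x) • gradient η x -
        ((η x * (Ioi k).indicator 1 (v x)) • Dv x + max (v x - k) 0 • gradient η x) =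
        (η x * (ramp k m (v x) - (Ioi k).indicator 1 (v x))) • Dv x +
        (softPosPart k m (v x) - max (v x - k) 0) • gradient η x := by module
    rw [e]
    refine (norm_add_le _ _).trans (add_le_add ?_ ?_)
    · rw [norm_smul, norm_mul]
      gcongr
      calc _ ≤ C * 1 := by
            gcongr
            · exact hC x
            · rw [Real.norm_eq_abs, abs_le]
              have h1 := ramp_nonneg k m (v x)
              have h2 := ramp_le_one k m (v x)
              by_cases hx : k < v x
              · simp only [mem_Ioi, hx, indicator_of_mem, Pi.one_apply]
                constructor <;> linarith
              · simp only [mem_Ioi, hx, not_false_eq_true, indicator_of_notMem]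
                constructor <;> linarith
        _ = C := mul_one C
    · rw [norm_smul, norm_smul]
      gcongr
      have := softPosPart_mem k m (v x)
      rw [Real.norm_eq_abs, Real.norm_of_nonneg (le_max_right _ _), abs_le]
      constructor <;> linarith [this.1, this.2]

/-- Truncation and localization of a `W^{1,p}_loc` function. -/
theorem MemW1pLoc.isSobolevLimit_posPart {p : ℝ} (hp : 1 ≤ p) {Ω : Set (Space N)}
    {u : Space N → ℝ} {Du : Space N → Space N} (h : MemW1pLoc p Ω u Du) (k : ℝ)
    {χ : Space N → ℝ} (hχ : ContDiff ℝ ∞ χ) (hχc : HasCompactSupport χ) (hχΩ : tsupport χ ⊆ Ω)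
    {η : Space N → ℝ} (hη : ContDiff ℝ 1 η) (hηc : HasCompactSupport η)
    (hχη : ∀ x ∈ tsupport η, χ =ᶠ[nhds x] 1) :
    IsSobolevLimit (ENNReal.ofReal p) (tsupport η) (fun x => η x * max (u x - k) 0)
      (fun x => (η x * (Ioi k).indicator 1 (u x)) • Du x + max (u x - k) 0 • gradient η x) := by
  have hp1 : 1 ≤ ENNReal.ofReal p := by simpa using hp
  have H := (h.isSobolevLimit_cutoff hp hχ hχc hχΩ).cutoff_mul_posPart hp1 ENNReal.ofReal_ne_top k
    hη hηc
  convert! H using 2 with x x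
  · by_cases hx : x ∈ tsupport η
    · rw [(hχη x hx).eq_of_nhds]; simp
    · simp [image_eq_zero_of_notMem_tsupport hx]
  · by_cases hx : x ∈ tsupport η
    · have h1 : gradient χ x = 0 := by
        rw [(hχη x hx).gradient_eq]
        simp [gradient, fderiv_one]
      rw [(hχη x hx).eq_of_nhds, h1]; simp
    · simp [image_eq_zero_of_notMem_tsupport hx, gradient_eq_zero_of_notMem_tsupport hx]

end

/-! ### Sobolev's inequality and weighted interpolation -/

section

variable {N : ℕ}

theorem ContDiff.isSobolevLimit {p : ℝ≥0∞} {φ : Space N → ℝ} (hφ : ContDiff ℝ 1 φ)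
    (hc : HasCompactSupport φ) : IsSobolevLimit p (tsupport φ) φ (gradient φ) where
  memLp := hφ.continuous.memLp_of_hasCompactSupport hc
  memLp_grad := (continuous_gradient hφ).memLp_of_hasCompactSupport hc.gradient
  exists_approx ε _ := ⟨φ, hφ, hc, subset_rfl, by simp, by simp⟩

theorem IsSobolevLimit.sub {p : ℝ≥0∞} (hp1 : 1 ≤ p) {K : Set (Space N)} {v w : Space N → ℝ}
    {Dv Dw : Space N → Space N} (hv : IsSobolevLimit p K v Dv) (hw : IsSobolevLimit p K w Dw) :
    IsSobolevLimit p K (fun x => v x - w x) (fun x => Dv x - Dw x) where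
  memLp := hv.memLp.sub hw.memLp
  memLp_grad := hv.memLp_grad.sub hw.memLp_grad
  exists_approx ε hε := by
    have hε2 : ε / 2 ≠ 0 := by simpa using hε
    obtain ⟨φ, a1, a2, a3, a4, a5⟩ := hv.exists_approx _ hε2
    obtain ⟨ψ, b1, b2, b3, b4, b5⟩ := hw.exists_approx _ hε2
    have hts : tsupport (fun x => φ x - ψ x) ⊆ tsupport φ ∪ tsupport ψ := by
      refine closure_minimal (fun x hx => ?_) ((isClosed_tsupport φ).union (isClosed_tsupport ψ))
      by_contra h
      simp only [mem_union, not_or] at h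
      exact hx (by simp [image_eq_zero_of_notMem_tsupport h.1,
        image_eq_zero_of_notMem_tsupport h.2])
    have hgrad : ∀ x, gradient (fun x => φ x - ψ x) x = gradient φ x - gradient ψ x := fun x => by
      simp only [gradient]
      rw [fderiv_fun_sub (a1.differentiable one_ne_zero x) (b1.differentiable one_ne_zero x),
        map_sub]
    refine ⟨fun x => φ x - ψ x, a1.sub b1, (a2.isCompact.union b2.isCompact).of_isClosed_subset
      (isClosed_tsupport _) hts, hts.trans (union_subset a3 b3), ?_, ?_⟩
    · calc eLpNorm (fun x => φ x - ψ x - (v x - w x)) p volume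
          = eLpNorm ((fun x => φ x - v x) - fun x => ψ x - w x) p volume := by
            congr 1; ext x; simp; ring
        _ ≤ ε / 2 + ε / 2 := (eLpNorm_sub_le
            (a1.continuous.aestronglyMeasurable.sub hv.memLp.1)
            (b1.continuous.aestronglyMeasurable.sub hw.memLp.1) hp1).trans (add_le_add a4 b4)
        _ = ε := ENNReal.add_halves ε
    · calc eLpNorm (fun x => gradient (fun x => φ x - ψ x) x - (Dv x - Dw x)) p volume
          = eLpNorm ((fun x => gradient φ x - Dv x) - fun x => gradient ψ x - Dw x) p volume := by
            congr 1; ext1 x; simp only [hgrad, Pi.sub_apply]; abel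
        _ ≤ ε / 2 + ε / 2 := (eLpNorm_sub_le
            ((continuous_gradient a1).aestronglyMeasurable.sub hv.memLp_grad.1)
            ((continuous_gradient b1).aestronglyMeasurable.sub hw.memLp_grad.1) hp1).trans
              (add_le_add a5 b5)
        _ = ε := ENNReal.add_halves ε

/-- The constant of the Gagliardo-Nirenberg-Sobolev inequality, for `p`-th powers of norms. -/
noncomputable def sobolevConst (N : ℕ) (p : ℝ) : ℝ≥0∞ :=
  (SNormLESNormFDerivOfEqConst ℝ (volume : Measure (Space N)) p : ℝ≥0∞) ^ p

theorem sobolevConst_ne_top (N : ℕ) {p : ℝ} (hp : 0 ≤ p) : sobolevConst N p ≠ ⊤ :=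
  ENNReal.rpow_ne_top_of_nonneg hp ENNReal.coe_ne_top

/-- The Gagliardo-Nirenberg-Sobolev inequality for limits of smooth functions, by Fatou's lemma
along an approximating sequence. -/
theorem IsSobolevLimit.lintegral_rpow_le {p : ℝ} (hp : 1 ≤ p) (hpN : p < N) {K : Set (Space N)}
    {v : Space N → ℝ} {Dv : Space N → Space N}
    (h : IsSobolevLimit (ENNReal.ofReal p) K v Dv) :
    (∫⁻ x, ‖v x‖ₑ ^ (N * p / (N - p))) ^ ((N - p) / N) ≤
      sobolevConst N p * ∫⁻ x, ‖Dv x‖ₑ ^ p := by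
  have hp0 : 0 < p := by linarith
  have hN0 : (0 : ℝ) < N := by linarith
  have hNp : 0 < N - p := by linarith
  set s : ℝ := N * p / (N - p) with hs
  have hs0 : 0 < s := by positivity
  have hpz : ENNReal.ofReal p ≠ 0 := by simpa using hp0
  have hsz : ENNReal.ofReal s ≠ 0 := by simpa using hs0
  obtain ⟨φ, c1, c2, -, t1, t2, b1, b2⟩ := h.exists_seq hpz
  have m2 : ∀ n, AEStronglyMeasurable (gradient (φ n)) volume := fun n =>
    (continuous_gradient (c1 n)).aestronglyMeasurable
  set S : ℝ≥0∞ := (SNormLESNormFDerivOfEqConst ℝ (volume : Measure (Space N)) p : ℝ≥0∞) with hS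
  have hSt : S ≠ ⊤ := ENNReal.coe_ne_top
  have hGNS : ∀ n, eLpNorm (φ n) (ENNReal.ofReal s) volume ≤
      S * eLpNorm (gradient (φ n)) (ENNReal.ofReal p) volume := fun n => by
    have := eLpNorm_le_eLpNorm_fderiv_of_eq (volume : Measure (Space N)) (c1 n) (c2 n)
      (p := p.toNNReal) (p' := s.toNNReal) (by simpa using hp)
      (by simp only [finrank_euclideanSpace, Fintype.card_fin]; exact_mod_cast hN0)
      (by
        simp only [finrank_euclideanSpace, Fintype.card_fin]
        rw [NNReal.coe_inv, Real.coe_toNNReal _ hs0.le, Real.coe_toNNReal _ hp0.le, hs]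
        field_simp)
    rw [Real.coe_toNNReal _ hp0.le] at this
    refine this.trans (le_of_eq ?_)
    congr 1
    exact eLpNorm_congr_norm_ae (Filter.Eventually.of_forall fun x => (norm_gradient _ x).symm)
  have hbd : eLpNorm v (ENNReal.ofReal s) volume ≤ S * eLpNorm Dv (ENNReal.ofReal p) volume := by
    refine (Lp.eLpNorm_lim_le_liminf_eLpNorm
      (fun n => (c1 n).continuous.aestronglyMeasurable) v b1).trans ?_
    have hlim : Filter.Tendsto (fun n => S * (eLpNorm (fun x => gradient (φ n) x - Dv x)
        (ENNReal.ofReal p) volume + eLpNorm Dv (ENNReal.ofReal p) volume)) Filter.atTop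
        (nhds (S * (0 + eLpNorm Dv (ENNReal.ofReal p) volume))) :=
      ENNReal.Tendsto.const_mul (t2.add tendsto_const_nhds) (Or.inr hSt)
    rw [zero_add] at hlim
    rw [← hlim.liminf_eq]
    refine Filter.liminf_le_liminf (Filter.Eventually.of_forall fun n => (hGNS n).trans ?_)
    gcongr
    calc eLpNorm (gradient (φ n)) (ENNReal.ofReal p) volume
        = eLpNorm ((fun x => gradient (φ n) x - Dv x) + Dv) (ENNReal.ofReal p) volume := by
          congr 1; ext1 x; simp
      _ ≤ _ := eLpNorm_add_le ((m2 n).sub h.memLp_grad.1) h.memLp_grad.1 (by simpa using hp)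
  rw [eLpNorm_eq_lintegral_rpow_enorm_toReal hsz ENNReal.ofReal_ne_top,
    eLpNorm_eq_lintegral_rpow_enorm_toReal hpz ENNReal.ofReal_ne_top,
    ENNReal.toReal_ofReal hs0.le, ENNReal.toReal_ofReal hp0.le] at hbd
  have h2 := ENNReal.rpow_le_rpow hbd hp0.le
  rw [ENNReal.mul_rpow_of_nonneg _ _ hp0.le, ← ENNReal.rpow_mul, ← ENNReal.rpow_mul,
    one_div_mul_cancel hp0.ne', ENNReal.rpow_one] at h2
  have e : 1 / s * p = (N - p) / N := by rw [hs]; field_simp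
  rw [e] at h2
  exact h2

end

section Weighted

variable {α : Type*} [MeasurableSpace α] {μ : Measure α}

theorem ENNReal.rpow_mul_rpow_le_add (a b : ℝ≥0∞) {τ : ℝ} (h0 : 0 ≤ τ) (h1 : τ ≤ 1) :
    a ^ (1 - τ) * b ^ τ ≤ a + b := by
  have h2 : 0 ≤ 1 - τ := by linarith
  calc a ^ (1 - τ) * b ^ τ ≤ (a + b) ^ (1 - τ) * (a + b) ^ τ := by
        gcongr
        · exact le_self_add
        · exact le_add_self
    _ = a + b := by
        rw [← ENNReal.rpow_add_of_nonneg _ _ h2 h0]; simp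

/-- Hölder's inequality with a weight in `L^q`, `q > n > p`: the exponents interpolate `hv ∈ L^p`
between `v ∈ L^p` and `v ∈ L^{np/(n-p)}`. -/
theorem lintegral_mul_rpow_le_interpolate {p q n : ℝ} (hp : 0 < p) (hpn : p < n) (hnq : n < q)
    {h v : α → ℝ≥0∞} (hh : AEMeasurable h μ) (hv : AEMeasurable v μ) :
    ∫⁻ x, (h x * v x) ^ p ∂μ ≤ (∫⁻ x, h x ^ q ∂μ) ^ (p / q) *
      ((∫⁻ x, v x ^ p ∂μ) ^ (1 - n / q) *
      ((∫⁻ x, v x ^ (n * p / (n - p)) ∂μ) ^ ((n - p) / n)) ^ (n / q)) := by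
  have hq : 0 < q := by linarith
  have hn : 0 < n := by linarith
  have hnp : 0 < n - p := by linarith
  have hτ : 0 ≤ 1 - n / q := by rw [sub_nonneg, div_le_one hq]; exact hnq.le
  have key := ENNReal.lintegral_prod_norm_pow_le (μ := μ) Finset.univ
    (f := ![fun x => h x ^ q, fun x => v x ^ p, fun x => v x ^ (n * p / (n - p))])
    (p := ![p / q, 1 - n / q, (n - p) / q])
    (by intro i _; fin_cases i
        · exact hh.pow_const _
        · exact hv.pow_const _
        · exact hv.pow_const _)
    (by simp only [Fin.sum_univ_three, Matrix.cons_val_zero, Matrix.cons_val_one, Matrix.cons_val]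
        field_simp; ring)
    (by intro i _; fin_cases i
        · change 0 ≤ p / q; positivity
        · exact hτ
        · change 0 ≤ (n - p) / q; positivity)
  simp only [Fin.prod_univ_three, Matrix.cons_val_zero, Matrix.cons_val_one, Matrix.cons_val]
    at key
  have e1 : ∀ x, (h x ^ q) ^ (p / q) * (v x ^ p) ^ (1 - n / q) *
      (v x ^ (n * p / (n - p))) ^ ((n - p) / q) = (h x * v x) ^ p := fun x => by
    rw [← ENNReal.rpow_mul, ← ENNReal.rpow_mul, ← ENNReal.rpow_mul, mul_assoc,
      ← ENNReal.rpow_add_of_nonneg _ _ (by positivity) (by positivity),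
      ENNReal.mul_rpow_of_nonneg _ _ hp.le]
    congr 2
    · field_simp
    · field_simp; ring
  simp only [e1] at key
  refine key.trans (le_of_eq ?_)
  rw [mul_assoc]
  congr 2
  rw [← ENNReal.rpow_mul]
  congr 1
  field_simp

/-- The weighted `L^p` norm is small relative to the Sobolev norm, modulo the `L^p` norm. -/
theorem lintegral_mul_rpow_le_add {p q n : ℝ} (hp : 0 < p) (hpn : p < n) (hnq : n < q)
    {h v : α → ℝ≥0∞} (hh : AEMeasurable h μ) (hv : AEMeasurable v μ) {M ε : ℝ≥0∞}
    (hM : (∫⁻ x, h x ^ q ∂μ) ^ (p / q) ≤ M ^ (1 - n / q)) (hε0 : ε ≠ 0) (hε : ε ≠ ⊤) :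
    ∫⁻ x, (h x * v x) ^ p ∂μ ≤
      ε⁻¹ ^ ((n / q) / (1 - n / q)) * M * (∫⁻ x, v x ^ p ∂μ) +
      ε * (∫⁻ x, v x ^ (n * p / (n - p)) ∂μ) ^ ((n - p) / n) := by
  have hq : 0 < q := by linarith
  have hn : 0 < n := by linarith
  have hτ : 0 < 1 - n / q := by rw [sub_pos, div_lt_one hq]; exact hnq
  refine (lintegral_mul_rpow_le_interpolate hp hpn hnq hh hv).trans ?_
  refine le_trans ?_ (ENNReal.rpow_mul_rpow_le_add _ _ (by positivity : 0 ≤ n / q)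
    (by linarith : n / q ≤ 1))
  rw [ENNReal.mul_rpow_of_nonneg _ _ hτ.le, ENNReal.mul_rpow_of_nonneg _ _ hτ.le,
    ENNReal.mul_rpow_of_nonneg _ _ (by positivity : 0 ≤ n / q), ← ENNReal.rpow_mul ε⁻¹,
    div_mul_cancel₀ _ hτ.ne', ENNReal.inv_rpow]
  have hc : (ε ^ (n / q))⁻¹ * ε ^ (n / q) = 1 := by
    refine ENNReal.inv_mul_cancel ?_ ?_
    · exact (ENNReal.rpow_pos (pos_iff_ne_zero.2 hε0) hε).ne'
    · exact ENNReal.rpow_ne_top_of_nonneg (by positivity) hε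
  set P := (∫⁻ x, v x ^ p ∂μ) ^ (1 - n / q)
  set Q := ((∫⁻ x, v x ^ (n * p / (n - p)) ∂μ) ^ ((n - p) / n)) ^ (n / q)
  calc _ ≤ M ^ (1 - n / q) * (P * Q) := by gcongr
    _ = ((ε ^ (n / q))⁻¹ * ε ^ (n / q)) * (M ^ (1 - n / q) * (P * Q)) := by rw [hc, one_mul]
    _ = _ := by ring

end Weighted

/-! ### Radial cutoffs and local solutions -/

section Cutoff

theorem exists_deriv_smoothTransition_le :
    ∃ H : ℝ, 0 ≤ H ∧ ∀ t, |deriv Real.smoothTransition t| ≤ H := by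
  have hc : Continuous (deriv Real.smoothTransition) :=
    (Real.smoothTransition.contDiff (n := 1)).continuous_deriv le_rfl
  obtain ⟨H, hH⟩ := (isCompact_Icc (a := (0 : ℝ)) (b := 1)).exists_bound_of_continuousOn
    hc.continuousOn
  refine ⟨H, (norm_nonneg _).trans (hH 0 (by simp)), fun t => ?_⟩
  by_cases h0 : t < 0
  · have : Real.smoothTransition =ᶠ[nhds t] fun _ => 0 := by
      filter_upwards [Iio_mem_nhds h0] with s hs
      exact Real.smoothTransition.zero_of_nonpos (le_of_lt hs)
    rw [this.deriv_eq]
    simpa using (norm_nonneg _).trans (hH 0 (by simp))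
  · by_cases h1 : 1 < t
    · have : Real.smoothTransition =ᶠ[nhds t] fun _ => 1 := by
        filter_upwards [Ioi_mem_nhds h1] with s hs
        exact Real.smoothTransition.one_of_one_le (le_of_lt hs)
      rw [this.deriv_eq]
      simpa using (norm_nonneg _).trans (hH 0 (by simp))
    · exact hH t ⟨not_lt.1 h0, not_lt.1 h1⟩

variable {N : ℕ}

/-- A smooth radial cutoff, equal to `1` on `closedBall x₀ s` and to `0` off `closedBall x₀ t`. -/
noncomputable def radialCutoff (x₀ : Space N) (s t : ℝ) (x : Space N) : ℝ :=
  Real.smoothTransition ((t ^ 2 - ‖x - x₀‖ ^ 2) / (t ^ 2 - s ^ 2))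

theorem contDiff_radialCutoff (x₀ : Space N) (s t : ℝ) : ContDiff ℝ ∞ (radialCutoff x₀ s t) := by
  have h1 : ContDiff ℝ ∞ fun x : Space N => (t ^ 2 - ‖x - x₀‖ ^ 2) / (t ^ 2 - s ^ 2) :=
    (contDiff_const.sub ((contDiff_id.sub contDiff_const).norm_sq ℝ)).div_const _
  exact Real.smoothTransition.contDiff.comp h1

theorem radialCutoff_nonneg (x₀ : Space N) (s t : ℝ) (x : Space N) : 0 ≤ radialCutoff x₀ s t x :=
  Real.smoothTransition.nonneg _

theorem radialCutoff_le_one (x₀ : Space N) (s t : ℝ) (x : Space N) : radialCutoff x₀ s t x ≤ 1 :=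
  Real.smoothTransition.le_one _

variable {x₀ : Space N} {s t : ℝ}

theorem radialCutoff_eq_one (hs : 0 ≤ s) (hst : s < t) {x : Space N} (hx : x ∈ closedBall x₀ s) :
    radialCutoff x₀ s t x = 1 := by
  rw [mem_closedBall, dist_eq_norm] at hx
  refine Real.smoothTransition.one_of_one_le ?_
  have h1 : 0 < t ^ 2 - s ^ 2 := by nlinarith
  rw [one_le_div h1]
  have := norm_nonneg (x - x₀)
  nlinarith

theorem tsupport_radialCutoff_subset (hs : 0 ≤ s) (hst : s < t) :
    tsupport (radialCutoff x₀ s t) ⊆ closedBall x₀ t := by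
  refine closure_minimal (fun x hx => ?_) isClosed_closedBall
  by_contra h
  rw [mem_closedBall, dist_eq_norm, not_le] at h
  refine hx (Real.smoothTransition.zero_of_nonpos ?_)
  have h1 : 0 < t ^ 2 - s ^ 2 := by nlinarith
  exact div_nonpos_of_nonpos_of_nonneg (by nlinarith) h1.le

theorem hasCompactSupport_radialCutoff (hs : 0 ≤ s) (hst : s < t) :
    HasCompactSupport (radialCutoff x₀ s t) :=
  (isCompact_closedBall x₀ t).of_isClosed_subset (isClosed_tsupport _)
    (tsupport_radialCutoff_subset hs hst)

/-- The gradient bound for radial cutoffs, with a constant that is uniform in the radii. -/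
theorem exists_norm_gradient_radialCutoff_le : ∃ H : ℝ, 0 ≤ H ∧ ∀ (N : ℕ) (x₀ : Space N) (s t : ℝ),
    0 ≤ s → s < t → ∀ x, ‖gradient (radialCutoff x₀ s t) x‖ ≤ H / (t - s) := by
  obtain ⟨H, hH0, hH⟩ := exists_deriv_smoothTransition_le
  refine ⟨2 * H, by positivity, fun N x₀ s t hs hst x => ?_⟩
  have hts : 0 < t - s := by linarith
  by_cases hx : x ∈ tsupport (radialCutoff x₀ s t)
  · have hx' := tsupport_radialCutoff_subset hs hst hx
    rw [mem_closedBall, dist_eq_norm] at hx'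
    have h1 : HasGradientAt (fun x : Space N => (t ^ 2 - ‖x - x₀‖ ^ 2) / (t ^ 2 - s ^ 2))
        (-(2 / (t ^ 2 - s ^ 2)) • (x - x₀)) x := by
      rw [hasGradientAt_iff_hasFDerivAt]
      have h2 : HasFDerivAt (fun x : Space N => ‖x - x₀‖ ^ 2)
          (2 • (innerSL ℝ (x - x₀)).comp (ContinuousLinearMap.id ℝ (Space N))) x :=
        ((hasFDerivAt_id x).sub_const x₀).norm_sq
      have h3 := (h2.const_sub (t ^ 2)).mul_const (t ^ 2 - s ^ 2)⁻¹
      simp only [div_eq_mul_inv]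
      refine h3.congr_fderiv ?_
      ext y
      simp
      ring
    have h4 := (HasDerivAt.comp_hasGradientAt
      ((Real.smoothTransition.contDiff (n := 1)).differentiable one_ne_zero _).hasDerivAt
        h1).gradient
    have h5 : gradient (radialCutoff x₀ s t) x = _ := h4
    rw [h5, norm_smul, norm_smul, Real.norm_eq_abs, Real.norm_eq_abs, abs_neg]
    have h6 : 0 < t ^ 2 - s ^ 2 := by nlinarith
    rw [abs_of_pos (a := 2 / (t ^ 2 - s ^ 2)) (by positivity)]
    calc _ ≤ H * (2 / (t ^ 2 - s ^ 2) * t) := by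
          gcongr
          exact hH _
      _ ≤ H * (2 / (t - s)) := by
          gcongr
          rw [div_mul_eq_mul_div, div_le_div_iff₀ h6 hts]
          nlinarith
      _ = _ := by ring
  · rw [gradient_eq_zero_of_notMem_tsupport hx, norm_zero]
    positivity

end Cutoff

/-- The local form of the equation at scale `r`: the fields `a = A(x, u, ∇u)` and
`b = B(x, u, ∇u)` satisfy the structure conditions on `ball x₀ (2 * r)` with a single weight
`h ∈ L^q` in front of `u`. The remaining data are bounded by `Λ` times their natural power of `r`,
and `weight_le` is the corresponding scaling-invariant bound for `h`. The fields `a` and `b` are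
arbitrary off the ball, where test functions vanish. -/
structure LocalSolution {N : ℕ} (p q lam Λ : ℝ) (Ω : Set (Space N)) (x₀ : Space N) (r : ℝ)
    (u : Space N → ℝ) (Du a : Space N → Space N) (b h : Space N → ℝ) : Prop where
  sobolev : MemW1pLoc p Ω u Du
  pos : 0 < r
  ball_subset : ball x₀ (2 * r) ⊆ Ω
  weak : ∀ φ : Space N → ℝ, ContDiff ℝ 1 φ → HasCompactSupport φ → tsupport φ ⊆ ball x₀ (2 * r) →
    Integrable (fun x => inner ℝ (a x) (gradient φ x) - b x * φ x) volume ∧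
    ∫ x, (inner ℝ (a x) (gradient φ x) - b x * φ x) = 0
  aestronglyMeasurable_weight : AEStronglyMeasurable h volume
  weight_nonneg : ∀ x, 0 ≤ h x
  weight_le : (∫⁻ x, ‖h x‖ₑ ^ q) ^ (p / q) ≤ (ENNReal.ofReal (Λ * r⁻¹ ^ p)) ^ (1 - N / q)
  coercive : ∀ᵐ x ∂(volume.restrict (ball x₀ (2 * r))),
    lam * ‖Du x‖ ^ p ≤ inner ℝ (a x) (Du x) + (h x * |u x|) ^ p + Λ * r⁻¹ ^ p
  growth_a : ∀ᵐ x ∂(volume.restrict (ball x₀ (2 * r))),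
    ‖a x‖ ≤ Λ * ‖Du x‖ ^ (p - 1) + (h x * |u x|) ^ (p - 1) + Λ * r⁻¹ ^ (p - 1)
  growth_b : ∀ᵐ x ∂(volume.restrict (ball x₀ (2 * r))),
    |b x| ≤ Λ * r⁻¹ * ‖Du x‖ ^ (p - 1) + h x * (h x * |u x|) ^ (p - 1) + Λ * r⁻¹ ^ p

namespace LocalSolution

variable {N : ℕ} {p q lam Λ : ℝ} {Ω : Set (Space N)} {x₀ : Space N} {r : ℝ}
  {u : Space N → ℝ} {Du a : Space N → Space N} {b h : Space N → ℝ}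

/-- The weighted Sobolev inequality for the weight of the equation. -/
theorem lintegral_weight_mul_le (D : LocalSolution p q lam Λ Ω x₀ r u Du a b h) (hp : 1 < p)
    (hpN : p < N) (hNq : N < q) {K : Set (Space N)} {v : Space N → ℝ} {Dv : Space N → Space N}
    (hv : IsSobolevLimit (ENNReal.ofReal p) K v Dv) :
    ∫⁻ x, (‖h x‖ₑ * ‖v x‖ₑ) ^ p ≤ ENNReal.ofReal (Λ * r⁻¹ ^ p) * (∫⁻ x, ‖v x‖ₑ ^ p) +
      sobolevConst N p * ∫⁻ x, ‖Dv x‖ₑ ^ p := by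
  have h1 := lintegral_mul_rpow_le_add (ε := 1) (by linarith) hpN hNq
    D.aestronglyMeasurable_weight.enorm hv.memLp.1.enorm D.weight_le one_ne_zero (by simp)
  simp only [inv_one, ENNReal.one_rpow, one_mul] at h1
  exact h1.trans (by gcongr; exact hv.lintegral_rpow_le hp.le hpN)

end LocalSolution

/-! ### Sobolev test functions -/

namespace LocalSolution

variable {N : ℕ} {p q lam Λ : ℝ} {Ω : Set (Space N)} {x₀ : Space N} {r : ℝ}
  {u : Space N → ℝ} {Du a : Space N → Space N} {b h : Space N → ℝ}

/-- A cutoff that is `1` near `closedBall x₀ ρ`, so that its gradient vanishes there. -/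
theorem exists_cutoff_eventuallyEq_one {ρ t : ℝ} (hρ : 0 ≤ ρ) (hρt : ρ < t) (x₀ : Space N) :
    ∃ χ : Space N → ℝ, ContDiff ℝ ∞ χ ∧ HasCompactSupport χ ∧ tsupport χ ⊆ ball x₀ t ∧
      ∀ x ∈ closedBall x₀ ρ, χ =ᶠ[nhds x] 1 := by
  refine ⟨radialCutoff x₀ ((2 * ρ + t) / 3) ((ρ + 2 * t) / 3), contDiff_radialCutoff _ _ _,
    hasCompactSupport_radialCutoff (by linarith) (by linarith),
    (tsupport_radialCutoff_subset (by linarith) (by linarith)).trans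
      (closedBall_subset_ball (by linarith)), fun x hx => ?_⟩
  have hx' : x ∈ ball x₀ ((2 * ρ + t) / 3) := closedBall_subset_ball (by linarith) hx
  filter_upwards [isOpen_ball.mem_nhds hx'] with y hy
  exact radialCutoff_eq_one (by linarith) (by linarith) (ball_subset_closedBall hy)

/-- The product of the weight with the solution is locally in `L^p`. -/
theorem memLp_weight_mul (D : LocalSolution p q lam Λ Ω x₀ r u Du a b h) (hp : 1 < p)
    (hpN : p < N) (hNq : N < q) {ρ : ℝ} (hρ : 0 ≤ ρ) (hρr : ρ < 2 * r) :
    MemLp (fun x => h x * |u x|) (ENNReal.ofReal p) (volume.restrict (closedBall x₀ ρ)) := by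
  obtain ⟨χ, c1, c2, c3, c4⟩ := exists_cutoff_eventuallyEq_one hρ hρr x₀
  have hS := D.sobolev.isSobolevLimit_cutoff hp.le c1 c2 (c3.trans D.ball_subset)
  have hpz : ENNReal.ofReal p ≠ 0 := by simpa using by linarith
  have hm : MemLp (fun x => h x * |χ x * u x|) (ENNReal.ofReal p) volume := by
    refine ⟨D.aestronglyMeasurable_weight.mul hS.memLp.1.norm, ?_⟩
    refine (eLpNorm_lt_top_iff_lintegral_rpow_enorm_lt_top hpz ENNReal.ofReal_ne_top).2 ?_
    rw [ENNReal.toReal_ofReal (by linarith)]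
    have h1 := D.lintegral_weight_mul_le hp hpN hNq hS
    have f1 := lintegral_rpow_enorm_lt_top_of_eLpNorm_lt_top hpz ENNReal.ofReal_ne_top hS.memLp.2
    have f2 := lintegral_rpow_enorm_lt_top_of_eLpNorm_lt_top hpz ENNReal.ofReal_ne_top
      hS.memLp_grad.2
    rw [ENNReal.toReal_ofReal (by linarith)] at f1 f2
    simp only [enorm_mul, ← Real.norm_eq_abs, enorm_norm] at h1 f1 ⊢
    refine h1.trans_lt (ENNReal.add_lt_top.2 ⟨ENNReal.mul_lt_top ENNReal.ofReal_lt_top f1,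
      ENNReal.mul_lt_top (sobolevConst_ne_top N (by linarith)).lt_top f2⟩)
  refine (hm.restrict (closedBall x₀ ρ)).ae_eq ?_
  filter_upwards [ae_restrict_mem isClosed_closedBall.measurableSet] with x hx
  rw [(c4 x hx).eq_of_nhds]; simp

/-- The equation may be tested with limits in `W^{1,p}` of `C^1` functions. No exponent is assumed
for `a` and `b`: their growth conditions, with Sobolev's inequality for the weighted part of `b`,
make the integrands converge in `L^1`. -/
theorem weak_of_isSobolevLimit (D : LocalSolution p q lam Λ Ω x₀ r u Du a b h) (hp : 1 < p)
    (hpN : p < N) (hNq : N < q) (hΛ : 0 ≤ Λ) {ρ : ℝ} (hρ : 0 ≤ ρ) (hρr : ρ < 2 * r)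
    {φ : Space N → ℝ} {Dφ : Space N → Space N}
    (hφ : IsSobolevLimit (ENNReal.ofReal p) (closedBall x₀ ρ) φ Dφ) :
    Integrable (fun x => inner ℝ (a x) (Dφ x) - b x * φ x) volume ∧
      ∫ x, (inner ℝ (a x) (Dφ x) - b x * φ x) = 0 := by
  have hp0 : 0 < p := by linarith
  have hp1 : 1 ≤ ENNReal.ofReal p := by simpa using hp.le
  have hpz : ENNReal.ofReal p ≠ 0 := by simpa using by linarith
  have hpt : ENNReal.ofReal p ≠ ⊤ := ENNReal.ofReal_ne_top
  have hr := D.pos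
  have hR : 0 < r⁻¹ := by positivity
  set K := closedBall x₀ ρ with hK
  have hKm : MeasurableSet K := isClosed_closedBall.measurableSet
  have hKb : K ⊆ ball x₀ (2 * r) := closedBall_subset_ball hρr
  have hKc : IsCompact K := isCompact_closedBall _ _
  have : IsFiniteMeasure (volume.restrict K) := isFiniteMeasure_restrict.2 hKc.measure_lt_top.ne
  obtain ⟨φn, c1, c2, c3, t1, t2, b1, b2⟩ := hφ.exists_seq hpz
  set F : Space N → ℝ := fun x => inner ℝ (a x) (Dφ x) - b x * φ x with hF
  set Fn : ℕ → Space N → ℝ := fun n x => inner ℝ (a x) (gradient (φn n) x) - b x * φn n x with hFn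
  have hw : ∀ n, Integrable (Fn n) volume ∧ ∫ x, Fn n x = 0 := fun n =>
    D.weak _ (c1 n) (c2 n) ((c3 n).trans hKb)
  have hlim : ∀ᵐ x, Filter.Tendsto (fun n => Fn n x) Filter.atTop (nhds (F x)) := by
    filter_upwards [b1, b2] with x h1 h2
    exact (Filter.Tendsto.inner tendsto_const_nhds h2).sub (h1.const_mul _)
  have hFm : AEStronglyMeasurable F volume :=
    aestronglyMeasurable_of_tendsto_ae _ (fun n => (hw n).1.1) hlim
  -- The growth conditions bound `a` and `b` by multiples of `T ^ (p - 1)`, and `T ∈ L^p(K)`.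
  set T : Space N → ℝ := fun x => ‖Du x‖ + h x * |u x| + r⁻¹ with hT
  have hTp : MemLp T (ENNReal.ofReal p) (volume.restrict K) :=
    ((D.sobolev.2.2 K (hKb.trans D.ball_subset) hKc).norm.add
      (D.memLp_weight_mul hp hpN hNq hρ hρr)).add (memLp_const _)
  have hT0 : ∀ x, 0 ≤ T x := fun x => by
    have := D.weight_nonneg x
    positivity
  have hψS : ∀ n, IsSobolevLimit (ENNReal.ofReal p) K (fun x => φn n x - φ x)
      (fun x => gradient (φn n) x - Dφ x) := fun n =>
    (((c1 n).isSobolevLimit (c2 n)).mono (c3 n)).sub hp1 hφ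
  set X : ℕ → Space N → ℝ := fun n x => (2 * Λ + 1) * ‖gradient (φn n) x - Dφ x‖ +
    (2 * Λ * r⁻¹) * ‖φn n x - φ x‖ + h x * ‖φn n x - φ x‖ with hX
  have hbound : ∀ n, ∀ᵐ x ∂(volume.restrict K), ‖Fn n x - F x‖ ≤ T x ^ (p - 1) * X n x := by
    intro n
    have hab := ae_mono (Measure.restrict_mono hKb le_rfl) D.growth_a
    have hbb := ae_mono (Measure.restrict_mono hKb le_rfl) D.growth_b
    filter_upwards [hab, hbb] with x ha hb
    have hh := D.weight_nonneg x
    have hp' : 0 ≤ p - 1 := by linarith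
    have e : Fn n x - F x = inner ℝ (a x) (gradient (φn n) x - Dφ x) -
        b x * (φn n x - φ x) := by
      simp only [hFn, hF, inner_sub_right]; ring
    have s1 : ‖Du x‖ ^ (p - 1) ≤ T x ^ (p - 1) := by
      refine Real.rpow_le_rpow (norm_nonneg _) ?_ hp'
      simp only [hT]; nlinarith [mul_nonneg hh (abs_nonneg (u x))]
    have s2 : (h x * |u x|) ^ (p - 1) ≤ T x ^ (p - 1) := by
      refine Real.rpow_le_rpow (by positivity) ?_ hp'
      simp only [hT]; nlinarith [norm_nonneg (Du x)]
    have s3 : r⁻¹ ^ (p - 1) ≤ T x ^ (p - 1) := by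
      refine Real.rpow_le_rpow (by positivity) ?_ hp'
      simp only [hT]; nlinarith [norm_nonneg (Du x), mul_nonneg hh (abs_nonneg (u x))]
    have s4 : r⁻¹ ^ p = r⁻¹ * r⁻¹ ^ (p - 1) := by
      rw [← Real.rpow_one_add' hR.le (by linarith)]; congr 1; ring
    have ha' : ‖a x‖ ≤ (2 * Λ + 1) * T x ^ (p - 1) := by
      refine ha.trans ?_
      nlinarith [mul_le_mul_of_nonneg_left s1 hΛ, mul_le_mul_of_nonneg_left s3 hΛ]
    have hb' : |b x| ≤ (2 * Λ * r⁻¹ + h x) * T x ^ (p - 1) := by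
      refine hb.trans ?_
      rw [s4]
      have hΛR : 0 ≤ Λ * r⁻¹ := by positivity
      nlinarith [mul_le_mul_of_nonneg_left s1 hΛR, mul_le_mul_of_nonneg_left s3 hΛR,
        mul_le_mul_of_nonneg_left s2 hh]
    rw [e]
    calc _ ≤ ‖a x‖ * ‖gradient (φn n) x - Dφ x‖ + |b x| * ‖φn n x - φ x‖ := by
          refine (norm_sub_le _ _).trans (add_le_add (norm_inner_le_norm _ _) ?_)
          rw [norm_mul, Real.norm_eq_abs]
      _ ≤ (2 * Λ + 1) * T x ^ (p - 1) * ‖gradient (φn n) x - Dφ x‖ +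
          (2 * Λ * r⁻¹ + h x) * T x ^ (p - 1) * ‖φn n x - φ x‖ := by gcongr
      _ = _ := by simp only [hX]; ring
  have hoff : ∀ n, ∀ᵐ x ∂(volume.restrict Kᶜ), Fn n x - F x = 0 := by
    intro n
    filter_upwards [ae_restrict_of_ae b1, ae_restrict_of_ae b2,
      ae_restrict_mem hKm.compl] with x h1 h2 hx
    have z1 : ∀ m, φn m x = 0 := fun m =>
      image_eq_zero_of_notMem_tsupport fun hh => hx (c3 m hh)
    have z2 : ∀ m, gradient (φn m) x = 0 := fun m =>
      gradient_eq_zero_of_notMem_tsupport fun hh => hx (c3 m hh)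
    simp only [z1] at h1
    simp only [z2] at h2
    have w1 := tendsto_nhds_unique h1 tendsto_const_nhds
    have w2 := tendsto_nhds_unique h2 tendsto_const_nhds
    simp only [hFn, hF, z1, z2, w1, w2, inner_zero_right, mul_zero, sub_self]
  have hXm : ∀ n, AEStronglyMeasurable (X n) volume := fun n =>
    (((hψS n).memLp_grad.1.norm.const_mul _).add ((hψS n).memLp.1.norm.const_mul _)).add
      (D.aestronglyMeasurable_weight.mul (hψS n).memLp.1.norm)
  have hXle : ∀ n, eLpNorm (X n) (ENNReal.ofReal p) volume ≤
      ENNReal.ofReal (2 * Λ + 1) * eLpNorm (fun x => gradient (φn n) x - Dφ x)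
        (ENNReal.ofReal p) volume +
      ENNReal.ofReal (2 * Λ * r⁻¹) * eLpNorm (fun x => φn n x - φ x) (ENNReal.ofReal p) volume +
      (ENNReal.ofReal (Λ * r⁻¹ ^ p) * eLpNorm (fun x => φn n x - φ x)
        (ENNReal.ofReal p) volume ^ p + sobolevConst N p *
        eLpNorm (fun x => gradient (φn n) x - Dφ x) (ENNReal.ofReal p) volume ^ p) ^ (1 / p) := by
    intro n
    have q1 : AEStronglyMeasurable (fun x => (2 * Λ + 1) * ‖gradient (φn n) x - Dφ x‖) volume :=
      (hψS n).memLp_grad.1.norm.const_mul _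
    have q2 : AEStronglyMeasurable (fun x => (2 * Λ * r⁻¹) * ‖φn n x - φ x‖) volume :=
      (hψS n).memLp.1.norm.const_mul _
    have q3 : AEStronglyMeasurable (fun x => h x * ‖φn n x - φ x‖) volume :=
      D.aestronglyMeasurable_weight.mul (hψS n).memLp.1.norm
    refine (eLpNorm_add_le (q1.add q2) q3 hp1).trans (add_le_add
      ((eLpNorm_add_le q1 q2 hp1).trans (add_le_add ?_ ?_)) ?_)
    · refine eLpNorm_le_mul_eLpNorm_of_ae_le_mul (Filter.Eventually.of_forall fun x => ?_) _
      rw [Real.norm_of_nonneg (by positivity)]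
    · refine eLpNorm_le_mul_eLpNorm_of_ae_le_mul (Filter.Eventually.of_forall fun x => ?_) _
      rw [Real.norm_of_nonneg (by positivity)]
    · have h1 := D.lintegral_weight_mul_le hp hpN hNq (hψS n)
      simp only [eLpNorm_eq_lintegral_rpow_enorm_toReal hpz hpt, ENNReal.toReal_ofReal hp0.le]
      rw [← ENNReal.rpow_mul, ← ENNReal.rpow_mul, one_div_mul_cancel hp0.ne', ENNReal.rpow_one,
        ENNReal.rpow_one]
      refine ENNReal.rpow_le_rpow (le_trans (le_of_eq ?_) h1) (by positivity)
      refine lintegral_congr fun x => ?_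
      rw [enorm_mul, enorm_norm]
  have hXlim : Filter.Tendsto (fun n => eLpNorm (X n) (ENNReal.ofReal p) volume) Filter.atTop
      (nhds 0) := by
    have hc : ∀ {c : ℝ≥0∞} (_ : c ≠ ⊤) {f : ℕ → ℝ≥0∞},
        Filter.Tendsto f Filter.atTop (nhds 0) →
        Filter.Tendsto (fun n => c * f n) Filter.atTop (nhds 0) := fun hc f hf => by
      simpa using ENNReal.Tendsto.const_mul hf (Or.inr hc)
    have hpow : ∀ {s : ℝ} (_ : 0 < s) {f : ℕ → ℝ≥0∞},
        Filter.Tendsto f Filter.atTop (nhds 0) →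
        Filter.Tendsto (fun n => f n ^ s) Filter.atTop (nhds 0) := fun {s} hs f hf => by
      have := (ENNReal.continuous_rpow_const (y := s)).tendsto 0 |>.comp hf
      rwa [ENNReal.zero_rpow_of_pos hs] at this
    have r1 := hc (ENNReal.ofReal_ne_top (r := 2 * Λ + 1)) t2
    have r2 := hc (ENNReal.ofReal_ne_top (r := 2 * Λ * r⁻¹)) t1
    have r3 := hc (ENNReal.ofReal_ne_top (r := Λ * r⁻¹ ^ p)) (hpow hp0 t1)
    have r4 := hc (sobolevConst_ne_top N hp0.le) (hpow hp0 t2)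
    have r34 := r3.add r4
    rw [add_zero] at r34
    have r5 := (r1.add r2).add (hpow (s := 1 / p) (by positivity) r34)
    simp only [add_zero] at r5
    exact tendsto_of_tendsto_of_tendsto_of_le_of_le tendsto_const_nhds r5 (fun _ => zero_le) hXle
  have hdiff : ∀ n, ∫⁻ x, ‖Fn n x - F x‖ₑ ≤
      (∫⁻ x in K, ‖T x‖ₑ ^ p) ^ ((p - 1) / p) * eLpNorm (X n) (ENNReal.ofReal p) volume := by
    intro n
    rw [← lintegral_add_compl _ hKm]
    have z : ∫⁻ x in Kᶜ, ‖Fn n x - F x‖ₑ = 0 := by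
      refine (lintegral_congr_ae ?_).trans lintegral_zero
      filter_upwards [hoff n] with x hx
      simp [hx]
    rw [z, add_zero]
    have hpc : (p / (p - 1)).HolderConjugate p := by
      have := (Real.HolderConjugate.conjExponent hp).symm
      simpa [Real.conjExponent] using this
    have hle1 : ∫⁻ x in K, ‖Fn n x - F x‖ₑ ≤ ∫⁻ x in K, (‖T x‖ₑ ^ (p - 1) * ‖X n x‖ₑ) := by
      refine lintegral_mono_ae ?_
      filter_upwards [hbound n] with x hx
      rw [← ofReal_norm]
      refine (ENNReal.ofReal_le_ofReal hx).trans ?_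
      rw [ENNReal.ofReal_mul (Real.rpow_nonneg (hT0 x) _), Real.enorm_of_nonneg (hT0 x),
        ENNReal.ofReal_rpow_of_nonneg (hT0 x) (by linarith)]
      gcongr
      rw [← ofReal_norm]
      exact ENNReal.ofReal_le_ofReal (Real.le_norm_self _)
    refine hle1.trans ?_
    refine (ENNReal.lintegral_mul_le_Lp_mul_Lq (volume.restrict K) hpc
      (hTp.1.enorm.pow_const (p - 1)) (hXm n).enorm.restrict).trans ?_
    have e1 : ∀ x, (‖T x‖ₑ ^ (p - 1)) ^ (p / (p - 1)) = ‖T x‖ₑ ^ p := fun x => by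
      rw [← ENNReal.rpow_mul]; congr 1
      have : p - 1 ≠ 0 := by linarith
      field_simp
    simp only [e1, one_div_div]
    gcongr
    rw [eLpNorm_eq_lintegral_rpow_enorm_toReal hpz hpt, ENNReal.toReal_ofReal hp0.le]
    gcongr
    exact Measure.restrict_le_self
  have hTfin : (∫⁻ x in K, ‖T x‖ₑ ^ p) ^ ((p - 1) / p) ≠ ⊤ := by
    have := lintegral_rpow_enorm_lt_top_of_eLpNorm_lt_top hpz hpt hTp.2
    rw [ENNReal.toReal_ofReal hp0.le] at this
    exact ENNReal.rpow_ne_top_of_nonneg (div_nonneg (by linarith) hp0.le) this.ne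
  have hdlim : Filter.Tendsto (fun n => ∫⁻ x, ‖Fn n x - F x‖ₑ) Filter.atTop (nhds 0) := by
    have := ENNReal.Tendsto.const_mul hXlim (Or.inr hTfin)
    rw [mul_zero] at this
    exact tendsto_of_tendsto_of_tendsto_of_le_of_le tendsto_const_nhds this (fun _ => zero_le) hdiff
  have hFi : Integrable F volume := by
    obtain ⟨n, hn⟩ := ((ENNReal.tendsto_nhds_zero.1 hdlim) 1 one_pos).exists
    have : Integrable (fun x => Fn n x - F x) volume :=
      ⟨(hw n).1.1.sub hFm, hn.trans_lt ENNReal.one_lt_top⟩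
    refine ((hw n).1.sub this).congr (Filter.Eventually.of_forall fun x => ?_)
    simp
  refine ⟨hFi, ?_⟩
  have := tendsto_integral_of_L1 F hFi.1 (Filter.Eventually.of_forall fun n => (hw n).1) hdlim
  simp only [fun n => (hw n).2] at this
  exact (tendsto_nhds_unique this tendsto_const_nhds)

end LocalSolution

/-! ### Pointwise energy inequality -/

section Elementary

/-- Young's inequality for the exponents `p/(p-1)` and `p`, with a small first term. -/
theorem mul_rpow_sub_one_mul_le {p ε c a b : ℝ} (hp : 1 < p) (hε : 0 < ε) (hc : 0 ≤ c) (ha : 0 ≤ a)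
    (hb : 0 ≤ b) : c * a ^ (p - 1) * b ≤ ε * a ^ p + c * (c / ε) ^ (p - 1) * b ^ p := by
  have e : ∀ {t : ℝ}, 0 ≤ t → t ^ p = t ^ (p - 1) * t := fun {t} ht => by
    rw [← Real.rpow_add_one' ht (by linarith)]; congr 1; ring
  have h1 : 0 ≤ a ^ (p - 1) := Real.rpow_nonneg ha _
  have h2 : 0 ≤ b ^ (p - 1) := Real.rpow_nonneg hb _
  have h3 : 0 ≤ (c / ε) ^ (p - 1) := Real.rpow_nonneg (by positivity) _
  rcases le_total (c * b) (ε * a) with h | h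
  · have : c * a ^ (p - 1) * b ≤ ε * a ^ p := by
      rw [e ha]; nlinarith [mul_le_mul_of_nonneg_left h h1]
    have : 0 ≤ c * (c / ε) ^ (p - 1) * b ^ p := by positivity
    linarith
  · have h4 : a ≤ c / ε * b := by rw [div_mul_eq_mul_div, le_div_iff₀ hε]; linarith
    have h5 : a ^ (p - 1) ≤ (c / ε) ^ (p - 1) * b ^ (p - 1) := by
      rw [← Real.mul_rpow (by positivity) hb]
      exact Real.rpow_le_rpow ha h4 (by linarith)
    have : c * a ^ (p - 1) * b ≤ c * (c / ε) ^ (p - 1) * b ^ p := by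
      rw [e hb]
      have := mul_le_mul_of_nonneg_left h5 (mul_nonneg hc hb)
      nlinarith
    have : 0 ≤ ε * a ^ p := by positivity
    linarith

theorem rpow_sub_one_mul_le {p a b : ℝ} (hp : 1 < p) (ha : 0 ≤ a) (hb : 0 ≤ b) :
    a ^ (p - 1) * b ≤ a ^ p + b ^ p := by
  simpa using mul_rpow_sub_one_mul_le hp one_pos zero_le_one ha hb

theorem add_rpow_le_two_rpow_mul {p a b : ℝ} (hp : 0 ≤ p) (ha : 0 ≤ a) (hb : 0 ≤ b) :
    (a + b) ^ p ≤ 2 ^ p * (a ^ p + b ^ p) := by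
  have h1 : 0 ≤ a ^ p := Real.rpow_nonneg ha _
  have h2 : 0 ≤ b ^ p := Real.rpow_nonneg hb _
  have h3 : (0 : ℝ) ≤ 2 ^ p := by positivity
  rcases le_total a b with h | h
  · calc (a + b) ^ p ≤ (2 * b) ^ p := Real.rpow_le_rpow (by positivity) (by linarith) hp
      _ = 2 ^ p * b ^ p := Real.mul_rpow (by norm_num) hb
      _ ≤ _ := by gcongr; linarith
  · calc (a + b) ^ p ≤ (2 * a) ^ p := Real.rpow_le_rpow (by positivity) (by linarith) hp
      _ = 2 ^ p * a ^ p := Real.mul_rpow (by norm_num) ha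
      _ ≤ _ := by gcongr; linarith

/-- The constant of the pointwise energy inequality; the quotients by `lam / 4` come from the two
uses of Young's inequality that absorb the gradient terms. -/
noncomputable def energyConst (p lam Λ : ℝ) : ℝ :=
  p * Λ * (p * Λ / (lam / 4)) ^ (p - 1) + Λ * (Λ / (lam / 4)) ^ (p - 1) + (p + 2) + (p + 2) * Λ

theorem energyConst_nonneg {p lam Λ : ℝ} (hp : 1 < p) (hlam : 0 < lam) (hΛ : 0 ≤ Λ) :
    0 ≤ energyConst p lam Λ := by
  have : 0 < p := by linarith
  unfold energyConst; positivity

/-- The pointwise energy inequality behind the Caccioppoli estimate. Here `α`, `γ`, `β` stand for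
`a · ∇u`, `a · ∇η` and `b`; `e`, `s`, `d`, `w`, `U` for `η`, `|∇u|`, `|∇η|`, `(u - k)^+` and `u`;
`θ` for the weight `h` and `R` for `r⁻¹`. -/
theorem pointwise_energy {p lam Λ e s d w θ U R α γ β : ℝ} (hp : 1 < p) (hlam : 0 < lam)
    (hΛ : 0 ≤ Λ) (he0 : 0 ≤ e) (he1 : e ≤ 1) (hs : 0 ≤ s) (hd : 0 ≤ d) (hw : 0 ≤ w) (hθ : 0 ≤ θ)
    (hR : 0 ≤ R) (hwU : w ≤ U)
    (h1 : lam * s ^ p ≤ α + (θ * U) ^ p + Λ * R ^ p)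
    (h2 : |γ| ≤ (Λ * s ^ (p - 1) + (θ * U) ^ (p - 1) + Λ * R ^ (p - 1)) * d)
    (h3 : |β| ≤ Λ * R * s ^ (p - 1) + θ * (θ * U) ^ (p - 1) + Λ * R ^ p) :
    lam / 2 * (e * s) ^ p ≤ (e ^ p * α + p * e ^ (p - 1) * w * γ - β * (e ^ p * w)) +
      energyConst p lam Λ * ((e * (θ * U)) ^ p + R ^ p + (w * d) ^ p + (e * w * R) ^ p) := by
  have hp0 : 0 < p := by linarith
  have hU : 0 ≤ U := hw.trans hwU
  have E : ∀ {t : ℝ}, 0 ≤ t → t ^ p = t ^ (p - 1) * t := fun {t} ht => by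
    rw [← Real.rpow_add_one' ht (by linarith)]; congr 1; ring
  have M : ∀ {t z : ℝ} (_ : 0 ≤ t), (e * t) ^ z = e ^ z * t ^ z := fun ht => Real.mul_rpow he0 ht
  set t := θ * U with ht
  have ht0 : 0 ≤ t := by positivity
  have y1 := mul_rpow_sub_one_mul_le hp (by positivity : 0 < lam / 4) (by positivity : 0 ≤ p * Λ)
    (by positivity : 0 ≤ e * s) (by positivity : 0 ≤ w * d)
  have y2 := rpow_sub_one_mul_le hp (by positivity : 0 ≤ e * t) (by positivity : 0 ≤ w * d)
  have y3 := rpow_sub_one_mul_le hp (by positivity : 0 ≤ e * R) (by positivity : 0 ≤ w * d)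
  have y4 := mul_rpow_sub_one_mul_le hp (by positivity : 0 < lam / 4) hΛ
    (by positivity : 0 ≤ e * s) (by positivity : 0 ≤ e * w * R)
  have y6 := rpow_sub_one_mul_le hp (by positivity : 0 ≤ e * R) (by positivity : 0 ≤ e * w * R)
  have y7 : (e * R) ^ p ≤ R ^ p := Real.rpow_le_rpow (by positivity)
    (mul_le_of_le_one_left hR he1) hp0.le
  set K1 := p * Λ * (p * Λ / (lam / 4)) ^ (p - 1) with hK1
  set K2 := Λ * (Λ / (lam / 4)) ^ (p - 1) with hK2
  have hK1' : 0 ≤ K1 := by positivity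
  have hK2' : 0 ≤ K2 := by positivity
  have hep : 0 ≤ e ^ p := Real.rpow_nonneg he0 _
  have hep1 : 0 ≤ e ^ (p - 1) := Real.rpow_nonneg he0 _
  -- The structure conditions enter through `g1` (coercivity), `g2` (the flux against `∇η`) and `g3`
  -- (the right-hand side); Young's inequality then leaves `lam / 4` twice on `(e * s) ^ p`.
  have g1 : lam * (e * s) ^ p ≤ e ^ p * α + (e * t) ^ p + Λ * (e * R) ^ p := by
    rw [M hs, M ht0, M hR]
    linarith [mul_le_mul_of_nonneg_left h1 hep]
  have g2 : -(p * e ^ (p - 1) * w * γ) ≤ p * Λ * (e * s) ^ (p - 1) * (w * d) +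
      p * ((e * t) ^ (p - 1) * (w * d)) + p * Λ * ((e * R) ^ (p - 1) * (w * d)) := by
    rw [M hs, M ht0, M hR]
    have h4 : -γ ≤ |γ| := neg_le_abs γ
    have h5 : 0 ≤ p * e ^ (p - 1) * w := by positivity
    linarith [mul_le_mul_of_nonneg_left (h4.trans h2) h5]
  have g3 : β * (e ^ p * w) ≤ Λ * (e * s) ^ (p - 1) * (e * w * R) + (e * t) ^ p +
      Λ * ((e * R) ^ (p - 1) * (e * w * R)) := by
    have h4 : β ≤ |β| := le_abs_self β
    have h5 : 0 ≤ e ^ p * w := by positivity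
    have h6 := mul_le_mul_of_nonneg_right (h4.trans h3) h5
    have h7 : θ * t ^ (p - 1) * (e ^ p * w) ≤ (e * t) ^ p := by
      rw [M ht0, E ht0]
      have : θ * w ≤ t := by rw [ht]; gcongr
      have h8 : 0 ≤ e ^ p * t ^ (p - 1) := mul_nonneg hep (Real.rpow_nonneg ht0 _)
      linarith [mul_le_mul_of_nonneg_left this h8]
    have h9 : Λ * R * s ^ (p - 1) * (e ^ p * w) = Λ * (e * s) ^ (p - 1) * (e * w * R) := by
      rw [M hs, E he0]; ring
    have h10 : Λ * R ^ p * (e ^ p * w) = Λ * ((e * R) ^ (p - 1) * (e * w * R)) := by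
      rw [M hR, E he0, E hR]; ring
    linarith
  have n1 : 0 ≤ (e * t) ^ p := by positivity
  have n2 : 0 ≤ R ^ p := by positivity
  have n3 : 0 ≤ (w * d) ^ p := by positivity
  have n4 : 0 ≤ (e * w * R) ^ p := by positivity
  have z2 := mul_le_mul_of_nonneg_left y2 hp0.le
  have z3 := mul_le_mul_of_nonneg_left y3 (by positivity : 0 ≤ p * Λ)
  have z6 := mul_le_mul_of_nonneg_left y6 hΛ
  have z7 := mul_le_mul_of_nonneg_left y7 (by positivity : 0 ≤ (p + 2) * Λ)
  have total : lam / 2 * (e * s) ^ p ≤ (e ^ p * α + p * e ^ (p - 1) * w * γ - β * (e ^ p * w)) +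
      ((p + 2) * (e * t) ^ p + (p + 2) * Λ * R ^ p + (K1 + p + p * Λ) * (w * d) ^ p +
        (K2 + Λ) * (e * w * R) ^ p) := by
    linarith
  refine total.trans (add_le_add le_rfl ?_)
  have c1 : p + 2 ≤ energyConst p lam Λ := by
    have : 0 ≤ (p + 2) * Λ := by positivity
    unfold energyConst; linarith
  have c2 : (p + 2) * Λ ≤ energyConst p lam Λ := by unfold energyConst; linarith
  have c3 : K1 + p + p * Λ ≤ energyConst p lam Λ := by unfold energyConst; linarith
  have c4 : K2 + Λ ≤ energyConst p lam Λ := by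
    have : 0 ≤ p * Λ := by positivity
    unfold energyConst; linarith
  linarith [mul_le_mul_of_nonneg_right c1 n1, mul_le_mul_of_nonneg_right c2 n2,
    mul_le_mul_of_nonneg_right c3 n3, mul_le_mul_of_nonneg_right c4 n4]

end Elementary

/-- If `P ≤ F + Q` with `∫ F = 0`, then `∫ P ≤ ∫ Q`, even when the latter are infinite. -/
theorem lintegral_ofReal_le_of_integral_eq_zero {α : Type*} [MeasurableSpace α] {μ : Measure α}
    {F P Q : α → ℝ} (hF : Integrable F μ) (hF0 : ∫ x, F x ∂μ = 0) (hP : ∀ᵐ x ∂μ, 0 ≤ P x)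
    (hQ : ∀ᵐ x ∂μ, 0 ≤ Q x) (h : ∀ᵐ x ∂μ, P x ≤ F x + Q x) :
    ∫⁻ x, ENNReal.ofReal (P x) ∂μ ≤ ∫⁻ x, ENNReal.ofReal (Q x) ∂μ := by
  have hpos : ∫⁻ x, ENNReal.ofReal (F x) ∂μ ≠ ⊤ := hF.lintegral_lt_top.ne
  have hneg : ∫⁻ x, ENNReal.ofReal (-F x) ∂μ ≠ ⊤ := hF.neg.lintegral_lt_top.ne
  have heq : ∫⁻ x, ENNReal.ofReal (F x) ∂μ = ∫⁻ x, ENNReal.ofReal (-F x) ∂μ := by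
    rw [integral_eq_lintegral_pos_part_sub_lintegral_neg_part hF, sub_eq_zero] at hF0
    exact (ENNReal.toReal_eq_toReal_iff' hpos hneg).1 hF0
  have m1 : AEMeasurable (fun x => ENNReal.ofReal (-F x)) μ := hF.1.aemeasurable.neg.ennreal_ofReal
  have m2 : AEMeasurable (fun x => ENNReal.ofReal (F x)) μ := hF.1.aemeasurable.ennreal_ofReal
  have key : ∫⁻ x, (ENNReal.ofReal (-F x) + ENNReal.ofReal (P x)) ∂μ ≤
      ∫⁻ x, (ENNReal.ofReal (F x) + ENNReal.ofReal (Q x)) ∂μ := by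
    refine lintegral_mono_ae ?_
    filter_upwards [hP, hQ, h] with x h1 h2 h3
    rcases le_total (F x) 0 with h4 | h4
    · rw [ENNReal.ofReal_of_nonpos h4, zero_add, ← ENNReal.ofReal_add (by linarith) h1]
      exact ENNReal.ofReal_le_ofReal (by linarith)
    · rw [ENNReal.ofReal_of_nonpos (by linarith : -F x ≤ 0), zero_add, ← ENNReal.ofReal_add h4 h2]
      exact ENNReal.ofReal_le_ofReal h3
  rw [lintegral_add_left' m1, lintegral_add_left' m2, heq] at key
  exact (ENNReal.add_le_add_iff_left hneg).1 key

/-! ### Caccioppoli's inequality -/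

section

variable {N : ℕ}

theorem contDiff_rpow_cutoff {p : ℝ} (hp : 1 ≤ p) {η : Space N → ℝ} (hη : ContDiff ℝ 1 η) :
    ContDiff ℝ 1 (fun x => η x ^ p) :=
  hη.rpow_const_of_le (by exact_mod_cast hp)

theorem gradient_rpow_cutoff {p : ℝ} (hp : 1 ≤ p) {η : Space N → ℝ} (hη : ContDiff ℝ 1 η)
    (x : Space N) : gradient (fun x => η x ^ p) x = (p * η x ^ (p - 1)) • gradient η x :=
  ((Real.hasDerivAt_rpow_const (Or.inr hp)).comp_hasGradientAt
    (hη.hasGradientAt one_ne_zero x)).gradient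

theorem tsupport_rpow_cutoff_subset {p : ℝ} (hp : 0 < p) (η : Space N → ℝ) :
    tsupport (fun x => η x ^ p) ⊆ tsupport η := by
  refine closure_mono fun x hx => ?_
  simp only [Function.mem_support] at hx ⊢
  intro h
  exact hx (by rw [h, Real.zero_rpow hp.ne'])

end

namespace LocalSolution

variable {N : ℕ} {p q lam Λ : ℝ} {Ω : Set (Space N)} {x₀ : Space N} {r : ℝ}
  {u : Space N → ℝ} {Du a : Space N → Space N} {b h : Space N → ℝ}

/-- The Caccioppoli inequality on the superlevel set `{u > k}`, obtained by testing the equation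
with `η^p (u - k)^+`. -/
theorem lintegral_energy_le (D : LocalSolution p q lam Λ Ω x₀ r u Du a b h) (hp : 1 < p)
    (hpN : p < N) (hNq : N < q) (hlam : 0 < lam) (hΛ : 0 ≤ Λ) {ρ k L : ℝ} (hρ : 0 ≤ ρ)
    (hρr : ρ < 2 * r) (hk : 0 ≤ k) (hL : 1 ≤ L) {η : Space N → ℝ} (hη : ContDiff ℝ 1 η)
    (hη0 : ∀ x, 0 ≤ η x) (hη1 : ∀ x, η x ≤ 1) (hηs : tsupport η ⊆ closedBall x₀ ρ)
    (hηg : ∀ x, ‖gradient η x‖ ≤ L * r⁻¹) :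
    ENNReal.ofReal (lam / 2) * ∫⁻ x in closedBall x₀ ρ,
        {x | k < u x}.indicator (fun x => (‖η x‖ₑ * ‖Du x‖ₑ) ^ p) x ≤
      ENNReal.ofReal (energyConst p lam Λ * (2 * 2 ^ p)) *
        ∫⁻ x in closedBall x₀ ρ, ((‖h x‖ₑ * ‖η x * max (u x - k) 0‖ₑ) ^ p +
          (ENNReal.ofReal (L * r⁻¹) ^ p * ‖max (u x - k) 0‖ₑ ^ p +
          {x | k < u x}.indicator (fun x => ENNReal.ofReal k ^ p * ‖h x‖ₑ ^ p +
            ENNReal.ofReal r⁻¹ ^ p) x)) := by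
  have hp0 : 0 < p := by linarith
  have hr := D.pos
  have hR : 0 < r⁻¹ := by positivity
  set K := closedBall x₀ ρ with hK
  have hKm : MeasurableSet K := isClosed_closedBall.measurableSet
  have hKb : K ⊆ ball x₀ (2 * r) := closedBall_subset_ball hρr
  have hηc : HasCompactSupport η := (isCompact_closedBall x₀ ρ).of_isClosed_subset
    (isClosed_tsupport _) hηs
  have hC := energyConst_nonneg hp hlam hΛ
  -- The test function is `η^p (u - k)^+`: the power of `η` matches the `p`-growth of the fields.
  obtain ⟨χ, c1, c2, c3, c4⟩ := exists_cutoff_eventuallyEq_one hρ hρr x₀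
  have hts := tsupport_rpow_cutoff_subset hp0 η
  have hS := (D.sobolev.isSobolevLimit_posPart hp.le k c1 c2 (c3.trans D.ball_subset)
    (contDiff_rpow_cutoff hp.le hη) (hηc.of_isClosed_subset (isClosed_tsupport _) hts)
    (fun x hx => c4 x (hηs (hts hx)))).mono (hts.trans hηs)
  obtain ⟨hF, hF0⟩ := D.weak_of_isSobolevLimit hp hpN hNq hΛ hρ hρr hS
  simp only [gradient_rpow_cutoff hp.le hη] at hF hF0
  set F : Space N → ℝ := _ with hFdef
  change Integrable F volume at hF
  change ∫ x, F x = 0 at hF0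
  have hoff : ∀ x, x ∉ K → F x = 0 := fun x hx => by
    have h0 : η x = 0 := image_eq_zero_of_notMem_tsupport fun hh => hx (hηs hh)
    have h1 : gradient η x = 0 := gradient_eq_zero_of_notMem_tsupport fun hh => hx (hηs hh)
    simp only [hFdef, h0, h1, Real.zero_rpow hp0.ne', smul_zero, zero_mul, zero_smul, mul_zero,
      add_zero, inner_zero_right, sub_zero]
  rw [← setIntegral_eq_integral_of_forall_compl_eq_zero hoff] at hF0
  set P : Space N → ℝ := {x | k < u x}.indicator fun x => lam / 2 * (η x * ‖Du x‖) ^ p with hP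
  set Q : Space N → ℝ := {x | k < u x}.indicator fun x => energyConst p lam Λ *
    ((η x * (h x * u x)) ^ p + r⁻¹ ^ p + (max (u x - k) 0 * ‖gradient η x‖) ^ p +
      (η x * max (u x - k) 0 * r⁻¹) ^ p) with hQ
  have hP0 : ∀ x, 0 ≤ P x := fun x => by
    refine indicator_nonneg (fun y _ => ?_) x
    have := hη0 y
    positivity
  have hQ0 : ∀ x, 0 ≤ Q x := fun x => by
    refine indicator_nonneg (fun y hy => ?_) x
    have h1 := hη0 y
    have h2 := D.weight_nonneg y
    have h3 : 0 ≤ u y := hk.trans (le_of_lt hy)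
    positivity
  have hPQ : ∀ᵐ x ∂(volume.restrict K), P x ≤ F x + Q x := by
    filter_upwards [ae_mono (Measure.restrict_mono hKb le_rfl) D.coercive,
      ae_mono (Measure.restrict_mono hKb le_rfl) D.growth_a,
      ae_mono (Measure.restrict_mono hKb le_rfl) D.growth_b] with x h1 h2 h3
    by_cases hx : k < u x
    · have hux : 0 ≤ u x := hk.trans hx.le
      rw [abs_of_nonneg hux] at h1 h2 h3
      have hγ : |inner ℝ (a x) (gradient η x)| ≤ (Λ * ‖Du x‖ ^ (p - 1) +
          (h x * u x) ^ (p - 1) + Λ * r⁻¹ ^ (p - 1)) * ‖gradient η x‖ :=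
        (abs_real_inner_le_norm _ _).trans (by gcongr)
      have key := pointwise_energy hp hlam hΛ (hη0 x) (hη1 x) (norm_nonneg (Du x))
        (norm_nonneg (gradient η x)) (le_max_right (u x - k) 0) (D.weight_nonneg x) hR.le
        (max_le (by linarith) hux) h1 hγ h3
      have hPx : P x = lam / 2 * (η x * ‖Du x‖) ^ p := by simp [hP, hx]
      have hQx : Q x = energyConst p lam Λ *
        ((η x * (h x * u x)) ^ p + r⁻¹ ^ p + (max (u x - k) 0 * ‖gradient η x‖) ^ p +
          (η x * max (u x - k) 0 * r⁻¹) ^ p) := by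
        simp only [hQ, mem_ofPred_eq, hx, indicator_of_mem]
      rw [hPx, hQx]
      refine key.trans (le_of_eq ?_)
      congr 1
      have hx' : u x ∈ Ioi k := hx
      simp only [hFdef, hx', indicator_of_mem, Pi.one_apply, mul_one, inner_add_right,
        inner_smul_right]
      ring
    · have h5 : max (u x - k) 0 = 0 := max_eq_right (by linarith)
      have hx' : u x ∉ Ioi k := hx
      simp only [hP, hQ, hFdef, mem_ofPred_eq, hx, hx', not_false_eq_true, indicator_of_notMem, h5,
        mul_zero, zero_smul, add_zero, inner_zero_right, sub_zero, le_refl]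
  have main := lintegral_ofReal_le_of_integral_eq_zero hF.integrableOn hF0
    (Filter.Eventually.of_forall hP0) (Filter.Eventually.of_forall hQ0) hPQ
  have hL0 : 0 ≤ L * r⁻¹ := by positivity
  calc _ ≤ ∫⁻ x in K, ENNReal.ofReal (P x) := by
        rw [← lintegral_const_mul' _ _ ENNReal.ofReal_ne_top]
        refine lintegral_mono fun x => ?_
        by_cases hx : k < u x
        · simp only [hP, mem_ofPred_eq, hx, indicator_of_mem]
          rw [ENNReal.ofReal_mul (by positivity), ← ENNReal.ofReal_rpow_of_nonneg
            (mul_nonneg (hη0 x) (norm_nonneg _)) hp0.le, ENNReal.ofReal_mul (hη0 x),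
            Real.enorm_of_nonneg (hη0 x), ofReal_norm]
        · simp [hx]
    _ ≤ ∫⁻ x in K, ENNReal.ofReal (Q x) := main
    _ ≤ _ := by
        rw [← lintegral_const_mul' _ _ ENNReal.ofReal_ne_top]
        refine lintegral_mono fun x => ?_
        by_cases hx : k < u x
        · have hw : max (u x - k) 0 = u x - k := max_eq_left (by linarith)
          have hw0 : 0 ≤ u x - k := by linarith
          have hθ := D.weight_nonneg x
          have he := hη0 x
          simp only [hQ, mem_ofPred_eq, hx, indicator_of_mem, hw]
          have s1 : (η x * (h x * u x)) ^ p ≤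
              2 ^ p * ((h x * (η x * (u x - k))) ^ p + (k * h x) ^ p) := by
            refine le_trans (Real.rpow_le_rpow (mul_nonneg he (mul_nonneg hθ (hk.trans hx.le))) ?_
              hp0.le) (add_rpow_le_two_rpow_mul hp0.le (by positivity) (by positivity))
            nlinarith [mul_le_mul_of_nonneg_right (hη1 x) (mul_nonneg hk hθ)]
          have s2 : ((u x - k) * ‖gradient η x‖) ^ p ≤ (L * r⁻¹ * (u x - k)) ^ p := by
            refine Real.rpow_le_rpow (by positivity) ?_ hp0.le
            rw [mul_comm]; gcongr; exact hηg x
          have s3 : (η x * (u x - k) * r⁻¹) ^ p ≤ (L * r⁻¹ * (u x - k)) ^ p := by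
            refine Real.rpow_le_rpow (by positivity) ?_ hp0.le
            calc η x * (u x - k) * r⁻¹ ≤ L * (u x - k) * r⁻¹ := by
                  gcongr; exact (hη1 x).trans hL
              _ = _ := by ring
          have h2p : (1 : ℝ) ≤ 2 ^ p := Real.one_le_rpow (by norm_num) hp0.le
          set A1 := (h x * (η x * (u x - k))) ^ p with hA1
          set A2 := (k * h x) ^ p with hA2
          set A3 := (L * r⁻¹ * (u x - k)) ^ p with hA3
          set A4 := r⁻¹ ^ p with hA4
          have n1 : 0 ≤ A1 := by positivity
          have n2 : 0 ≤ A2 := by positivity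
          have n3 : 0 ≤ A3 := by positivity
          have n4 : 0 ≤ A4 := by positivity
          have s4 : energyConst p lam Λ * ((η x * (h x * u x)) ^ p + A4 +
              ((u x - k) * ‖gradient η x‖) ^ p + (η x * (u x - k) * r⁻¹) ^ p) ≤
              energyConst p lam Λ * (2 * 2 ^ p) * (A1 + (A3 + (A2 + A4))) := by
            rw [mul_assoc (energyConst p lam Λ)]
            refine mul_le_mul_of_nonneg_left ?_ hC
            nlinarith [mul_le_mul_of_nonneg_right h2p n1, mul_le_mul_of_nonneg_right h2p n2,
              mul_le_mul_of_nonneg_right h2p n3, mul_le_mul_of_nonneg_right h2p n4]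
          refine (ENNReal.ofReal_le_ofReal s4).trans (le_of_eq ?_)
          rw [ENNReal.ofReal_mul (by positivity), ENNReal.ofReal_add n1 (by positivity),
            ENNReal.ofReal_add n3 (by positivity), ENNReal.ofReal_add n2 n4, hA1, hA2, hA3, hA4,
            ← ENNReal.ofReal_rpow_of_nonneg (by positivity) hp0.le,
            ← ENNReal.ofReal_rpow_of_nonneg (by positivity) hp0.le,
            ← ENNReal.ofReal_rpow_of_nonneg (by positivity) hp0.le,
            ← ENNReal.ofReal_rpow_of_nonneg (by positivity) hp0.le,
            ENNReal.ofReal_mul hθ, ENNReal.ofReal_mul hL0, ENNReal.ofReal_mul hk,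
            ENNReal.mul_rpow_of_nonneg _ _ hp0.le, ENNReal.mul_rpow_of_nonneg _ _ hp0.le,
            ENNReal.mul_rpow_of_nonneg _ _ hp0.le, ENNReal.mul_rpow_of_nonneg _ _ hp0.le,
            Real.enorm_of_nonneg hθ, Real.enorm_of_nonneg (mul_nonneg he hw0),
            Real.enorm_of_nonneg hw0]
        · simp [hQ, hx]

end LocalSolution

/-! ### Sobolev's inequality for truncations -/

/-- Absorption of half of the left-hand side, which needs `E` to be finite. -/
theorem ENNReal.le_two_mul_of_le_half_add {E B : ℝ≥0∞} (hE : E ≠ ⊤) (h : E ≤ E / 2 + B) :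
    E ≤ 2 * B := by
  have h1 : E / 2 + E / 2 ≤ E / 2 + B := by rwa [ENNReal.add_halves]
  have h2 : E / 2 ≤ B := (ENNReal.add_le_add_iff_left (ENNReal.div_ne_top hE two_ne_zero)).1 h1
  calc E = 2 * (E / 2) := (ENNReal.mul_div_cancel two_ne_zero ENNReal.ofNat_ne_top).symm
    _ ≤ 2 * B := by gcongr

/-- Hölder's inequality on a set: the `L^p` integral over `A` in terms of the `L^q` norm. -/
theorem setLIntegral_rpow_le {α : Type*} [MeasurableSpace α] {μ : Measure α} {p q : ℝ}
    (hp : 0 < p) (hpq : p < q) {f : α → ℝ≥0∞} (hf : AEMeasurable f μ) (A : Set α) :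
    ∫⁻ x in A, f x ^ p ∂μ ≤ (∫⁻ x, f x ^ q ∂μ) ^ (p / q) * μ A ^ (1 - p / q) := by
  have hq : 0 < q := by linarith
  have h1 := ENNReal.lintegral_mul_norm_pow_le (μ := μ.restrict A)
    (f := fun x => f x ^ q) (g := fun _ => 1) (hf.restrict.pow_const q) aemeasurable_const
    (p := p / q) (q := 1 - p / q) (by positivity)
    (by rw [sub_nonneg, div_le_one hq]; exact hpq.le) (by ring)
  have e : ∀ x, (f x ^ q) ^ (p / q) = f x ^ p := fun x => by
    rw [← ENNReal.rpow_mul]; congr 1; field_simp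
  simp only [e, ENNReal.one_rpow, mul_one, lintegral_const, one_mul, Measure.restrict_apply_univ]
    at h1
  refine h1.trans ?_
  gcongr
  exact Measure.restrict_le_self

namespace LocalSolution

/-- The Sobolev norm of the truncation `η (u - k)^+` is controlled by the `L^p` norm of
`(u - k)^+` and the measure of the superlevel set. -/
theorem exists_sobolev_truncation_le {N : ℕ} {p q lam Λ : ℝ} (hp : 1 < p) (hpN : p < N)
    (hNq : N < q) (hlam : 0 < lam) (hΛ : 0 ≤ Λ) :
    ∃ C : ℝ≥0∞, C ≠ ⊤ ∧ ∀ {Ω : Set (Space N)} {x₀ : Space N} {r : ℝ} {u : Space N → ℝ}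
      {Du a : Space N → Space N} {b h : Space N → ℝ},
      LocalSolution p q lam Λ Ω x₀ r u Du a b h → ∀ {ρ k L : ℝ}, 0 ≤ ρ → ρ < 2 * r → 0 ≤ k →
      1 ≤ L → ∀ {η : Space N → ℝ}, ContDiff ℝ 1 η → (∀ x, 0 ≤ η x) → (∀ x, η x ≤ 1) →
      tsupport η ⊆ closedBall x₀ ρ → (∀ x, ‖gradient η x‖ ≤ L * r⁻¹) →
      (∫⁻ x, ‖η x * max (u x - k) 0‖ₑ ^ (N * p / (N - p))) ^ ((N - p) / N) ≤
        C * (ENNReal.ofReal (L * r⁻¹) ^ p *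
            (∫⁻ x in closedBall x₀ ρ, ‖max (u x - k) 0‖ₑ ^ p) +
          (ENNReal.ofReal k ^ p * (ENNReal.ofReal r⁻¹ ^ p) ^ (1 - N / q) *
            (volume.restrict (closedBall x₀ ρ)) {x | k < u x} ^ (1 - p / q) +
          ENNReal.ofReal r⁻¹ ^ p * (volume.restrict (closedBall x₀ ρ)) {x | k < u x})) := by
  have hp0 : 0 < p := by linarith
  have hq0 : 0 < q := by linarith
  have hN0 : (0 : ℝ) < N := by linarith
  have hτ : 0 < 1 - N / q := by rw [sub_pos, div_lt_one hq0]; exact hNq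
  have hC := energyConst_nonneg hp hlam hΛ
  set S := sobolevConst N p with hS
  have hSt : S ≠ ⊤ := sobolevConst_ne_top N hp0.le
  set CE : ℝ≥0∞ := ENNReal.ofReal (energyConst p lam Λ * (2 * 2 ^ p)) with hCE
  set cl : ℝ≥0∞ := ENNReal.ofReal (lam / 2) with hcl
  have hcl0 : cl ≠ 0 := by simpa [hcl] using hlam
  have hclt : cl ≠ ⊤ := ENNReal.ofReal_ne_top
  set K0 : ℝ≥0∞ := S * 2 ^ (p - 1) * (cl⁻¹ * CE + 1) with hK0
  have h2p : (2 : ℝ≥0∞) ^ (p - 1) ≠ ⊤ :=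
    ENNReal.rpow_ne_top_of_nonneg (by linarith) ENNReal.ofNat_ne_top
  have hK0t : K0 ≠ ⊤ := ENNReal.mul_ne_top (ENNReal.mul_ne_top hSt h2p) (ENNReal.add_ne_top.2
    ⟨ENNReal.mul_ne_top (ENNReal.inv_ne_top.2 hcl0) ENNReal.ofReal_ne_top, ENNReal.one_ne_top⟩)
  -- This value of `ε` makes `K0 * ε ≤ 1 / 2`, so that the Sobolev norm can be absorbed.
  set ε : ℝ≥0∞ := (2 * (K0 + 1))⁻¹ with hε
  have hK1t : 2 * (K0 + 1) ≠ ⊤ := ENNReal.mul_ne_top ENNReal.ofNat_ne_top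
    (ENNReal.add_ne_top.2 ⟨hK0t, ENNReal.one_ne_top⟩)
  have hK10 : 2 * (K0 + 1) ≠ 0 := by simp
  have hε0 : ε ≠ 0 := ENNReal.inv_ne_zero.2 hK1t
  have hεt : ε ≠ ⊤ := ENNReal.inv_ne_top.2 hK10
  have hK0ε : ∀ E : ℝ≥0∞, K0 * (ε * E) ≤ E / 2 := fun E => by
    have h1 : (K0 + 1) * ε = 2⁻¹ := by
      rw [hε, ENNReal.mul_inv (Or.inl two_ne_zero) (Or.inl ENNReal.ofNat_ne_top),
        mul_left_comm, ENNReal.mul_inv_cancel (by simp) (ENNReal.add_ne_top.2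
          ⟨hK0t, ENNReal.one_ne_top⟩), mul_one]
    calc K0 * (ε * E) ≤ (K0 + 1) * ε * E := by
          rw [← mul_assoc]; gcongr; exact le_self_add
      _ = E / 2 := by rw [h1, mul_comm, div_eq_mul_inv]
  set cε : ℝ≥0∞ := ε⁻¹ ^ ((N / q) / (1 - N / q)) with hcε
  have hcεt : cε ≠ ⊤ := ENNReal.rpow_ne_top_of_nonneg (by positivity) (ENNReal.inv_ne_top.2 hε0)
  refine ⟨2 * (K0 * (cε * ENNReal.ofReal Λ + 2 + ENNReal.ofReal Λ ^ (1 - N / q) + 1)),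
    ?_, ?_⟩
  · have := ENNReal.rpow_ne_top_of_nonneg hτ.le (ENNReal.ofReal_ne_top (r := Λ))
    have := ENNReal.mul_ne_top hcεt (ENNReal.ofReal_ne_top (r := Λ))
    finiteness
  intro Ω x₀ r u Du a b h D ρ k L hρ hρr hk hL η hη hη0 hη1 hηs hηg
  have hr := D.pos
  have hR : 0 < r⁻¹ := by positivity
  set K := closedBall x₀ ρ with hK
  have hKm : MeasurableSet K := isClosed_closedBall.measurableSet
  have hηc : HasCompactSupport η := (isCompact_closedBall x₀ ρ).of_isClosed_subset
    (isClosed_tsupport _) hηs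
  obtain ⟨χ, c1, c2, c3, c4⟩ := exists_cutoff_eventuallyEq_one hρ hρr x₀
  have hV := D.sobolev.isSobolevLimit_posPart hp.le k c1 c2 (c3.trans D.ball_subset) hη hηc
    (fun x hx => c4 x (hηs hx))
  have hen := D.lintegral_energy_le hp hpN hNq hlam hΛ hρ hρr hk hL hη hη0 hη1 hηs hηg
  have hsob := hV.lintegral_rpow_le hp.le hpN
  set E := (∫⁻ x, ‖η x * max (u x - k) 0‖ₑ ^ (N * p / (N - p))) ^ ((N - p) / N) with hE
  set A := {x | k < u x} with hA
  set m := (volume.restrict K) A with hm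
  set W := ∫⁻ x in K, ‖max (u x - k) 0‖ₑ ^ p with hW
  set LR : ℝ≥0∞ := ENNReal.ofReal (L * r⁻¹) ^ p with hLR
  set R : ℝ≥0∞ := ENNReal.ofReal r⁻¹ ^ p with hRdef
  have hηoff : ∀ x, x ∉ K → η x = 0 := fun x hx =>
    image_eq_zero_of_notMem_tsupport fun hh => hx (hηs hh)
  have hgoff : ∀ x, x ∉ K → gradient η x = 0 := fun x hx =>
    gradient_eq_zero_of_notMem_tsupport fun hh => hx (hηs hh)
  have hrestr : ∀ f : Space N → ℝ≥0∞, (∀ x, x ∉ K → f x = 0) → ∫⁻ x, f x = ∫⁻ x in K, f x :=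
    fun f hf => by
      rw [← lintegral_add_compl _ hKm, setLIntegral_congr_fun hKm.compl
        (g := fun _ => 0) (fun x hx => hf x hx)]
      simp
  have humK : AEStronglyMeasurable u (volume.restrict K) :=
    (D.sobolev.2.1 K ((closedBall_subset_ball hρr).trans D.ball_subset)
      (isCompact_closedBall _ _)).1
  have hwm : AEMeasurable (fun x => ‖max (u x - k) 0‖ₑ ^ p) (volume.restrict K) :=
    (((by fun_prop : Continuous fun t : ℝ => max (t - k) 0).comp_aestronglyMeasurable
      humK).enorm).pow_const p
  -- The gradient of the truncation splits into its energy on `{u > k}` and the cutoff term.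
  set J := ∫⁻ x in K, A.indicator (fun x => (‖η x‖ₑ * ‖Du x‖ₑ) ^ p) x with hJ
  have hgrad : ∫⁻ x, ‖(η x * (Ioi k).indicator 1 (u x)) • Du x +
      max (u x - k) 0 • gradient η x‖ₑ ^ p ≤ 2 ^ (p - 1) * (J + LR * W) := by
    rw [hrestr _ (fun x hx => by
      rw [hηoff x hx, hgoff x hx]; simp [hp0])]
    calc _ ≤ ∫⁻ x in K, 2 ^ (p - 1) * (LR * ‖max (u x - k) 0‖ₑ ^ p +
          A.indicator (fun x => (‖η x‖ₑ * ‖Du x‖ₑ) ^ p) x) := by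
          refine lintegral_mono fun x => ?_
          refine (ENNReal.rpow_le_rpow (enorm_add_le _ _) hp0.le).trans
            ((ENNReal.rpow_add_le_mul_rpow_add_rpow _ _ hp.le).trans ?_)
          rw [add_comm (‖(η x * (Ioi k).indicator 1 (u x)) • Du x‖ₑ ^ p)]
          gcongr
          · rw [enorm_smul, mul_comm, hLR, ← ENNReal.mul_rpow_of_nonneg _ _ hp0.le]
            gcongr
            rw [← ofReal_norm]
            exact ENNReal.ofReal_le_ofReal (hηg x)
          · by_cases hx : x ∈ A
            · have hx' : u x ∈ Ioi k := hx
              simp [hx, hx', enorm_smul]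
            · have hx' : u x ∉ Ioi k := hx
              simp [hx, hx', hp0]
      _ = _ := by
          rw [lintegral_const_mul' _ _ h2p, lintegral_add_left' (hwm.const_mul _),
            lintegral_const_mul' _ _ (ENNReal.rpow_ne_top_of_nonneg hp0.le ENNReal.ofReal_ne_top),
            add_comm]
  -- Finiteness of the Sobolev norm, without which it could not be absorbed.
  have hEt : E ≠ ⊤ := by
    have hf := lintegral_rpow_enorm_lt_top_of_eLpNorm_lt_top (by simpa using hp0)
      ENNReal.ofReal_ne_top hV.memLp_grad.2
    rw [ENNReal.toReal_ofReal hp0.le] at hf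
    exact (hsob.trans_lt (ENNReal.mul_lt_top hSt.lt_top hf)).ne
  have hM : ENNReal.ofReal (Λ * r⁻¹ ^ p) = ENNReal.ofReal Λ * R := by
    rw [ENNReal.ofReal_mul hΛ, hRdef, ENNReal.ofReal_rpow_of_nonneg hR.le hp0.le]
  have hRLR : R ≤ LR := by
    rw [hRdef, hLR]
    gcongr
    nlinarith
  -- By interpolation the weighted term costs only an `ε`-fraction of the Sobolev norm.
  have hT1 : ∫⁻ x in K, (‖h x‖ₑ * ‖η x * max (u x - k) 0‖ₑ) ^ p ≤
      cε * ENNReal.ofReal Λ * (LR * W) + ε * E := by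
    refine (setLIntegral_le_lintegral K _).trans ?_
    refine (lintegral_mul_rpow_le_add hp0 hpN hNq D.aestronglyMeasurable_weight.enorm
      hV.memLp.1.enorm D.weight_le hε0 hεt).trans (add_le_add ?_ le_rfl)
    rw [hM, hrestr _ (fun x hx => by rw [hηoff x hx]; simp [hp0])]
    calc _ ≤ cε * (ENNReal.ofReal Λ * LR) * W := by
          gcongr
          refine lintegral_mono fun x => ENNReal.rpow_le_rpow ?_ hp0.le
          rw [enorm_mul]
          refine mul_le_of_le_one_left zero_le ?_
          rw [Real.enorm_of_nonneg (hη0 _)]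
          simpa using hη1 _
      _ = _ := by ring
  have hT2 : ∫⁻ x in K, A.indicator (fun x => ENNReal.ofReal k ^ p * ‖h x‖ₑ ^ p + R) x ≤
      ENNReal.ofReal Λ ^ (1 - N / q) *
        (ENNReal.ofReal k ^ p * R ^ (1 - N / q) * m ^ (1 - p / q)) + R * m := by
    refine (lintegral_indicator_le _ _).trans ?_
    rw [lintegral_add_right _ measurable_const, lintegral_const_mul' _ _
      (ENNReal.rpow_ne_top_of_nonneg hp0.le ENNReal.ofReal_ne_top), lintegral_const,
      Measure.restrict_apply_univ]
    refine add_le_add ?_ le_rfl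
    have hw := D.weight_le
    rw [hM, ENNReal.mul_rpow_of_nonneg _ _ hτ.le] at hw
    have hH := setLIntegral_rpow_le hp0 (hpN.trans hNq)
      (D.aestronglyMeasurable_weight.enorm.restrict (s := K)) A
    have hmono : (∫⁻ x in K, ‖h x‖ₑ ^ q) ^ (p / q) ≤
        ENNReal.ofReal Λ ^ (1 - N / q) * R ^ (1 - N / q) :=
      (ENNReal.rpow_le_rpow (setLIntegral_le_lintegral K _) (by positivity)).trans hw
    calc _ ≤ ENNReal.ofReal k ^ p *
          (ENNReal.ofReal Λ ^ (1 - N / q) * R ^ (1 - N / q) * m ^ (1 - p / q)) := by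
          gcongr
          exact hH.trans (by gcongr)
      _ = _ := by ring
  set T1 := ∫⁻ x in K, (‖h x‖ₑ * ‖η x * max (u x - k) 0‖ₑ) ^ p with hT1def
  set T2 := ∫⁻ x in K, A.indicator (fun x => ENNReal.ofReal k ^ p * ‖h x‖ₑ ^ p + R) x with hT2def
  have hJle : J ≤ cl⁻¹ * CE * (T1 + (LR * W + T2)) := by
    have hsplit : ∫⁻ x in K, ((‖h x‖ₑ * ‖η x * max (u x - k) 0‖ₑ) ^ p +
        (LR * ‖max (u x - k) 0‖ₑ ^ p +
        A.indicator (fun x => ENNReal.ofReal k ^ p * ‖h x‖ₑ ^ p + R) x)) = T1 + (LR * W + T2) := by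
      have hm1 : AEMeasurable (fun x => (‖h x‖ₑ * ‖η x * max (u x - k) 0‖ₑ) ^ p)
          (volume.restrict K) := (D.aestronglyMeasurable_weight.enorm.restrict.mul
        hV.memLp.1.enorm.restrict).pow_const p
      rw [lintegral_add_left' hm1, lintegral_add_left' (hwm.const_mul _),
        lintegral_const_mul' _ _ (ENNReal.rpow_ne_top_of_nonneg hp0.le ENNReal.ofReal_ne_top)]
    rw [hsplit] at hen
    calc J = cl⁻¹ * (cl * J) := by
          rw [← mul_assoc, ENNReal.inv_mul_cancel hcl0 hclt, one_mul]
      _ ≤ cl⁻¹ * (CE * (T1 + (LR * W + T2))) := by gcongr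
      _ = _ := by ring
  set G := ENNReal.ofReal k ^ p * R ^ (1 - N / q) * m ^ (1 - p / q) with hG
  rw [mul_assoc]
  refine ENNReal.le_two_mul_of_le_half_add hEt ?_
  calc E ≤ S * (2 ^ (p - 1) * (J + LR * W)) := hsob.trans (by gcongr)
    _ ≤ S * (2 ^ (p - 1) * (cl⁻¹ * CE * (T1 + (LR * W + T2)) + 1 * (T1 + (LR * W + T2)))) := by
        refine mul_le_mul_right (mul_le_mul_right (add_le_add hJle ?_) _) _
        rw [one_mul]
        exact le_add_left le_self_add
    _ = K0 * (T1 + (LR * W + T2)) := by rw [hK0]; ring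
    _ ≤ K0 * ((cε * ENNReal.ofReal Λ * (LR * W) + ε * E) + (LR * W +
          (ENNReal.ofReal Λ ^ (1 - N / q) * G + R * m))) := by gcongr
    _ = K0 * (ε * E) + K0 * (cε * ENNReal.ofReal Λ * (LR * W) + LR * W +
          ENNReal.ofReal Λ ^ (1 - N / q) * G + R * m) := by ring
    _ ≤ E / 2 + K0 * (cε * ENNReal.ofReal Λ + 2 + ENNReal.ofReal Λ ^ (1 - N / q) + 1) *
          (LR * W + (G + R * m)) := by
        refine add_le_add (hK0ε E) ?_
        rw [mul_assoc K0]
        gcongr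
        set c1 := cε * ENNReal.ofReal Λ
        set c2 := ENNReal.ofReal Λ ^ (1 - N / q)
        calc c1 * (LR * W) + LR * W + c2 * G + R * m
            ≤ c1 * (LR * W) + LR * W + c2 * G + R * m + (LR * W + 2 * G + c1 * G + G +
              (c2 * (LR * W) + LR * W) + (c1 + 2 + c2) * (R * m)) := le_self_add
          _ = _ := by ring

end LocalSolution

/-! ### One step of the De Giorgi iteration -/

section Iteration

/-- Geometric sequences are supersolutions of the De Giorgi recursion
`z ↦ C b^j (κ z^{1+α} + z^{1+δ})` as soon as they start small enough. -/
theorem deGiorgi_recursion_le {C b κ α δ μ z : ℝ} (hC : 0 ≤ C) (hb : 0 ≤ b) (hκ : 0 ≤ κ)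
    (hα : 0 < α) (hδ : 0 < δ) (hμ : 0 < μ) (hz : 0 ≤ z) (hbα : b * μ ^ α ≤ 1)
    (hbδ : b * μ ^ δ ≤ 1) (h : C * (κ * z ^ α + z ^ δ) ≤ μ) (j : ℕ) :
    C * b ^ j * (κ * (μ ^ j * z) ^ (1 + α) + (μ ^ j * z) ^ (1 + δ)) ≤ μ ^ (j + 1) * z := by
  have key : ∀ γ : ℝ, 0 < γ → b * μ ^ γ ≤ 1 →
      b ^ j * (μ ^ j * z) ^ (1 + γ) ≤ μ ^ j * z * z ^ γ := by
    intro γ hγ hbγ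
    have h1 : (b * μ ^ γ) ^ j ≤ 1 := pow_le_one₀ (by positivity) hbγ
    have h2 : (μ ^ j) ^ γ = (μ ^ γ) ^ j := by
      rw [← Real.rpow_natCast, ← Real.rpow_mul hμ.le, mul_comm, Real.rpow_mul hμ.le,
        Real.rpow_natCast]
    rw [Real.rpow_add_of_nonneg (by positivity) zero_le_one hγ.le, Real.rpow_one,
      Real.mul_rpow (by positivity) hz, h2]
    calc _ = (b * μ ^ γ) ^ j * (μ ^ j * z * z ^ γ) := by rw [mul_pow]; ring
      _ ≤ 1 * (μ ^ j * z * z ^ γ) := by gcongr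
      _ = _ := one_mul _
  have k1 := mul_le_mul_of_nonneg_left (key α hα hbα) hκ
  have k2 := key δ hδ hbδ
  calc _ = C * (κ * (b ^ j * (μ ^ j * z) ^ (1 + α)) + b ^ j * (μ ^ j * z) ^ (1 + δ)) := by ring
    _ ≤ C * (κ * (μ ^ j * z * z ^ α) + μ ^ j * z * z ^ δ) := by gcongr
    _ = C * (κ * z ^ α + z ^ δ) * (μ ^ j * z) := by ring
    _ ≤ μ * (μ ^ j * z) := by gcongr
    _ = _ := by ring

/-- The right-hand side of the level estimate in dimensionless form: with
`y = k^p r^n z`, all powers of `r` cancel. -/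
theorem level_estimate_dimensionless {n p q c r k k' z : ℝ} (hp : 0 < p) (hpn : p < n)
    (hnq : n < q) (hc : 0 ≤ c) (hr : 0 < r) (hk : 0 < k) (hk' : 0 ≤ k') (hk'k : k' ≤ k)
    (hz : 0 ≤ z) (j : ℕ) {y m L : ℝ} (hy : y = k ^ p * r ^ n * z)
    (hm : m = y / (k / 2 ^ (j + 1)) ^ p) (hL : L = 2 ^ (j + 2)) :
    c * m ^ (p / n) * ((L * r⁻¹) ^ p * y + (k' ^ p * (r⁻¹ ^ p) ^ (1 - n / q) * m ^ (1 - p / q) +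
      r⁻¹ ^ p * m)) ≤
    k ^ p * r ^ n * ((c * 2 ^ (3 * p)) * (2 ^ (2 * p)) ^ j *
      ((1 + (k ^ p)⁻¹) * z ^ (1 + p / n) + z ^ (1 + (p / n - p / q)))) := by
  have hn : 0 < n := by linarith
  have hq : 0 < q := by linarith
  have hkp : 0 < k ^ p := by positivity
  set D : ℝ := (2 ^ (j + 1)) ^ p with hD
  have hD1 : 1 ≤ D := Real.one_le_rpow (one_le_pow₀ (by norm_num)) hp.le
  have hD0 : 0 < D := by positivity
  have hmD : m = D * r ^ n * z := by
    rw [hm, hy, Real.div_rpow hk.le (by positivity)]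
    field_simp
    rw [hD]
  have hpq : 0 ≤ 1 - p / q := by rw [sub_nonneg, div_le_one hq]; linarith
  have hm1 : m ^ (p / n) = D ^ (p / n) * r ^ p * z ^ (p / n) := by
    rw [hmD, Real.mul_rpow (by positivity) hz, Real.mul_rpow (by positivity) (by positivity),
      ← Real.rpow_mul hr.le]
    congr 3
    field_simp
  have hm2 : m ^ (1 - p / q) = D ^ (1 - p / q) * r ^ (n * (1 - p / q)) * z ^ (1 - p / q) := by
    rw [hmD, Real.mul_rpow (by positivity) hz, Real.mul_rpow (by positivity) (by positivity),
      ← Real.rpow_mul hr.le]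
  have hr1 : r⁻¹ ^ p = (r ^ p)⁻¹ := Real.inv_rpow hr.le p
  have hr2 : r ^ p * ((r⁻¹ ^ p) ^ (1 - n / q) * r ^ (n * (1 - p / q))) = r ^ n := by
    rw [hr1, ← Real.rpow_neg hr.le, ← Real.rpow_mul hr.le, ← Real.rpow_add hr, ← Real.rpow_add hr]
    congr 1
    field_simp
    ring
  have hr3 : r ^ p * r⁻¹ ^ p = 1 := by rw [hr1]; exact mul_inv_cancel₀ (by positivity)
  have hLp : (L * r⁻¹) ^ p = 2 ^ p * D * r⁻¹ ^ p := by
    rw [hL, hD, Real.mul_rpow (by positivity) (by positivity), pow_succ,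
      Real.mul_rpow (by positivity) (by norm_num)]
    ring
  have hDn : D ^ (p / n) ≤ D := by
    calc D ^ (p / n) ≤ D ^ (1 : ℝ) :=
          Real.rpow_le_rpow_of_exponent_le hD1 (by rw [div_le_one hn]; linarith)
      _ = D := Real.rpow_one D
  have hDq : D ^ (1 - p / q) ≤ 2 ^ p * D := by
    have h2p : (1 : ℝ) ≤ 2 ^ p := Real.one_le_rpow (by norm_num) hp.le
    calc D ^ (1 - p / q) ≤ D ^ (1 : ℝ) :=
          Real.rpow_le_rpow_of_exponent_le hD1 (by have : 0 ≤ p / q := by positivity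
                                                   linarith)
      _ = 1 * D := by rw [Real.rpow_one, one_mul]
      _ ≤ 2 ^ p * D := by gcongr
  have hDle : D ≤ 2 ^ p * D := by
    have h2p : (1 : ℝ) ≤ 2 ^ p := Real.one_le_rpow (by norm_num) hp.le
    nlinarith
  have hk'p : k' ^ p ≤ k ^ p := Real.rpow_le_rpow hk' hk'k hp.le
  have hDD : 2 ^ p * D * D = 2 ^ (3 * p) * (2 ^ (2 * p)) ^ j := by
    rw [hD, ← Real.rpow_natCast, ← Real.rpow_natCast, ← Real.rpow_mul (by norm_num),
      ← Real.rpow_mul (by norm_num), ← Real.rpow_add (by norm_num), ← Real.rpow_add (by norm_num),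
      ← Real.rpow_add (by norm_num)]
    congr 1
    push_cast
    ring
  have hz1 : z ^ (1 + p / n) = z ^ (p / n) * z := by
    rw [Real.rpow_add_of_nonneg hz zero_le_one (by positivity), Real.rpow_one, mul_comm]
  have hz2 : z ^ (1 + (p / n - p / q)) = z ^ (p / n) * z ^ (1 - p / q) := by
    rw [← Real.rpow_add_of_nonneg hz (by positivity) hpq]
    congr 1; ring
  have zn : 0 ≤ z ^ (p / n) := by positivity
  have zq : 0 ≤ z ^ (1 - p / q) := by positivity
  calc _ = c * (D ^ (p / n) * z ^ (p / n)) * (2 ^ p * D * (r ^ p * r⁻¹ ^ p) * (k ^ p * r ^ n * z) +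
        (k' ^ p * (D ^ (1 - p / q) * z ^ (1 - p / q)) *
          (r ^ p * ((r⁻¹ ^ p) ^ (1 - n / q) * r ^ (n * (1 - p / q)))) +
          (r ^ p * r⁻¹ ^ p) * (D * r ^ n * z))) := by
        rw [hm1, hm2, hLp, hy, hmD]; ring
    _ = c * (D ^ (p / n) * z ^ (p / n)) * (2 ^ p * D * (k ^ p * r ^ n * z) +
        (k' ^ p * (D ^ (1 - p / q) * z ^ (1 - p / q)) * r ^ n + D * r ^ n * z)) := by
        rw [hr2, hr3]; ring
    _ ≤ c * (D * z ^ (p / n)) * (2 ^ p * D * (k ^ p * r ^ n * z) +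
        (k ^ p * ((2 ^ p * D) * z ^ (1 - p / q)) * r ^ n + (2 ^ p * D) * r ^ n * z)) := by
        gcongr
    _ = c * (2 ^ p * D * D) * r ^ n * (k ^ p * (z ^ (p / n) * z) +
        k ^ p * (z ^ (p / n) * z ^ (1 - p / q)) + 1 * (z ^ (p / n) * z)) := by ring
    _ = c * (2 ^ p * D * D) * r ^ n * (k ^ p * (z ^ (p / n) * z) +
        k ^ p * (z ^ (p / n) * z ^ (1 - p / q)) + (k ^ p * (k ^ p)⁻¹) * (z ^ (p / n) * z)) := by
        rw [mul_inv_cancel₀ hkp.ne']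
    _ = _ := by rw [hDD, hz1, hz2]; ring

end Iteration

namespace LocalSolution

/-- One step of the De Giorgi iteration: from the level `k` on `closedBall x₀ t` to the level `k'`
on `closedBall x₀ s`. -/
theorem exists_level_step {N : ℕ} {p q lam Λ : ℝ} (hp : 1 < p) (hpN : p < N)
    (hNq : N < q) (hlam : 0 < lam) (hΛ : 0 ≤ Λ) :
    ∃ c : ℝ, 0 ≤ c ∧ ∀ {Ω : Set (Space N)} {x₀ : Space N} {r : ℝ} {u : Space N → ℝ}
      {Du a : Space N → Space N} {b h : Space N → ℝ},
      LocalSolution p q lam Λ Ω x₀ r u Du a b h → ∀ {s t k k' y m : ℝ}, 0 ≤ s → s < t →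
      t < 2 * r → t - s ≤ r → 0 ≤ k → k < k' → 0 ≤ y → m = y / (k' - k) ^ p →
      ∫⁻ x in closedBall x₀ t, ‖max (u x - k) 0‖ₑ ^ p ≤ ENNReal.ofReal y →
      ∫⁻ x in closedBall x₀ s, ‖max (u x - k') 0‖ₑ ^ p ≤ ENNReal.ofReal
        (c * m ^ (p / N) * ((r / (t - s) * r⁻¹) ^ p * y +
          (k' ^ p * (r⁻¹ ^ p) ^ (1 - N / q) * m ^ (1 - p / q) + r⁻¹ ^ p * m))) := by
  have hp0 : 0 < p := by linarith
  have hq0 : 0 < q := by linarith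
  have hN0 : (0 : ℝ) < N := by linarith
  have hNp : 0 < N - p := by linarith
  have hpq : 0 ≤ 1 - p / q := by rw [sub_nonneg, div_le_one hq0]; linarith
  have hτ : 0 ≤ 1 - N / q := by rw [sub_nonneg, div_le_one hq0]; linarith
  obtain ⟨C, hCt, hC⟩ := exists_sobolev_truncation_le hp hpN hNq hlam hΛ
  obtain ⟨H, hH0, hH⟩ := exists_norm_gradient_radialCutoff_le
  have hH1 : (1 : ℝ) ≤ (H + 1) ^ p := Real.one_le_rpow (by linarith) hp0.le
  refine ⟨C.toReal * (H + 1) ^ p, by positivity, ?_⟩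
  intro Ω x₀ r u Du a b h D s t k k' y m hs hst htr hts hk hkk' hy hm hY
  have hr := D.pos
  have hR : 0 < r⁻¹ := by positivity
  have hts0 : 0 < t - s := by linarith
  have hk'0 : 0 ≤ k' := hk.trans hkk'.le
  have hdk : 0 < k' - k := by linarith
  have hdkp : 0 < (k' - k) ^ p := by positivity
  have hm0 : 0 ≤ m := by rw [hm]; positivity
  set K := closedBall x₀ t with hK
  have hKm : MeasurableSet K := isClosed_closedBall.measurableSet
  set η := radialCutoff x₀ s t with hη
  have hηd : ContDiff ℝ 1 η := (contDiff_radialCutoff x₀ s t).of_le (by exact_mod_cast le_top)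
  have hηs : tsupport η ⊆ K := tsupport_radialCutoff_subset hs hst
  set L := (H + 1) * (r / (t - s)) with hL
  have hrts : 1 ≤ r / (t - s) := by rw [one_le_div hts0]; exact hts
  have hL1 : 1 ≤ L := by nlinarith
  have hηg : ∀ x, ‖gradient η x‖ ≤ L * r⁻¹ := fun x => by
    refine (hH N x₀ s t hs hst x).trans ?_
    rw [hL, mul_assoc, div_mul_eq_mul_div, mul_inv_cancel₀ hr.ne', ← div_eq_mul_one_div]
    gcongr
    linarith
  have main := hC D (hs.trans hst.le) htr hk'0 hL1 hηd (radialCutoff_nonneg x₀ s t)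
    (radialCutoff_le_one x₀ s t) hηs hηg
  have humK : AEStronglyMeasurable u (volume.restrict K) :=
    (D.sobolev.2.1 K ((closedBall_subset_ball htr).trans D.ball_subset)
      (isCompact_closedBall _ _)).1
  have hwm : ∀ z : ℝ, AEMeasurable (fun x => ‖max (u x - z) 0‖ₑ) (volume.restrict K) := fun z =>
    ((by fun_prop : Continuous fun t : ℝ => max (t - z) 0).comp_aestronglyMeasurable humK).enorm
  set A := {x | k' < u x} with hA
  set M := (volume.restrict K) A with hM
  -- Chebyshev's inequality for `{u > k'}`, where `u - k ≥ k' - k`.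
  have hMle : M ≤ ENNReal.ofReal m := by
    have h1 : ENNReal.ofReal ((k' - k) ^ p) * M ≤ ENNReal.ofReal y := by
      refine le_trans ?_ ((mul_meas_ge_le_lintegral₀ ((hwm k).pow_const p)
        (ENNReal.ofReal ((k' - k) ^ p))).trans hY)
      gcongr
      refine measure_mono fun x hx => ?_
      have hx' : k' < u x := hx
      simp only [mem_ofPred_eq]
      rw [← ENNReal.ofReal_rpow_of_nonneg hdk.le hp0.le, Real.enorm_of_nonneg (le_max_right _ _)]
      gcongr
      exact le_max_of_le_left (by linarith)
    rw [hm, ENNReal.ofReal_div_of_pos hdkp, ENNReal.le_div_iff_mul_le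
      (Or.inl (by simpa using hdkp)) (Or.inl ENNReal.ofReal_ne_top), mul_comm]
    exact h1
  have hY' : ∫⁻ x in K, ‖max (u x - k') 0‖ₑ ^ p ≤ ENNReal.ofReal y := by
    refine le_trans (lintegral_mono fun x => ?_) hY
    rw [Real.enorm_of_nonneg (le_max_right _ _), Real.enorm_of_nonneg (le_max_right _ _)]
    gcongr
  set E := (∫⁻ x, ‖η x * max (u x - k') 0‖ₑ ^ (N * p / (N - p))) ^ ((N - p) / N) with hE
  -- Hölder's inequality on `{u > k'}` gains the power `p / N` of its measure.
  have hstep : ∫⁻ x in closedBall x₀ s, ‖max (u x - k') 0‖ₑ ^ p ≤ E * M ^ (p / N) := by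
    have hpp : p < N * p / (N - p) := by rw [lt_div_iff₀ hNp]; nlinarith
    have hηm : AEMeasurable (fun x => ‖η x * max (u x - k') 0‖ₑ) (volume.restrict K) := by
      simp only [enorm_mul]
      exact hηd.continuous.enorm.measurable.aemeasurable.mul (hwm k')
    have hh := setLIntegral_rpow_le hp0 hpp hηm A
    have e1 : p / (N * p / (N - p)) = (N - p) / N := by field_simp
    have e2 : 1 - p / (N * p / (N - p)) = p / N := by field_simp; ring
    rw [e2, e1] at hh
    calc _ ≤ ∫⁻ x in closedBall x₀ s, A.indicator (fun x => ‖η x * max (u x - k') 0‖ₑ ^ p) x := by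
          refine setLIntegral_mono' isClosed_closedBall.measurableSet fun x hx => ?_
          by_cases hxA : x ∈ A
          · rw [indicator_of_mem hxA, hη, radialCutoff_eq_one hs hst hx, one_mul]
          · have hxA' : ¬ k' < u x := hxA
            rw [max_eq_right (by linarith)]
            simp [hp0]
      _ ≤ ∫⁻ x in K, A.indicator (fun x => ‖η x * max (u x - k') 0‖ₑ ^ p) x :=
          lintegral_mono_set (closedBall_subset_closedBall hst.le)
      _ ≤ ∫⁻ x in A, ‖η x * max (u x - k') 0‖ₑ ^ p ∂(volume.restrict K) :=
          lintegral_indicator_le _ _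
      _ ≤ _ := hh.trans (by
          gcongr
          exact ENNReal.rpow_le_rpow (setLIntegral_le_lintegral K _) (by positivity))
  have hle1 : L * r⁻¹ = (H + 1) * (r / (t - s) * r⁻¹) := by rw [hL]; ring
  have hq1 : 0 ≤ r / (t - s) * r⁻¹ := by positivity
  calc _ ≤ E * M ^ (p / N) := hstep
    _ ≤ C * (ENNReal.ofReal (L * r⁻¹) ^ p * ENNReal.ofReal y +
          (ENNReal.ofReal k' ^ p * (ENNReal.ofReal r⁻¹ ^ p) ^ (1 - N / q) *
            ENNReal.ofReal m ^ (1 - p / q) +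
          ENNReal.ofReal r⁻¹ ^ p * ENNReal.ofReal m)) * ENNReal.ofReal m ^ (p / N) := by
        gcongr
        exact main.trans (by gcongr)
    _ = ENNReal.ofReal (C.toReal * ((L * r⁻¹) ^ p * y +
          (k' ^ p * (r⁻¹ ^ p) ^ (1 - N / q) * m ^ (1 - p / q) + r⁻¹ ^ p * m)) * m ^ (p / N)) := by
        have hLr : 0 ≤ L * r⁻¹ := by positivity
        clear_value L
        have e1 : ENNReal.ofReal ((L * r⁻¹) ^ p * y) =
            ENNReal.ofReal (L * r⁻¹) ^ p * ENNReal.ofReal y := by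
          rw [ENNReal.ofReal_mul (p := (L * r⁻¹) ^ p) (by positivity),
            ENNReal.ofReal_rpow_of_nonneg hLr hp0.le]
        have e2 : ENNReal.ofReal (k' ^ p * (r⁻¹ ^ p) ^ (1 - N / q) * m ^ (1 - p / q)) =
            ENNReal.ofReal k' ^ p * (ENNReal.ofReal r⁻¹ ^ p) ^ (1 - N / q) *
              ENNReal.ofReal m ^ (1 - p / q) := by
          rw [ENNReal.ofReal_mul (by positivity), ENNReal.ofReal_mul (by positivity),
            ENNReal.ofReal_rpow_of_nonneg hk'0 hp0.le, ENNReal.ofReal_rpow_of_nonneg hR.le hp0.le,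
            ENNReal.ofReal_rpow_of_nonneg (by positivity) hτ,
            ENNReal.ofReal_rpow_of_nonneg hm0 hpq]
        have e3 : ENNReal.ofReal (r⁻¹ ^ p * m) = ENNReal.ofReal r⁻¹ ^ p * ENNReal.ofReal m := by
          rw [ENNReal.ofReal_mul (by positivity), ENNReal.ofReal_rpow_of_nonneg hR.le hp0.le]
        symm
        rw [ENNReal.ofReal_mul (by positivity), ENNReal.ofReal_mul ENNReal.toReal_nonneg,
          ENNReal.ofReal_add (by positivity) (by positivity),
          ENNReal.ofReal_add (by positivity) (by positivity), e1, e2, e3,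
          ENNReal.ofReal_toReal hCt, ENNReal.ofReal_rpow_of_nonneg (p := p / N) hm0 (by positivity)]
    _ ≤ _ := by
        refine ENNReal.ofReal_le_ofReal ?_
        rw [hle1, Real.mul_rpow (by positivity) hq1]
        set X := (r / (t - s) * r⁻¹) ^ p * y with hX
        set G := k' ^ p * (r⁻¹ ^ p) ^ (1 - N / q) * m ^ (1 - p / q) + r⁻¹ ^ p * m with hG
        have hG0 : 0 ≤ G := by positivity
        calc C.toReal * ((H + 1) ^ p * (r / (t - s) * r⁻¹) ^ p * y + G) * m ^ (p / N)
            = C.toReal * ((H + 1) ^ p * X + 1 * G) * m ^ (p / N) := by rw [hX]; ring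
          _ ≤ C.toReal * ((H + 1) ^ p * X + (H + 1) ^ p * G) * m ^ (p / N) := by gcongr
          _ = _ := by ring

end LocalSolution

/-! ### Upper bounds -/

/-- The level `k = K max (M, M^θ)` with `θ = p / (p + n)` makes the first energy `z = c M^p / k^p`
of the iteration small, uniformly in `M`; the exponent `θ` is the one for which the inhomogeneous
contribution `k^{-p} z^{p/n}` scales like a power of `K` alone. -/
theorem exists_level_factor {n p δ C cV μ : ℝ} (hp : 0 < p) (hn : 0 < n) (hδ : 0 < δ)
    (hC : 0 ≤ C) (hcV : 0 < cV) (hμ : 0 < μ) :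
    ∃ K : ℝ, 1 ≤ K ∧ ∀ {M k : ℝ}, 0 < M → k = K * max M (M ^ (p / (p + n))) →
      C * ((1 + (k ^ p)⁻¹) * (cV * M ^ p / k ^ p) ^ (p / n) + (cV * M ^ p / k ^ p) ^ δ) ≤ μ := by
  have hα : 0 < p / n := by positivity
  have hlim : Filter.Tendsto (fun K : ℝ => C * (2 * (cV * K ^ (-p)) ^ (p / n) +
      (cV * K ^ (-p)) ^ δ)) Filter.atTop (nhds 0) := by
    have h0 : Filter.Tendsto (fun K : ℝ => cV * K ^ (-p)) Filter.atTop (nhds 0) := by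
      simpa using (tendsto_rpow_neg_atTop hp).const_mul cV
    have h1 := h0.rpow_const (p := p / n) (Or.inr hα.le)
    have h2 := h0.rpow_const (p := δ) (Or.inr hδ.le)
    rw [Real.zero_rpow hα.ne'] at h1
    rw [Real.zero_rpow hδ.ne'] at h2
    simpa using ((h1.const_mul 2).add h2).const_mul C
  obtain ⟨K, hK1, hK⟩ := ((Filter.eventually_ge_atTop (1 : ℝ)).and
    (hlim.eventually_le_const hμ)).exists
  refine ⟨K, hK1, fun {M k} hM hk => le_trans ?_ hK⟩
  have hK0 : 0 < K := by linarith
  have hX : 0 < max M (M ^ (p / (p + n))) := lt_max_of_lt_left hM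
  have hk0 : 0 < k := by rw [hk]; positivity
  have hkM : K * M ≤ k := by rw [hk]; gcongr; exact le_max_left _ _
  have hkM' : K * M ^ (p / (p + n)) ≤ k := by rw [hk]; gcongr; exact le_max_right _ _
  have hz : cV * M ^ p / k ^ p ≤ cV * K ^ (-p) := by
    rw [div_le_iff₀ (by positivity), mul_assoc]
    gcongr
    calc M ^ p = K ^ (-p) * (K * M) ^ p := by
          rw [Real.mul_rpow hK0.le hM.le, ← mul_assoc, ← Real.rpow_add hK0]; simp
      _ ≤ K ^ (-p) * k ^ p := by gcongr
  have hz0 : 0 ≤ cV * M ^ p / k ^ p := by positivity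
  have h1 : (k ^ p)⁻¹ * (cV * M ^ p / k ^ p) ^ (p / n) ≤ (cV * K ^ (-p)) ^ (p / n) := by
    rw [Real.div_rpow (by positivity) (by positivity), Real.mul_rpow hcV.le (by positivity),
      Real.mul_rpow hcV.le (by positivity), ← Real.rpow_mul hM.le, ← Real.rpow_mul hk0.le,
      ← Real.rpow_mul hK0.le]
    have e : (k ^ p)⁻¹ * (cV ^ (p / n) * M ^ (p * (p / n)) / k ^ (p * (p / n))) =
        cV ^ (p / n) * (M ^ (p * (p / n)) / k ^ (p + p * (p / n))) := by
      rw [Real.rpow_add hk0]; field_simp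
    rw [e]
    gcongr
    rw [div_le_iff₀ (by positivity)]
    calc M ^ (p * (p / n)) = K ^ (-(p + p * (p / n))) *
          (K * M ^ (p / (p + n))) ^ (p + p * (p / n)) := by
          rw [Real.mul_rpow hK0.le (by positivity), ← mul_assoc, ← Real.rpow_add hK0,
            ← Real.rpow_mul hM.le]
          simp only [neg_add_cancel, Real.rpow_zero, one_mul]
          congr 1
          field_simp
          ring
      _ ≤ K ^ (-p * (p / n)) * k ^ (p + p * (p / n)) := by
          gcongr
          linarith
  calc _ = C * ((cV * M ^ p / k ^ p) ^ (p / n) + (k ^ p)⁻¹ * (cV * M ^ p / k ^ p) ^ (p / n) +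
        (cV * M ^ p / k ^ p) ^ δ) := by ring
    _ ≤ C * ((cV * K ^ (-p)) ^ (p / n) + (cV * K ^ (-p)) ^ (p / n) + (cV * K ^ (-p)) ^ δ) := by
        gcongr
    _ = _ := by ring

namespace LocalSolution

/-- De Giorgi's theorem for the positive part: an `L^p` bound of size `M` on `closedBall x₀ (3r/2)`
gives the bound `u ≤ K max (M, M^θ)` on `closedBall x₀ r`, with `θ = p / (p + N)`. -/
theorem exists_ae_le {N : ℕ} {p q lam Λ cV : ℝ} (hp : 1 < p) (hpN : p < N)
    (hNq : N < q) (hlam : 0 < lam) (hΛ : 0 ≤ Λ) (hcV : 0 < cV) :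
    ∃ K : ℝ, 1 ≤ K ∧ ∀ {Ω : Set (Space N)} {x₀ : Space N} {r : ℝ} {u : Space N → ℝ}
      {Du a : Space N → Space N} {b h : Space N → ℝ},
      LocalSolution p q lam Λ Ω x₀ r u Du a b h → ∀ {M : ℝ}, 0 < M →
      ∫⁻ x in closedBall x₀ (3 / 2 * r), ‖u x‖ₑ ^ p ≤
        ENNReal.ofReal (cV * M ^ p * r ^ (N : ℝ)) →
      ∀ᵐ x ∂(volume.restrict (closedBall x₀ r)), u x ≤ K * max M (M ^ (p / (p + N))) := by
  have hp0 : 0 < p := by linarith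
  have hq0 : 0 < q := by linarith
  have hN0 : (0 : ℝ) < N := by linarith
  have hδ : 0 < p / N - p / q := sub_pos.2 (div_lt_div_of_pos_left hp0 hN0 hNq)
  obtain ⟨c, hc0, hstep⟩ := exists_level_step hp hpN hNq hlam hΛ
  have hb : (1 : ℝ) ≤ 2 ^ (2 * p) := Real.one_le_rpow (by norm_num) (by positivity)
  have hb0 : (0 : ℝ) < 2 ^ (2 * p) := by positivity
  set μ : ℝ := (2 ^ (2 * p)) ^ (-(p / N - p / q)⁻¹) with hμ
  have hμ0 : 0 < μ := by positivity
  -- The ratio `μ` is chosen so that `b μ^δ = 1` for `b = 2^{2p}` and `δ = p/N - p/q`.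
  have hbδ : 2 ^ (2 * p) * μ ^ (p / N - p / q) = 1 := by
    rw [hμ, ← Real.rpow_mul hb0.le, neg_mul, inv_mul_cancel₀ hδ.ne', Real.rpow_neg_one,
      mul_inv_cancel₀ hb0.ne']
  have hμ1 : μ < 1 :=
    Real.rpow_lt_one_of_one_lt_of_neg (Real.one_lt_rpow (by norm_num) (by positivity))
      (by simpa using hδ)
  have hbα : 2 ^ (2 * p) * μ ^ (p / N) ≤ 1 := by
    rw [← hbδ]
    gcongr 2 ^ (2 * p) * ?_
    exact Real.rpow_le_rpow_of_exponent_ge hμ0 hμ1.le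
      (sub_le_self _ (by positivity))
  obtain ⟨K, hK1, hK⟩ := exists_level_factor (n := N) (C := c * 2 ^ (3 * p)) hp0 hN0 hδ
    (by positivity) hcV hμ0
  refine ⟨K, hK1, ?_⟩
  intro Ω x₀ r u Du a b h D M hM hM'
  have hr := D.pos
  obtain ⟨k, hk⟩ : ∃ k, k = K * max M (M ^ (p / (p + N))) := ⟨_, rfl⟩
  have hsmall := hK hM hk
  have hk0 : 0 < k := by
    rw [hk]
    have : 0 < max M (M ^ (p / (p + N))) := lt_max_of_lt_left hM
    positivity
  rw [← hk]
  set z := cV * M ^ p / k ^ p with hz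
  have hz0 : 0 ≤ z := by positivity
  have hkp : 0 < k ^ p := by positivity
  -- Radii `r (1 + 2^{-(j+1)})` decrease from `3r/2` to `r`, levels `k (1 - 2^{-j})` grow from `0` to
  -- `k`, and the energies decay like `μ^j`.
  have hiter : ∀ j : ℕ, ∫⁻ x in closedBall x₀ (r * (1 + (1 / 2) ^ (j + 1))),
      ‖max (u x - k * (1 - (1 / 2) ^ j)) 0‖ₑ ^ p ≤
        ENNReal.ofReal (k ^ p * r ^ (N : ℝ) * (μ ^ j * z)) := by
    intro j
    induction j with
    | zero =>
      have e1 : r * (1 + (1 / 2) ^ (0 + 1)) = 3 / 2 * r := by ring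
      have e2 : k ^ p * r ^ (N : ℝ) * (μ ^ 0 * z) = cV * M ^ p * r ^ (N : ℝ) := by
        rw [hz]; field_simp
      rw [e1, e2]
      refine le_trans (lintegral_mono fun x => ?_) hM'
      gcongr
      rw [pow_zero, sub_self, mul_zero, sub_zero, Real.enorm_of_nonneg (le_max_right _ _),
        Real.enorm_eq_ofReal_abs]
      exact ENNReal.ofReal_le_ofReal (max_le (le_abs_self _) (abs_nonneg _))
    | succ j ih =>
      have hj : (0 : ℝ) < (1 / 2) ^ (j + 1) := by positivity
      have hj1 : ((1 : ℝ) / 2) ^ (j + 1) ≤ 1 := pow_le_one₀ (by norm_num) (by norm_num)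
      have hj' : ((1 : ℝ) / 2) ^ (j + 1) = (1 / 2) ^ j * (1 / 2) := pow_succ _ _
      have hj2 : ((1 : ℝ) / 2) ^ (j + 1 + 1) = (1 / 2) ^ (j + 1) * (1 / 2) := pow_succ _ _
      have hj3 : ((1 : ℝ) / 2) ^ j ≤ 1 := pow_le_one₀ (by norm_num) (by norm_num)
      have hd : k * (1 - (1 / 2) ^ (j + 1)) - k * (1 - (1 / 2) ^ j) = k / 2 ^ (j + 1) := by
        rw [show k / 2 ^ (j + 1) = k * (1 / 2) ^ (j + 1) by rw [one_div, inv_pow]; rfl, hj']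
        ring
      have hs : r * (1 + (1 / 2) ^ (j + 1)) - r * (1 + (1 / 2) ^ (j + 1 + 1)) =
          r * (1 / 2) ^ (j + 2) := by
        rw [show j + 2 = j + 1 + 1 from rfl, hj2]; ring
      have hL : r / (r * (1 + (1 / 2) ^ (j + 1)) - r * (1 + (1 / 2) ^ (j + 1 + 1))) =
          2 ^ (j + 2) := by
        rw [hs, one_div, inv_pow]; field_simp
      have step := hstep D (s := r * (1 + (1 / 2) ^ (j + 1 + 1)))
        (t := r * (1 + (1 / 2) ^ (j + 1))) (k := k * (1 - (1 / 2) ^ j))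
        (k' := k * (1 - (1 / 2) ^ (j + 1))) (y := k ^ p * r ^ (N : ℝ) * (μ ^ j * z))
        (by positivity) (by rw [hj2]; linarith [mul_pos hr hj])
        (by rw [mul_comm 2 r]; gcongr; linarith [show ((1 : ℝ) / 2) ^ (j + 1) < 1 from
              pow_lt_one₀ (by norm_num) (by norm_num) (by simp)])
        (by rw [hs]; exact mul_le_of_le_one_right hr.le (pow_le_one₀ (by norm_num) (by norm_num)))
        (by have := sub_nonneg.2 hj3; positivity) (by rw [← sub_pos, hd]; positivity)
        (by positivity) rfl ih
      refine step.trans (ENNReal.ofReal_le_ofReal ?_)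
      refine (level_estimate_dimensionless hp0 hpN hNq hc0 hr hk0
        (by have := sub_nonneg.2 hj1; positivity) (by nlinarith) (by positivity) j rfl
        (by rw [hd]) hL).trans ?_
      exact mul_le_mul_of_nonneg_left (deGiorgi_recursion_le (by positivity) hb0.le (by positivity)
        (by positivity) hδ hμ0 hz0 hbα hbδ.le hsmall j) (by positivity)
  have hzero : ∫⁻ x in closedBall x₀ r, ‖max (u x - k) 0‖ₑ ^ p = 0 := by
    have hlim : Filter.Tendsto (fun j : ℕ => ENNReal.ofReal (k ^ p * r ^ (N : ℝ) * (μ ^ j * z)))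
        Filter.atTop (nhds 0) := by
      have h1 := (((tendsto_pow_atTop_nhds_zero_of_lt_one hμ0.le hμ1).mul_const z).const_mul
        (k ^ p * r ^ (N : ℝ)))
      simpa using ENNReal.tendsto_ofReal h1
    refine le_antisymm (ge_of_tendsto' hlim fun j => le_trans ?_ (hiter j)) zero_le
    have hj : (0 : ℝ) < r * (1 / 2) ^ (j + 1) := by positivity
    have hkj : (0 : ℝ) < k * (1 / 2) ^ j := by positivity
    refine (lintegral_mono fun x => ?_).trans
      (lintegral_mono_set (closedBall_subset_closedBall (by linarith)))
    gcongr
    rw [Real.enorm_of_nonneg (le_max_right _ _), Real.enorm_of_nonneg (le_max_right _ _)]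
    gcongr
    linarith
  have hum : AEStronglyMeasurable u (volume.restrict (closedBall x₀ r)) :=
    (D.sobolev.2.1 _ ((closedBall_subset_ball (by linarith)).trans D.ball_subset)
      (isCompact_closedBall _ _)).1
  have hwm : AEMeasurable (fun x => ‖max (u x - k) 0‖ₑ ^ p) (volume.restrict (closedBall x₀ r)) :=
    (((by fun_prop : Continuous fun t : ℝ => max (t - k) 0).comp_aestronglyMeasurable
      hum).enorm).pow_const p
  filter_upwards [(lintegral_eq_zero_iff' hwm).1 hzero] with x hx
  have hx' : ‖max (u x - k) 0‖ₑ ^ p = 0 := hx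
  have h0 : max (u x - k) 0 = 0 := by
    rcases (ENNReal.rpow_eq_zero_iff.1 hx') with h | h
    · simpa using h.1
    · linarith [h.2]
  linarith [max_eq_right_iff.1 h0]

end LocalSolution

/-! ### Local boundedness -/

theorem IsWeakGradient.neg {N : ℕ} {Ω : Set (Space N)} {u : Space N → ℝ}
    {Du : Space N → Space N} (h : IsWeakGradient Ω u Du) :
    IsWeakGradient Ω (fun x => -u x) (fun x => -Du x) := by
  refine ⟨h.1.neg, h.2.1.neg, fun φ h1 h2 h3 => ?_⟩
  simp only [neg_smul, smul_neg, integral_neg]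
  rw [h.2.2 φ h1 h2 h3]

theorem MemW1pLoc.neg {N : ℕ} {p : ℝ} {Ω : Set (Space N)} {u : Space N → ℝ}
    {Du : Space N → Space N} (h : MemW1pLoc p Ω u Du) :
    MemW1pLoc p Ω (fun x => -u x) (fun x => -Du x) :=
  ⟨h.1.neg, fun K h1 h2 => (h.2.1 K h1 h2).neg, fun K h1 h2 => (h.2.2 K h1 h2).neg⟩

namespace LocalSolution

variable {N : ℕ} {p q lam Λ : ℝ} {Ω : Set (Space N)} {x₀ : Space N} {r : ℝ} {u : Space N → ℝ}
  {Du a : Space N → Space N} {b h : Space N → ℝ}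

/-- The structure conditions are invariant under `u ↦ -u`, which reduces bounds for `|u|` to upper
bounds for `u`. -/
theorem neg (D : LocalSolution p q lam Λ Ω x₀ r u Du a b h) :
    LocalSolution p q lam Λ Ω x₀ r (fun x => -u x) (fun x => -Du x) (fun x => -a x)
      (fun x => -b x) h where
  sobolev := D.sobolev.neg
  pos := D.pos
  ball_subset := D.ball_subset
  weak φ h1 h2 h3 := by
    obtain ⟨i1, i2⟩ := D.weak φ h1 h2 h3
    have e : (fun x => inner ℝ (-a x) (gradient φ x) - -b x * φ x) =
        fun x => -(inner ℝ (a x) (gradient φ x) - b x * φ x) := by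
      funext x; rw [inner_neg_left]; ring
    rw [e]
    exact ⟨i1.neg, by rw [integral_neg, i2, neg_zero]⟩
  aestronglyMeasurable_weight := D.aestronglyMeasurable_weight
  weight_nonneg := D.weight_nonneg
  weight_le := D.weight_le
  coercive := by simpa only [norm_neg, abs_neg, inner_neg_neg] using D.coercive
  growth_a := by simpa only [norm_neg, abs_neg] using D.growth_a
  growth_b := by simpa only [norm_neg, abs_neg] using D.growth_b

/-- The local boundedness estimate in terms of the `L^β` average over `ball x₀ (2 * r)`. -/
theorem exists_eLpNorm_top_le {N : ℕ} {p q β lam Λ : ℝ} (hp : 1 < p) (hpN : p < N)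
    (hβ : p < β) (hNq : N < q) (hlam : 0 < lam) (hΛ : 0 ≤ Λ) :
    ∃ K : ℝ, 0 < K ∧ ∀ {Ω : Set (Space N)} {x₀ : Space N} {r : ℝ} {u : Space N → ℝ}
      {Du a : Space N → Space N} {b h : Space N → ℝ},
      LocalSolution p q lam Λ Ω x₀ r u Du a b h →
      eLpNorm u ⊤ (volume.restrict (ball x₀ r)) ≤ ENNReal.ofReal K *
        max ((⨍⁻ x in ball x₀ (2 * r), ‖u x‖ₑ ^ β ∂volume) ^ (1 / β))
          ((⨍⁻ x in ball x₀ (2 * r), ‖u x‖ₑ ^ β ∂volume) ^ (p / (p + N) / β)) := by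
  have hp0 : 0 < p := by linarith
  have hβ0 : 0 < β := by linarith
  have hN0 : (0 : ℝ) < N := by linarith
  have hV1 : volume (ball (0 : Space N) 1) ≠ ⊤ := measure_ball_lt_top.ne
  have hV0 : 0 < (volume (ball (0 : Space N) 1)).toReal :=
    ENNReal.toReal_pos (measure_ball_pos _ _ one_pos).ne' hV1
  obtain ⟨K, hK1, hK⟩ := exists_ae_le (cV := 2 ^ (N : ℝ) * (volume (ball (0 : Space N) 1)).toReal)
    hp hpN hNq hlam hΛ (by positivity)
  have hK0 : 0 < K := by linarith
  refine ⟨K, hK0, ?_⟩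
  intro Ω x₀ r u Du a b h D
  have hr := D.pos
  set V := ball x₀ (2 * r) with hV
  set I := ⨍⁻ x in V, ‖u x‖ₑ ^ β ∂volume with hI
  have hVtop : volume V ≠ ⊤ := measure_ball_lt_top.ne
  have hVpos : volume V ≠ 0 := (measure_ball_pos _ _ (by linarith)).ne'
  have hint : ∫⁻ x in V, ‖u x‖ₑ ^ β = volume V * I := (measure_mul_setLAverage _ hVtop).symm
  have hum : AEMeasurable (fun x => ‖u x‖ₑ) (volume.restrict V) :=
    (D.sobolev.1.1.aestronglyMeasurable.mono_measure
      (Measure.restrict_mono D.ball_subset le_rfl)).enorm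
  have hsub : ball x₀ r ⊆ V := ball_subset_ball (by linarith)
  rcases eq_or_ne I ⊤ with hIt | hIt
  · have : I ^ (1 / β) = ⊤ := by rw [hIt, ENNReal.top_rpow_of_pos (by positivity)]
    rw [this, max_eq_left le_top, ENNReal.mul_top (by simpa using hK0)]
    exact le_top
  rcases eq_or_ne I 0 with hI0 | hI0
  · rw [hI0, mul_zero, lintegral_eq_zero_iff' (hum.pow_const β)] at hint
    have h0 : u =ᵐ[volume.restrict (ball x₀ r)] 0 := by
      filter_upwards [ae_restrict_of_ae_restrict_of_subset hsub hint] with x hx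
      have hx' : ‖u x‖ₑ ^ β = 0 := hx
      rcases ENNReal.rpow_eq_zero_iff.1 hx' with h | h
      · simpa using h.1
      · linarith [h.2]
    rw [eLpNorm_congr_ae h0, eLpNorm_zero]
    exact zero_le
  have hIβt : I ^ (1 / β) ≠ ⊤ := ENNReal.rpow_ne_top_of_nonneg (by positivity) hIt
  have hIβ0 : I ^ (1 / β) ≠ 0 := by
    rw [Ne, ENNReal.rpow_eq_zero_iff]
    rintro (⟨h, -⟩ | ⟨h, -⟩)
    exacts [hI0 h, hIt h]
  set M := (I ^ (1 / β)).toReal with hM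
  have hM0 : 0 < M := ENNReal.toReal_pos hIβ0 hIβt
  have hMI : ENNReal.ofReal M = I ^ (1 / β) := ENNReal.ofReal_toReal hIβt
  have hvol : volume V = ENNReal.ofReal
      (2 ^ (N : ℝ) * (volume (ball (0 : Space N) 1)).toReal * r ^ (N : ℝ)) := by
    rw [hV, Measure.addHaar_ball_of_pos volume x₀ (by positivity), finrank_euclideanSpace_fin,
      ENNReal.ofReal_mul (by positivity), ENNReal.ofReal_mul (by positivity),
      ENNReal.ofReal_toReal hV1, mul_pow, ENNReal.ofReal_mul (by positivity),
      Real.rpow_natCast, Real.rpow_natCast]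
    ring
  have hmain : ∫⁻ x in closedBall x₀ (3 / 2 * r), ‖u x‖ₑ ^ p ≤ ENNReal.ofReal
      (2 ^ (N : ℝ) * (volume (ball (0 : Space N) 1)).toReal * M ^ p * r ^ (N : ℝ)) := by
    have hh := setLIntegral_rpow_le hp0 hβ hum univ
    rw [Measure.restrict_univ, hint, Measure.restrict_apply_univ,
      ENNReal.mul_rpow_of_nonneg _ _ (by positivity)] at hh
    calc _ ≤ ∫⁻ x in V, ‖u x‖ₑ ^ p := lintegral_mono_set (closedBall_subset_ball (by linarith))
      _ ≤ _ := hh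
      _ = (volume V ^ (p / β) * volume V ^ (1 - p / β)) * I ^ (p / β) := by ring
      _ = volume V * ENNReal.ofReal (M ^ p) := by
          rw [← ENNReal.rpow_add _ _ hVpos hVtop, add_sub_cancel, ENNReal.rpow_one,
            ← ENNReal.ofReal_rpow_of_nonneg hM0.le hp0.le, hMI, ← ENNReal.rpow_mul]
          congr 2
          ring
      _ = _ := by
          rw [hvol, ← ENNReal.ofReal_mul (by positivity)]
          congr 1
          ring
  have hup := hK D hM0 hmain
  have hlow := hK D.neg hM0 (by simpa only [enorm_neg] using hmain)
  have hbd : ∀ᵐ x ∂(volume.restrict (ball x₀ r)), ‖u x‖ ≤ K * max M (M ^ (p / (p + N))) := by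
    filter_upwards [ae_restrict_of_ae_restrict_of_subset ball_subset_closedBall hup,
      ae_restrict_of_ae_restrict_of_subset ball_subset_closedBall hlow] with x h1 h2
    rw [Real.norm_eq_abs, abs_le]
    exact ⟨by linarith, h1⟩
  rw [eLpNorm_exponent_top]
  refine (eLpNormEssSup_le_of_ae_bound hbd).trans_eq ?_
  rw [ENNReal.ofReal_mul hK0.le, ENNReal.ofReal_max,
    ← ENNReal.ofReal_rpow_of_pos hM0, hMI, ← ENNReal.rpow_mul]
  congr 3
  ring

end LocalSolution

/-! ### From the structure conditions to local solutions -/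

section Data

variable {N : ℕ} {Ω V : Set (Space N)} {f : Space N → ℝ}

theorem normOn_nonneg (s : ℝ≥0∞) (V : Set (Space N)) (f : Space N → ℝ) : 0 ≤ normOn s V f :=
  ENNReal.toReal_nonneg

theorem ae_abs_le_of_normOn_top_le {B : ℝ} (hf : MemLp f ⊤ (volume.restrict V))
    (hB : normOn ⊤ V f ≤ B) : ∀ᵐ x ∂(volume.restrict V), |f x| ≤ B := by
  filter_upwards [ae_le_eLpNormEssSup (f := f) (μ := volume.restrict V)] with x hx
  rw [← eLpNorm_exponent_top] at hx
  have := ENNReal.toReal_mono hf.2.ne hx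
  rw [toReal_enorm, Real.norm_eq_abs] at this
  exact this.trans hB

/-- If `|f|^{1/s}` is measured in `L^q`, a bound `n r^{-sτ}` for `f` in `L^{q/s}` becomes a bound
`n^{1/s} r^{-τ}`. -/
theorem eLpNorm_abs_rpow_inv_le {s q n r τ : ℝ} (hs : 0 < s) (hq : 0 < q) (hr : 0 < r)
    (hn : 0 ≤ n) (hf : MemLp f (ENNReal.ofReal (q / s)) (volume.restrict V))
    (h : r ^ (s * τ) * normOn (ENNReal.ofReal (q / s)) V f ≤ n) :
    eLpNorm (fun x => |f x| ^ s⁻¹) (ENNReal.ofReal q) (volume.restrict V) ≤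
      ENNReal.ofReal (n ^ s⁻¹ * r ^ (-τ)) := by
  have e : ENNReal.ofReal q * ENNReal.ofReal s⁻¹ = ENNReal.ofReal (q / s) := by
    rw [← ENNReal.ofReal_mul hq.le, div_eq_mul_inv]
  have h1 := eLpNorm_norm_rpow (p := ENNReal.ofReal q) (μ := volume.restrict V) f
    (inv_pos.2 hs)
  simp only [Real.norm_eq_abs] at h1
  rw [h1, e, ← ENNReal.ofReal_toReal hf.2.ne]
  rw [ENNReal.ofReal_rpow_of_nonneg ENNReal.toReal_nonneg (by positivity)]
  refine ENNReal.ofReal_le_ofReal ?_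
  have h2 : normOn (ENNReal.ofReal (q / s)) V f ≤ n * r ^ (-(s * τ)) := by
    rw [Real.rpow_neg hr.le, ← div_eq_mul_inv, le_div_iff₀ (by positivity), mul_comm]
    exact h
  calc _ ≤ (n * r ^ (-(s * τ))) ^ s⁻¹ := Real.rpow_le_rpow (normOn_nonneg _ _ _) h2 (by positivity)
    _ = _ := by
        rw [Real.mul_rpow hn (by positivity), ← Real.rpow_mul hr.le]
        congr 2
        field_simp

end Data

/-- The single weight `h` that dominates the coefficients `a₁, b₂` and `c₂` on `V`: there
`a₁, b₂ ≤ h^p` and `c₂ ≤ h^{p-1}`. -/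
noncomputable def coefficientWeight {N : ℕ} (p : ℝ) (V : Set (Space N)) (a₁ b₂ c₂ : Space N → ℝ) :
    Space N → ℝ :=
  V.indicator fun x => |a₁ x| ^ p⁻¹ + |b₂ x| ^ p⁻¹ + |c₂ x| ^ (p - 1)⁻¹

section Weight

variable {N : ℕ} {p q : ℝ} {V : Set (Space N)} {a₁ b₂ c₂ : Space N → ℝ}

theorem coefficientWeight_nonneg (x : Space N) : 0 ≤ coefficientWeight p V a₁ b₂ c₂ x :=
  indicator_nonneg (fun _ _ => by positivity) x

theorem abs_le_coefficientWeight_rpow (hp : 1 < p) {x : Space N} (hx : x ∈ V) :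
    |a₁ x| ≤ coefficientWeight p V a₁ b₂ c₂ x ^ p ∧ |b₂ x| ≤ coefficientWeight p V a₁ b₂ c₂ x ^ p ∧
      |c₂ x| ≤ coefficientWeight p V a₁ b₂ c₂ x ^ (p - 1) := by
  have hp1 : 0 < p - 1 := by linarith
  have key : ∀ {s y z : ℝ}, 0 < s → 0 ≤ y → y ^ s⁻¹ ≤ z → y ≤ z ^ s := fun {s y z} hs hy h => by
    calc y = (y ^ s⁻¹) ^ s := by rw [← Real.rpow_mul hy, inv_mul_cancel₀ hs.ne', Real.rpow_one]
      _ ≤ z ^ s := by gcongr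
  have h1 : 0 ≤ |a₁ x| ^ p⁻¹ := by positivity
  have h2 : 0 ≤ |b₂ x| ^ p⁻¹ := by positivity
  have h3 : 0 ≤ |c₂ x| ^ (p - 1)⁻¹ := by positivity
  rw [coefficientWeight, indicator_of_mem hx]
  exact ⟨key (by linarith) (abs_nonneg _) (by linarith),
    key (by linarith) (abs_nonneg _) (by linarith), key hp1 (abs_nonneg _) (by linarith)⟩

theorem aestronglyMeasurable_coefficientWeight (hV : MeasurableSet V)
    (ha₁ : AEStronglyMeasurable a₁ (volume.restrict V))
    (hb₂ : AEStronglyMeasurable b₂ (volume.restrict V))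
    (hc₂ : AEStronglyMeasurable c₂ (volume.restrict V)) :
    AEStronglyMeasurable (coefficientWeight p V a₁ b₂ c₂) volume := by
  rw [coefficientWeight, aestronglyMeasurable_indicator_iff hV]
  exact (((ha₁.norm.aemeasurable.pow_const p⁻¹).add (hb₂.norm.aemeasurable.pow_const p⁻¹)).add
    (hc₂.norm.aemeasurable.pow_const (p - 1)⁻¹)).aestronglyMeasurable

/-- The scaling-invariant `L^q` bound for the weight. -/
theorem lintegral_coefficientWeight_rpow_le {n r τ : ℝ} (hp : 1 < p) (hq : 1 ≤ q) (hr : 0 < r)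
    (hn : 0 ≤ n) (hτ : 0 < τ) (hV : MeasurableSet V)
    (ha₁ : MemLp a₁ (ENNReal.ofReal (q / p)) (volume.restrict V))
    (hb₂ : MemLp b₂ (ENNReal.ofReal (q / p)) (volume.restrict V))
    (hc₂ : MemLp c₂ (ENNReal.ofReal (q / (p - 1))) (volume.restrict V))
    (ha₁n : r ^ (p * τ) * normOn (ENNReal.ofReal (q / p)) V a₁ ≤ n)
    (hb₂n : r ^ (p * τ) * normOn (ENNReal.ofReal (q / p)) V b₂ ≤ n)
    (hc₂n : r ^ ((p - 1) * τ) * normOn (ENNReal.ofReal (q / (p - 1))) V c₂ ≤ n) :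
    (∫⁻ x, ‖coefficientWeight p V a₁ b₂ c₂ x‖ₑ ^ q) ^ (p / q) ≤
      ENNReal.ofReal ((n ^ p⁻¹ + n ^ p⁻¹ + n ^ (p - 1)⁻¹) ^ (p / τ) * r⁻¹ ^ p) ^ τ := by
  have hp0 : 0 < p := by linarith
  have hp1 : 0 < p - 1 := by linarith
  have hq0 : 0 < q := by linarith
  have hq0' : ENNReal.ofReal q ≠ 0 := by simpa using hq0
  have hq1' : 1 ≤ ENNReal.ofReal q := by simpa using hq
  have hm : ∀ {f : Space N → ℝ} {s : ℝ}, AEStronglyMeasurable f (volume.restrict V) →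
      AEStronglyMeasurable (fun x => |f x| ^ s) (volume.restrict V) := fun hf =>
    (hf.norm.aemeasurable.pow_const _).aestronglyMeasurable
  set W := n ^ p⁻¹ + n ^ p⁻¹ + n ^ (p - 1)⁻¹ with hW
  have hW0 : 0 ≤ W := by positivity
  have hnorm : eLpNorm (coefficientWeight p V a₁ b₂ c₂) (ENNReal.ofReal q) volume ≤
      ENNReal.ofReal (W * r ^ (-τ)) := by
    rw [coefficientWeight, eLpNorm_indicator_eq_eLpNorm_restrict hV]
    refine (eLpNorm_add_le ((hm ha₁.1).add (hm hb₂.1)) (hm hc₂.1) hq1').trans ?_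
    refine (add_le_add (eLpNorm_add_le (hm ha₁.1) (hm hb₂.1) hq1') le_rfl).trans ?_
    rw [hW, add_mul, add_mul, ENNReal.ofReal_add (by positivity) (by positivity),
      ENNReal.ofReal_add (by positivity) (by positivity)]
    exact add_le_add (add_le_add (eLpNorm_abs_rpow_inv_le hp0 hq0 hr hn ha₁ ha₁n)
      (eLpNorm_abs_rpow_inv_le hp0 hq0 hr hn hb₂ hb₂n))
      (eLpNorm_abs_rpow_inv_le hp1 hq0 hr hn hc₂ hc₂n)
  rw [eLpNorm_eq_lintegral_rpow_enorm_toReal hq0' ENNReal.ofReal_ne_top,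
    ENNReal.toReal_ofReal hq0.le] at hnorm
  calc _ = ((∫⁻ x, ‖coefficientWeight p V a₁ b₂ c₂ x‖ₑ ^ q) ^ (1 / q)) ^ p := by
        rw [← ENNReal.rpow_mul]; congr 1; ring
    _ ≤ ENNReal.ofReal (W * r ^ (-τ)) ^ p := by gcongr
    _ = _ := by
        rw [ENNReal.ofReal_rpow_of_nonneg (by positivity) hp0.le,
          ENNReal.ofReal_rpow_of_nonneg (by positivity) hτ.le,
          Real.mul_rpow hW0 (by positivity), Real.mul_rpow (by positivity) (by positivity),
          ← Real.rpow_mul hW0, Real.inv_rpow hr.le, ← Real.rpow_neg hr.le, ← Real.rpow_mul hr.le,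
          ← Real.rpow_mul hr.le]
        congr 2
        · congr 1; field_simp
        · congr 1; ring

end Weight

/-- A weak solution whose data norms over `ball x₀ (2 * r)` are at most `n` is a local solution
with a constant `Λ` that depends on `n`, `p`, `q` and `N` only. -/
theorem exists_localSolution {N : ℕ} {p q β : ℝ} (hp : 1 < p) (hpN : p < N) (hNq : N < q)
    {n : ℝ} (hn : 0 ≤ n) :
    ∃ Λ : ℝ, 0 ≤ Λ ∧ ∀ {lam : ℝ} {Ω : Set (Space N)} {A : Space N → ℝ → Space N → Space N}
      {B : Space N → ℝ → Space N → ℝ} {a₁ a₂ b₁ b₂ b₃ c₁ c₂ c₃ : Space N → ℝ}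
      {u : Space N → ℝ} {Du : Space N → Space N} {x₀ : Space N} {r : ℝ},
      StructureS1 p lam Ω A a₁ a₂ → StructureS2 p Ω B b₁ b₂ b₃ → StructureS3 p Ω A c₁ c₂ c₃ →
      MemLp b₁ ⊤ (volume.restrict Ω) →
      MemLp a₁ (ENNReal.ofReal (q / p)) (volume.restrict Ω) →
      MemLp b₂ (ENNReal.ofReal (q / p)) (volume.restrict Ω) →
      MemLp a₂ ⊤ (volume.restrict Ω) → MemLp b₃ ⊤ (volume.restrict Ω) →
      MemLp c₁ ⊤ (volume.restrict Ω) →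
      MemLp c₂ (ENNReal.ofReal (q / (p - 1))) (volume.restrict Ω) →
      MemLp c₃ ⊤ (volume.restrict Ω) →
      MemW1pLoc p Ω u Du → IsWeakSolution Ω A B u Du → 0 < r → ball x₀ (2 * r) ⊆ Ω →
      (∀ i, dataNorms p q β r (ball x₀ (2 * r)) a₁ a₂ b₁ b₂ b₃ c₁ c₂ c₃ i ≤ n) →
      LocalSolution p q lam Λ Ω x₀ r u Du (fun x => A x (u x) (Du x)) (fun x => B x (u x) (Du x))
        (coefficientWeight p (ball x₀ (2 * r)) a₁ b₂ c₂) := by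
  have hp0 : 0 < p := by linarith
  have hp1 : 0 < p - 1 := by linarith
  have hN0 : (0 : ℝ) < N := by linarith
  have hq0 : 0 < q := by linarith
  have hτ : 0 < 1 - N / q := by rw [sub_pos, div_lt_one hq0]; exact hNq
  set W := (n ^ p⁻¹ + n ^ p⁻¹ + n ^ (p - 1)⁻¹) ^ (p / (1 - N / q)) with hW
  have hW0 : 0 ≤ W := by positivity
  refine ⟨n + W, by positivity, ?_⟩
  intro lam Ω A B a₁ a₂ b₁ b₂ b₃ c₁ c₂ c₃ u Du x₀ r hS1 hS2 hS3 hb₁ ha₁ hb₂ ha₂ hb₃ hc₁ hc₂ hc₃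
    hu hsol hr hball hdata
  set V := ball x₀ (2 * r) with hV
  set h := coefficientWeight p V a₁ b₂ c₂ with hh
  have hVm : MeasurableSet V := measurableSet_ball
  have hres : volume.restrict V ≤ volume.restrict Ω := Measure.restrict_mono hball le_rfl
  have hrp : 0 < r ^ p := by positivity
  have hri : r⁻¹ ^ p = (r ^ p)⁻¹ := Real.inv_rpow hr.le p
  have hri' : r⁻¹ ^ (p - 1) = (r ^ (p - 1))⁻¹ := Real.inv_rpow hr.le (p - 1)
  have d0 : r * normOn ⊤ V b₁ ≤ n := hdata 0
  have d1 : normOn ⊤ V c₁ ≤ n := hdata 1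
  have d2 : r ^ (p * (1 - N / q)) * normOn (ENNReal.ofReal (q / p)) V a₁ ≤ n := hdata 2
  have d3 : r ^ (p * (1 - N / q)) * normOn (ENNReal.ofReal (q / p)) V b₂ ≤ n := hdata 3
  have d4 : r ^ ((p - 1) * (1 - N / q)) * normOn (ENNReal.ofReal (q / (p - 1))) V c₂ ≤ n :=
    hdata 4
  have d5 : r ^ p * normOn ⊤ V a₂ ≤ n := le_trans (le_add_of_nonneg_left
    (mul_nonneg (by positivity) (normOn_nonneg _ _ _))) (hdata 5)
  have d6 : r ^ p * normOn ⊤ V b₃ ≤ n := le_trans (le_add_of_nonneg_left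
    (mul_nonneg (by positivity) (normOn_nonneg _ _ _))) (hdata 6)
  have d7 : r ^ (p - 1) * normOn ⊤ V c₃ ≤ n := le_trans (le_add_of_nonneg_left
    (mul_nonneg (by positivity) (normOn_nonneg _ _ _))) (hdata 7)
  have hle : ∀ {s t : ℝ}, 0 < s → s * t ≤ n → t ≤ (n + W) * s⁻¹ := fun {s t} hs ht => by
    rw [← div_eq_mul_inv, le_div_iff₀ hs, mul_comm]
    linarith
  have e0 := ae_abs_le_of_normOn_top_le (hb₁.mono_measure hres) (hle hr d0)
  have e1 := ae_abs_le_of_normOn_top_le (hc₁.mono_measure hres) (d1.trans (by linarith :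
    n ≤ n + W))
  have e5 := ae_abs_le_of_normOn_top_le (ha₂.mono_measure hres) (hle hrp d5)
  have e6 := ae_abs_le_of_normOn_top_le (hb₃.mono_measure hres) (hle hrp d6)
  have e7 := ae_abs_le_of_normOn_top_le (hc₃.mono_measure hres)
    (hle (Real.rpow_pos_of_pos hr (p - 1)) d7)
  have hh0 : ∀ x, 0 ≤ h x := fun x => coefficientWeight_nonneg x
  have hV' : ∀ᵐ x ∂(volume.restrict V), x ∈ V := ae_restrict_mem hVm
  refine
    { sobolev := hu
      pos := hr
      ball_subset := hball
      weak := fun φ h1 h2 h3 => ?_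
      aestronglyMeasurable_weight := aestronglyMeasurable_coefficientWeight hVm
        (ha₁.mono_measure hres).1 (hb₂.mono_measure hres).1 (hc₂.mono_measure hres).1
      weight_nonneg := hh0
      weight_le := ?_
      coercive := ?_
      growth_a := ?_
      growth_b := ?_ }
  · obtain ⟨i1, i2, i3⟩ := hsol φ h1 h2 (h3.trans hball)
    have hφ : ∀ x, x ∉ Ω → φ x = 0 := fun x hx =>
      image_eq_zero_of_notMem_tsupport fun hx' => hx (hball (h3 hx'))
    have hφ' : ∀ x, x ∉ Ω → gradient φ x = 0 := fun x hx =>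
      gradient_eq_zero_of_notMem_tsupport fun hx' => hx (hball (h3 hx'))
    have hz : ∀ x, x ∉ Ω → (inner ℝ (A x (u x) (Du x)) (gradient φ x) -
        B x (u x) (Du x) * φ x : ℝ) = 0 := fun x hx => by rw [hφ x hx, hφ' x hx]; simp
    refine ⟨(integrableOn_iff_integrable_of_support_subset fun x hx => ?_).1 (i1.sub i2), ?_⟩
    · by_contra hx'
      exact hx (hz x hx')
    · rw [← setIntegral_eq_integral_of_forall_compl_eq_zero hz, integral_sub i1 i2, i3, sub_self]
  · refine (lintegral_coefficientWeight_rpow_le hp (by linarith) hr hn hτ hVm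
      (ha₁.mono_measure hres) (hb₂.mono_measure hres) (hc₂.mono_measure hres) d2 d3 d4).trans ?_
    gcongr
    linarith
  · filter_upwards [ae_restrict_of_ae_restrict_of_subset hball hS1, e5, hV'] with x hs h5 hx
    have hw := (abs_le_coefficientWeight_rpow (a₁ := a₁) (b₂ := b₂) (c₂ := c₂) hp hx).1
    have hs' := hs (u x) (Du x)
    have k1 : a₁ x * |u x| ^ p ≤ h x ^ p * |u x| ^ p := by
      gcongr
      exact (le_abs_self _).trans hw
    rw [Real.mul_rpow (hh0 x) (abs_nonneg _), hri]
    linarith [le_abs_self (a₂ x)]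
  · filter_upwards [ae_restrict_of_ae_restrict_of_subset hball hS3, e1, e7, hV'] with x hs h1 h7 hx
    have hw := (abs_le_coefficientWeight_rpow (a₁ := a₁) (b₂ := b₂) (c₂ := c₂) hp hx).2.2
    have hs' := hs (u x) (Du x)
    have k1 : c₂ x * |u x| ^ (p - 1) ≤ h x ^ (p - 1) * |u x| ^ (p - 1) := by
      gcongr
      exact (le_abs_self _).trans hw
    have k2 : c₁ x * ‖Du x‖ ^ (p - 1) ≤ (n + W) * ‖Du x‖ ^ (p - 1) := by
      gcongr
      exact (le_abs_self _).trans h1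
    rw [Real.mul_rpow (hh0 x) (abs_nonneg _), hri']
    linarith [le_abs_self (c₃ x)]
  · filter_upwards [ae_restrict_of_ae_restrict_of_subset hball hS2, e0, e6, hV'] with x hs h0 h6 hx
    have hw := (abs_le_coefficientWeight_rpow (a₁ := a₁) (b₂ := b₂) (c₂ := c₂) hp hx).2.1
    have hs' := hs (u x) (Du x)
    have hpow : h x * h x ^ (p - 1) = h x ^ p := by
      have := Real.rpow_add_of_nonneg (hh0 x) zero_le_one hp1.le
      rw [Real.rpow_one, add_sub_cancel] at this
      exact this.symm
    have k1 : b₂ x * |u x| ^ (p - 1) ≤ h x ^ p * |u x| ^ (p - 1) := by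
      gcongr
      exact (le_abs_self _).trans hw
    have k2 : b₁ x * ‖Du x‖ ^ (p - 1) ≤ (n + W) * r⁻¹ * ‖Du x‖ ^ (p - 1) := by
      gcongr
      exact (le_abs_self _).trans h0
    rw [Real.mul_rpow (hh0 x) (abs_nonneg _), ← mul_assoc, hpow, hri]
    linarith [le_abs_self (b₃ x)]

/-! ### The estimate -/

theorem theorem2p6 (N : ℕ) (p β : ℝ) (hp : 1 < p) (hpN : p < N) (hβ : p < β) :
    ∃ θ₀ : ℝ, 0 < θ₀ ∧ θ₀ ≤ 1 ∧
      ∀ (q lam : ℝ), (N : ℝ) < q → 0 < lam →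
        ∃ C : (Fin 8 → ℝ) → ℝ, Monotone C ∧ (∀ d, 0 < C d) ∧
          ∀ (Ω : Set (Space N)) (A : Space N → ℝ → Space N → Space N)
            (B : Space N → ℝ → Space N → ℝ)
            (a₁ a₂ b₁ b₂ b₃ c₁ c₂ c₃ : Space N → ℝ)
            (u : Space N → ℝ) (Du : Space N → Space N) (x₀ : Space N) (r : ℝ),
            IsOpen Ω →
            IsCaratheodory Ω A → IsCaratheodory Ω B →
            (∀ᵐ x ∂(volume.restrict Ω), 0 ≤ a₁ x ∧ 0 ≤ a₂ x ∧ 0 ≤ b₁ x ∧ 0 ≤ b₂ x ∧ 0 ≤ b₃ x) →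
            StructureS1 p lam Ω A a₁ a₂ →
            StructureS2 p Ω B b₁ b₂ b₃ →
            StructureS3 p Ω A c₁ c₂ c₃ →
            MemLp b₁ ∞ (volume.restrict Ω) →
            MemLp a₁ (ENNReal.ofReal (q / p)) (volume.restrict Ω) →
            MemLp b₂ (ENNReal.ofReal (q / p)) (volume.restrict Ω) →
            MemLp a₂ (ENNReal.ofReal (β / p)) (volume.restrict Ω) →
            MemLp a₂ ∞ (volume.restrict Ω) →
            MemLp b₃ (ENNReal.ofReal (β / (p - 1))) (volume.restrict Ω) →
            MemLp b₃ ∞ (volume.restrict Ω) →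
            MemLp c₁ ∞ (volume.restrict Ω) →
            MemLp c₂ (ENNReal.ofReal (q / (p - 1))) (volume.restrict Ω) →
            MemLp c₃ (ENNReal.ofReal (β / p)) (volume.restrict Ω) →
            MemLp c₃ ∞ (volume.restrict Ω) →
            MemW1pLoc p Ω u Du →
            MemLpLoc (ENNReal.ofReal β) Ω u →
            IsWeakSolution Ω A B u Du →
            0 < r → ball x₀ (2 * r) ⊆ Ω →
            eLpNorm u ∞ (volume.restrict (ball x₀ r)) ≤
              ENNReal.ofReal (C (dataNorms p q β r (ball x₀ (2 * r)) a₁ a₂ b₁ b₂ b₃ c₁ c₂ c₃)) *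
                max ((⨍⁻ x in ball x₀ (2 * r), ‖u x‖ₑ ^ β ∂volume) ^ (1 / β))
                  ((⨍⁻ x in ball x₀ (2 * r), ‖u x‖ₑ ^ β ∂volume) ^ (θ₀ / β)) := by
  have hp0 : 0 < p := by linarith
  have hN0 : (0 : ℝ) < N := by linarith
  refine ⟨p / (p + N), by positivity, by rw [div_le_one (by positivity)]; linarith, ?_⟩
  intro q lam hNq hlam
  have hK : ∀ n : ℕ, ∃ K : ℝ, 0 < K ∧ ∀ (Ω : Set (Space N)) (A : Space N → ℝ → Space N → Space N)
      (B : Space N → ℝ → Space N → ℝ) (a₁ a₂ b₁ b₂ b₃ c₁ c₂ c₃ : Space N → ℝ)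
      (u : Space N → ℝ) (Du : Space N → Space N) (x₀ : Space N) (r : ℝ),
      StructureS1 p lam Ω A a₁ a₂ → StructureS2 p Ω B b₁ b₂ b₃ → StructureS3 p Ω A c₁ c₂ c₃ →
      MemLp b₁ ⊤ (volume.restrict Ω) →
      MemLp a₁ (ENNReal.ofReal (q / p)) (volume.restrict Ω) →
      MemLp b₂ (ENNReal.ofReal (q / p)) (volume.restrict Ω) →
      MemLp a₂ ⊤ (volume.restrict Ω) → MemLp b₃ ⊤ (volume.restrict Ω) →
      MemLp c₁ ⊤ (volume.restrict Ω) →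
      MemLp c₂ (ENNReal.ofReal (q / (p - 1))) (volume.restrict Ω) →
      MemLp c₃ ⊤ (volume.restrict Ω) →
      MemW1pLoc p Ω u Du → IsWeakSolution Ω A B u Du → 0 < r → ball x₀ (2 * r) ⊆ Ω →
      (∀ i, dataNorms p q β r (ball x₀ (2 * r)) a₁ a₂ b₁ b₂ b₃ c₁ c₂ c₃ i ≤ n) →
      eLpNorm u ⊤ (volume.restrict (ball x₀ r)) ≤ ENNReal.ofReal K *
        max ((⨍⁻ x in ball x₀ (2 * r), ‖u x‖ₑ ^ β ∂volume) ^ (1 / β))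
          ((⨍⁻ x in ball x₀ (2 * r), ‖u x‖ₑ ^ β ∂volume) ^ (p / (p + N) / β)) := by
    intro n
    obtain ⟨Λ, hΛ, h1⟩ := exists_localSolution (β := β) hp hpN hNq n.cast_nonneg
    obtain ⟨K, hK0, h2⟩ := LocalSolution.exists_eLpNorm_top_le hp hpN hβ hNq hlam hΛ
    refine ⟨K, hK0, ?_⟩
    intro Ω A B a₁ a₂ b₁ b₂ b₃ c₁ c₂ c₃ u Du x₀ r hS1 hS2 hS3 hb₁ ha₁ hb₂ ha₂ hb₃ hc₁ hc₂ hc₃ hu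
      hsol hr hball hdata
    exact h2 (h1 hS1 hS2 hS3 hb₁ ha₁ hb₂ ha₂ hb₃ hc₁ hc₂ hc₃ hu hsol hr hball hdata)
  choose K hK0 hK using hK
  -- Summing the constants over all integers up to a bound for the data makes them monotone.
  refine ⟨fun d => ∑ m ∈ Finset.range (∑ i, ⌈d i⌉₊ + 1), K m, fun d d' hd => ?_, fun d => ?_, ?_⟩
  · refine Finset.sum_le_sum_of_subset_of_nonneg (Finset.range_mono ?_) fun m _ _ => (hK0 m).le
    exact Nat.add_le_add_right (Finset.sum_le_sum fun i _ => Nat.ceil_mono (hd i)) 1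
  · exact Finset.sum_pos (fun m _ => hK0 m) (by simp)
  · intro Ω A B a₁ a₂ b₁ b₂ b₃ c₁ c₂ c₃ u Du x₀ r _ _ _ _ hS1 hS2 hS3 hb₁ ha₁ hb₂ _ ha₂ _ hb₃ hc₁
      hc₂ _ hc₃ hu _ hsol hr hball
    set d := dataNorms p q β r (ball x₀ (2 * r)) a₁ a₂ b₁ b₂ b₃ c₁ c₂ c₃ with hd
    refine (hK (∑ i, ⌈d i⌉₊) Ω A B a₁ a₂ b₁ b₂ b₃ c₁ c₂ c₃ u Du x₀ r hS1 hS2 hS3 hb₁ ha₁ hb₂ ha₂ hb₃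
      hc₁ hc₂ hc₃ hu hsol hr hball fun i => ?_).trans ?_
    · refine (Nat.le_ceil (d i)).trans ?_
      exact_mod_cast Finset.single_le_sum (f := fun i => ⌈d i⌉₊) (fun _ _ => Nat.zero_le _)
        (Finset.mem_univ i)
    · gcongr
      exact Finset.single_le_sum (f := K) (fun m _ => (hK0 m).le)
        (Finset.mem_range.2 (Nat.lt_succ_self _))
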